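/- For a sequence $a=(a_0,a_1,\dots)$ of real numbers let $\mathrm{LTT}(a)$ be the infinite lower-triangular Toeplitz matrix whose $(i,j)$ entry is $a_{i-j}$ if $i\ge j$ and $0$ otherwise, let $M_{\mathrm{count}}=\mathrm{LTT}(1,1,1,\dots)$, and let $[A]_n$ be the submatrix of the first $n$ rows and columns of $A$. For a finite matrix $A$ let $\lVert A\rVert_{1\to2}$ be the maximal Euclidean norm of a column of $A$, and $\lVert A\rVert_{2\to\infty}$ the maximal Euclidean norm of a row of $A$. **Theorem.** For every real $\alpha>0$ there are infinite lower-triangular Toeplitz matrices $L,R$ with real entries such that 1. *(Joint validity)* $[L]_n[R]_n=[M_{\mathrm{count}}]_n$ for all $n$; 2. *(Bounded sensitivity)* $\lim_{n\to\infty}\lVert [R]_n\rVert_{1\to2}=C<\infty$, where $C$ is a computable real number; 3. *(Near-optimal asymptotic error)* $\lVert [L]_n\rVert_{2\to\infty}=O(\log^{1+\alpha} n)$ as $n\to\infty$; 4. *(Computability)* there is an unbounded streaming algorithm, which does not know the number of time steps, that for any real sequence $y$ with entries that can be queried in constant time outputs $(Ly)_t$ at each time step $t=1,2,\dots$, using $O(t)$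 memory and amortized $O(\log t)$ time, that is, $O(t\log t)$ time in total for the first $t\ge2$ outputs, with constants that do not depend on $y$. The algorithm is a fixed program for a random access machine that has integer registers holding integers of size $O(t)$ and memory cells holding exact numbers, with unit-cost integer arithmetic, real constants, field operations and square roots on numbers. Moreover, such factors can be given explicitly. For $\gamma,\delta\in\mathbb R$ the function $$f(z;\gamma,\delta)=\frac1{\sqrt{1-z}}\Big(\frac1z\ln\frac1{1-z}\Big)^{\gamma}\Big(\frac2z\ln\Big(\frac1z\ln\frac1{1-z}\Big)\Big)^{\delta},\qquad f(0;\gamma,\delta)=1,$$ with principal branches is considered on the open unit disc. For every $\alpha>0$ and every $\delta\ge0$ (the choice $\delta=0$ leaves out the log-log factor) both $f(z;\tfrac12+\alpha,-\delta)$ and $f(z;-\tfrac12-\alpha,\delta)$ are given on the whole open unit disc by power series with real coefficients $(l_n)$ and $(r_n)$ respectively, and $L=\mathrm{LTT}(l_0,l_1,\dots)$, $R=\mathrm{LTT}(r_0,r_1,\dots)$ satisfy 1, 3 and 4, and $\lim_{n\to\infty}\lVert[R]_n\rVert_{1\to2}=C$ for some finite $C$, which is a computable real number whenever $\alpha$ and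 $\delta$ are computable. -/

import Mathlib

open Filter Topology Asymptotics

noncomputable section

/-! ## Lower-triangular Toeplitz matrices -/

/-- The infinite lower-triangular Toeplitz matrix of the sequence `a`:
its `(i, j)` entry is `a (i - j)` for `i ≥ j` and `0` otherwise. -/
def ltt (a : ℕ → ℝ) : Matrix ℕ ℕ ℝ :=
  Matrix.of fun i j => if j ≤ i then a (i - j) else 0

/-- `A` is an infinite lower-triangular Toeplitz matrix. -/
def IsLTToeplitz (A : Matrix ℕ ℕ ℝ) : Prop := ∃ a : ℕ → ℝ, A = ltt a

/-- The all-ones lower-triangular matrix. -/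
def Mcount : Matrix ℕ ℕ ℝ := ltt fun _ => 1

/-- `[A]_n`, the submatrix of the first `n` rows and columns. -/
def leading (n : ℕ) (A : Matrix ℕ ℕ ℝ) : Matrix (Fin n) (Fin n) ℝ :=
  A.submatrix Fin.val Fin.val

/-- The `1 → 2` norm: the maximal Euclidean norm of a column. -/
def colNorm {n : ℕ} (A : Matrix (Fin n) (Fin n) ℝ) : ℝ :=
  ⨆ j, √(∑ i, A i j ^ 2)

/-- The `2 → ∞` norm: the maximal Euclidean norm of a row. -/
def rowNorm {n : ℕ} (A : Matrix (Fin n) (Fin n) ℝ) : ℝ :=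
  ⨆ i, √(∑ j, A i j ^ 2)

/-- The entry `(A y)_t` for a lower-triangular `A` (rows and columns counted from `0`). -/
def ltMulVec (A : Matrix ℕ ℕ ℝ) (y : ℕ → ℝ) (t : ℕ) : ℝ :=
  ∑ j ∈ Finset.range (t + 1), A t j * y j

/-! ## The generating functions -/

/-- `(1 - z)^(-1/2) * ((1/z) ln (1/(1-z)))^γ * ((2/z) ln ((1/z) ln (1/(1-z))))^δ` on the open
unit disc, with the removable singularity at `0` filled by the value `1`.
All powers and logarithms are principal branches. -/
def singularFn (γ δ : ℝ) (z : ℂ) : ℂ :=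
  if z = 0 then 1
  else
    (1 - z) ^ (-(1 / 2) : ℂ)
      * (1 / z * Complex.log (1 / (1 - z))) ^ (γ : ℂ)
      * (2 / z * Complex.log (1 / z * Complex.log (1 / (1 - z)))) ^ (δ : ℂ)

/-- `a` is the sequence of Taylor coefficients at `0` of `f`, and the Taylor series represents
`f` on the whole open unit disc (in particular `f` is analytic there). -/
def IsTaylorOnDisc (f : ℂ → ℂ) (a : ℕ → ℝ) : Prop :=
  ∀ z : ℂ, ‖z‖ < 1 → HasSum (fun n => (a n : ℂ) * z ^ n) (f z)

/-! ## Computable real numbers -/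

/-- `x` is a computable real number: an algorithm produces, for every `n`, a dyadic rational
`f n / 2 ^ n` at distance at most `2 ^ (-n)` from `x`. -/
def IsComputableReal (x : ℝ) : Prop :=
  ∃ f : ℕ → ℤ, Computable f ∧ ∀ n : ℕ, |x - (f n : ℝ) / 2 ^ n| ≤ 1 / 2 ^ n

/-! ## A random access machine with exact arithmetic

Programs are finite. They use integer registers, and arrays whose cells hold exact complex
numbers. Every operation on integers or numbers, every read and every write costs one unit of
time. There is no conversion from numbers to integers (no rounding), and no branching on numbers,
so a number never influences the control flow or an address.
A fixed sequence `y` can be queried at a cost of one unit per entry. -/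

namespace RAM

/-- Integer expressions. -/
inductive IExp : Type
  | const (n : ℕ)
  | reg (x : ℕ)
  | add (a b : IExp)
  | sub (a b : IExp)
  | mul (a b : IExp)
  | div (a b : IExp)
  | mod (a b : IExp)

/-- The value of an integer expression when the registers hold `ρ`. -/
def IExp.eval (ρ : ℕ → ℕ) : IExp → ℕ
  | .const n => n
  | .reg x => ρ x
  | .add a b => a.eval ρ + b.eval ρ
  | .sub a b => a.eval ρ - b.eval ρ
  | .mul a b => a.eval ρ * b.eval ρ
  | .div a b => a.eval ρ / b.eval ρ
  | .mod a b => a.eval ρ % b.eval ρ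

/-- The time needed to evaluate an integer expression: one unit per node. -/
def IExp.cost : IExp → ℕ
  | .const _ => 1
  | .reg _ => 1
  | .add a b => a.cost + b.cost + 1
  | .sub a b => a.cost + b.cost + 1
  | .mul a b => a.cost + b.cost + 1
  | .div a b => a.cost + b.cost + 1
  | .mod a b => a.cost + b.cost + 1

/-- Number expressions: real constants of the program, integers read as numbers, cell `i` of the
array `k`, entry `i` of the queried sequence, the field operations, and the principal square
root. -/
inductive NExp : Type
  | const (c : ℝ)
  | ofInt (i : IExp)
  | cell (k : ℕ) (i : IExp)
  | query (i : IExp)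
  | add (a b : NExp)
  | sub (a b : NExp)
  | mul (a b : NExp)
  | div (a b : NExp)
  | sqrt (a : NExp)

/-- The value of a number expression when the sequence `y` can be queried, the registers hold `ρ`
and the arrays hold `μ`. -/
def NExp.eval (y : ℕ → ℝ) (ρ : ℕ → ℕ) (μ : ℕ → ℕ → ℂ) : NExp → ℂ
  | .const c => (c : ℂ)
  | .ofInt i => (i.eval ρ : ℂ)
  | .cell k i => μ k (i.eval ρ)
  | .query i => (y (i.eval ρ) : ℂ)
  | .add a b => a.eval y ρ μ + b.eval y ρ μ
  | .sub a b => a.eval y ρ μ - b.eval y ρ μ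
  | .mul a b => a.eval y ρ μ * b.eval y ρ μ
  | .div a b => a.eval y ρ μ / b.eval y ρ μ
  | .sqrt a => Complex.sqrt (a.eval y ρ μ)

/-- The time needed to evaluate a number expression: one unit per node. -/
def NExp.cost : NExp → ℕ
  | .const _ => 1
  | .ofInt i => i.cost + 1
  | .cell _ i => i.cost + 1
  | .query i => i.cost + 1
  | .add a b => a.cost + b.cost + 1
  | .sub a b => a.cost + b.cost + 1
  | .mul a b => a.cost + b.cost + 1
  | .div a b => a.cost + b.cost + 1
  | .sqrt a => a.cost + 1

/-- The largest address that is read when a number expression is evaluated. -/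
def NExp.maxAddr (ρ : ℕ → ℕ) : NExp → ℕ
  | .const _ => 0
  | .ofInt _ => 0
  | .cell _ i => i.eval ρ
  | .query i => i.eval ρ
  | .add a b => max (a.maxAddr ρ) (b.maxAddr ρ)
  | .sub a b => max (a.maxAddr ρ) (b.maxAddr ρ)
  | .mul a b => max (a.maxAddr ρ) (b.maxAddr ρ)
  | .div a b => max (a.maxAddr ρ) (b.maxAddr ρ)
  | .sqrt a => a.maxAddr ρ

/-- Programs. -/
inductive Cmd : Type
  /-- do nothing -/
  | skip
  /-- integer register `x` becomes `e` -/
  | setReg (x : ℕ) (e : IExp)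
  /-- cell `i` of the array `k` becomes `e` -/
  | setCell (k : ℕ) (i : IExp) (e : NExp)
  /-- `c` and then `d` -/
  | seq (c d : Cmd)
  /-- `c` if `a < b`, otherwise `d` -/
  | ite (a b : IExp) (c d : Cmd)
  /-- repeat `c` as long as `a < b` -/
  | loop (a b : IExp) (c : Cmd)

/-- A configuration of the machine, with two counters: `time` is the time used so far, and `peak`
is a bound for every address accessed and every integer stored so far. A program mentions finitely
many registers and arrays, so it has used at most a constant times `peak + 1` words of memory,
each of them a number or an integer that is at most `peak`. -/
structure State where
  reg : ℕ → ℕ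
  mem : ℕ → ℕ → ℂ
  time : ℕ
  peak : ℕ

/-- The configuration at the start: everything is zero. -/
def State.init : State := ⟨fun _ => 0, fun _ _ => 0, 0, 0⟩

/-- Spend `c` units of time, and note that addresses or integers up to `p` occurred. -/
def State.tick (s : State) (c p : ℕ) : State :=
  { s with time := s.time + c, peak := max s.peak p }

/-- The configuration after a write to a register. -/
def State.setReg (s : State) (x v : ℕ) : State :=
  { s with reg := Function.update s.reg x v }

/-- The configuration after a write to a cell. -/
def State.setCell (s : State) (k i : ℕ) (v : ℂ) : State :=
  { s with mem := Function.update s.mem k (Function.update (s.mem k) i v) }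

/-- `Exec y c s s'`: with queries to `y`, the program `c` started in `s` halts in `s'`. -/
inductive Exec (y : ℕ → ℝ) : Cmd → State → State → Prop
  | skip (s : State) : Exec y .skip s (s.tick 1 0)
  | setReg (s : State) (x : ℕ) (e : IExp) :
      Exec y (.setReg x e) s
        ((s.setReg x (e.eval s.reg)).tick (e.cost + 1) (e.eval s.reg))
  | setCell (s : State) (k : ℕ) (i : IExp) (e : NExp) :
      Exec y (.setCell k i e) s
        ((s.setCell k (i.eval s.reg) (e.eval y s.reg s.mem)).tick
          (i.cost + e.cost + 1) (max (i.eval s.reg) (e.maxAddr s.reg)))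
  | seq {c d : Cmd} {s s' s'' : State} :
      Exec y c s s' → Exec y d s' s'' → Exec y (.seq c d) s s''
  | ite_true {a b : IExp} {c d : Cmd} {s s' : State} :
      a.eval s.reg < b.eval s.reg → Exec y c (s.tick (a.cost + b.cost + 1) 0) s' →
        Exec y (.ite a b c d) s s'
  | ite_false {a b : IExp} {c d : Cmd} {s s' : State} :
      ¬ a.eval s.reg < b.eval s.reg → Exec y d (s.tick (a.cost + b.cost + 1) 0) s' →
        Exec y (.ite a b c d) s s'
  | loop_true {a b : IExp} {c : Cmd} {s s' s'' : State} :
      a.eval s.reg < b.eval s.reg → Exec y c (s.tick (a.cost + b.cost + 1) 0) s' →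
        Exec y (.loop a b c) s' s'' → Exec y (.loop a b c) s s''
  | loop_false {a b : IExp} {c : Cmd} {s : State} :
      ¬ a.eval s.reg < b.eval s.reg →
        Exec y (.loop a b c) s (s.tick (a.cost + b.cost + 1) 0)

end RAM

/-- There is an unbounded streaming algorithm for `t ↦ (A y)_t` with memory `O(t)` and amortized
time `O(log t)`: one program is run once per time step, each time from the configuration that the
previous step left, and leaves the next entry of `A y` in cell `0` of array `0`. After the first
`t + 1` steps the total time is at most `K (t + 1) log (t + 2)` and the memory at most
`K (t + 1)`. The program and `K` do not depend on `y`, and the number of steps is not known to the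
program. -/
def IsStreamable (A : Matrix ℕ ℕ ℝ) : Prop :=
  ∃ (P : RAM.Cmd) (K : ℝ), ∀ y : ℕ → ℝ, ∃ s : ℕ → RAM.State,
    s 0 = RAM.State.init ∧
    ∀ t : ℕ,
      RAM.Exec y P (s t) (s (t + 1)) ∧
      (s (t + 1)).mem 0 0 = (ltMulVec A y t : ℂ) ∧
      ((s (t + 1)).time : ℝ) ≤ K * (t + 1) * Real.log (t + 2) ∧
      ((s (t + 1)).peak : ℝ) ≤ K * (t + 1)

/-- `L`, `R` is a factorization of the all-ones lower-triangular matrix such that the sensitivity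
of `R` converges to `C`, the row norms of `L` are `O(log^(1+α) n)`, and `L y` can be streamed with
`O(t)` memory and amortized `O(log t)` time. -/
def IsGoodFactorization (α : ℝ) (L R : Matrix ℕ ℕ ℝ) (C : ℝ) : Prop :=
  (∀ n : ℕ, leading n L * leading n R = leading n Mcount) ∧
  Tendsto (fun n : ℕ => colNorm (leading n R)) atTop (𝓝 C) ∧
  (fun n : ℕ => rowNorm (leading n L)) =O[atTop] (fun n : ℕ => Real.log n ^ (1 + α)) ∧
  IsStreamable L

end

/-! The product of f(z;γ,δ) and f(z;-γ,-δ) is 1/(1-z), so the two coefficient sequences convolve to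
the constant sequence 1; this is joint validity. The proof reads it off the differential equation F'
= cF of f, since the two logarithmic derivatives add up to 1/(1-z) (`mk_singularSeq_mul_neg`).

Analyticity. Put g = (1/z) ln(1/(1-z)) and h = (2/z) ln g. On the plane slit along [1, ∞) neither g
nor h takes a value in (-∞, 0], so their principal powers are holomorphic there
(`logQuot_mem_slitPlane`, `logLogQuot_mem_slitPlane`).

Size. Asymptotics of single coefficients are not needed. On the unit disc |f'|² is at most a
constant times |1-z|⁻³ times the power β of 1 + ln(2/|1-z|), where β = 2γ is allowed if δ ≤ 0 and
any β > 2γ otherwise. On the circle of radius 1 - 1/N with N = 2^k this is at most a multiple of N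
k^β / |1-z|². Comparing mean squares with the geometric series by Parseval (`HasTaylor.sum_sq_le`)
shows that the squares of the coefficients with N ≤ n < 2N sum to O(k^β) (`exists_block_sum_sq_le`).
For R one takes β = -1-α, and the blocks are summable; for L one takes β = 1+2α, and the first log n
blocks sum to O(log^(2+2α) n).

Computability of the limit. For rational parameters the coefficients are rational and primitive
recursive, uniformly in the parameters. The partial sums of squares are Lipschitz in the parameters
with an explicit constant, and the tail after 2^k terms is O(k^(-α/2)). So the required number of
terms and the required accuracy of the parameters are computable functions of the target accuracy
(`isComputableReal_sqrt_tsum_sq`).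

Streaming. Whenever the known coefficients run out, their number is doubled. One Newton step for
each of 1/g, 1/h, f and two for 1/f, with products by the fast Fourier transform, cost O(k 2^k), and
so does the recomputation of the first entries of Ly. These costs grow geometrically, so the total
is O(t log t) (`StreamInv.step`). The roots of unity come from repeated square roots of -1.

The first claim also covers an α that is not computable: it is replaced by a smaller number 1/(k+1),
with δ = 0. -/

noncomputable section

/-! ## The factors of `singularFn` on the plane slit along `[1, ∞)` -/

/-- The plane slit along `[1, ∞)`. -/
def slitDomain : Set ℂ := {z | 1 - z ∈ Complex.slitPlane}

/-- `(1/z) ln (1/(1-z))` with its removable singularity filled. -/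
def logQuot : ℂ → ℂ := dslope (fun z => -Complex.log (1 - z)) 0

/-- `(2/z) ln ((1/z) ln (1/(1-z)))` with its removable singularity filled. -/
def logLogQuot (z : ℂ) : ℂ := 2 * dslope (fun z => Complex.log (logQuot z)) 0 z

lemma isOpen_slitDomain : IsOpen slitDomain :=
  Complex.isOpen_slitPlane.preimage (by fun_prop)

lemma ball_subset_slitDomain : Metric.ball (0 : ℂ) 1 ⊆ slitDomain := by
  intro z hz
  rw [mem_ball_zero_iff] at hz
  refine Or.inl ?_
  have := (Complex.abs_re_le_norm z).trans_lt hz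
  rw [abs_lt] at this
  simp only [Complex.sub_re, Complex.one_re]
  linarith

lemma zero_mem_slitDomain : (0 : ℂ) ∈ slitDomain :=
  ball_subset_slitDomain (by simp)

lemma slitDomain_mem_nhds_zero : slitDomain ∈ 𝓝 (0 : ℂ) :=
  isOpen_slitDomain.mem_nhds zero_mem_slitDomain

lemma hasDerivAt_neg_log_one_sub {z : ℂ} (hz : z ∈ slitDomain) :
    HasDerivAt (fun z => -Complex.log (1 - z)) (1 / (1 - z)) z := by
  have := (((hasDerivAt_id z).const_sub 1).clog hz).neg
  refine this.congr_deriv ?_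
  simp only [neg_div, neg_neg, id]

lemma differentiableOn_logQuot : DifferentiableOn ℂ logQuot slitDomain :=
  (Complex.differentiableOn_dslope slitDomain_mem_nhds_zero).2 fun _ hz =>
    (hasDerivAt_neg_log_one_sub hz).differentiableAt.differentiableWithinAt

lemma logQuot_zero : logQuot 0 = 1 := by
  rw [logQuot, dslope_same, (hasDerivAt_neg_log_one_sub zero_mem_slitDomain).deriv]
  simp

lemma mul_logQuot (z : ℂ) : z * logQuot z = -Complex.log (1 - z) := by
  have := sub_smul_dslope (fun z => -Complex.log (1 - z)) 0 z
  simpa [logQuot] using this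

lemma logQuot_of_ne {z : ℂ} (hz : z ≠ 0) : logQuot z = -Complex.log (1 - z) / z := by
  rw [eq_div_iff hz, mul_comm, mul_logQuot]

/-- For φ < π/2 this is φ ≤ tan φ; beyond π/2 both terms have the right sign. -/
lemma sin_sub_mul_cos_nonneg {φ : ℝ} (h0 : 0 ≤ φ) (h1 : φ ≤ Real.pi) :
    0 ≤ Real.sin φ - φ * Real.cos φ := by
  rcases lt_or_ge φ (Real.pi / 2) with h | h
  · have hc : 0 < Real.cos φ := Real.cos_pos_of_mem_Ioo ⟨by linarith, h⟩
    have := Real.le_tan h0 h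
    rw [Real.tan_eq_sin_div_cos, le_div_iff₀ hc] at this
    linarith
  · have hc : Real.cos φ ≤ 0 :=
      Real.cos_nonpos_of_pi_div_two_le_of_le h (by linarith [Real.pi_pos])
    have := Real.sin_nonneg_of_nonneg_of_le_pi h0 h1
    nlinarith

/-- With 1 - z = r e^(-iφ) the imaginary part is φ(1 - r cos φ) + r ln r sin φ. Since r ln r ≥ r -
1, it is at least (φ - sin φ) + r(sin φ - φ cos φ), whose first term is positive and whose second is
nonnegative. -/
lemma im_neg_log_one_sub_mul_conj_pos {z : ℂ} (hz : 0 < z.im) :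
    0 < (-Complex.log (1 - z) * (starRingEnd ℂ) z).im := by
  set w := 1 - z with hw
  have hwim : w.im < 0 := by simp [hw, hz]
  have hw0 : w ≠ 0 := by rintro h; simp [h] at hwim
  have hzw : z = 1 - w := by rw [hw]; ring
  set r := ‖w‖ with hr
  set φ := -w.arg with hφ
  have hr0 : 0 < r := norm_pos_iff.2 hw0
  have harg : w.arg < 0 := Complex.arg_neg_iff.2 hwim
  have hφ0 : 0 < φ := by linarith
  have hφ1 : φ ≤ Real.pi := by linarith [Complex.neg_pi_lt_arg w]
  have hre : w.re = r * Real.cos φ := by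
    rw [hφ, Real.cos_neg, hr, Complex.norm_mul_cos_arg]
  have him : w.im = -(r * Real.sin φ) := by
    rw [hφ, Real.sin_neg, hr]
    have := Complex.norm_mul_sin_arg w
    linarith
  have hlog : r - 1 ≤ r * Real.log r := by
    have := Real.one_sub_inv_le_log_of_pos hr0
    have h2 := mul_le_mul_of_nonneg_left this hr0.le
    rwa [mul_sub, mul_one, mul_inv_cancel₀ hr0.ne'] at h2
  have hs : 0 ≤ Real.sin φ := Real.sin_nonneg_of_nonneg_of_le_pi hφ0.le hφ1
  have key : (-Complex.log w * (starRingEnd ℂ) z).im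
      = φ * (1 - r * Real.cos φ) + Real.log r * (r * Real.sin φ) := by
    rw [hzw]
    simp only [Complex.mul_im, Complex.neg_re, Complex.neg_im, Complex.log_re, Complex.log_im,
      Complex.conj_re, Complex.conj_im, Complex.sub_re, Complex.sub_im, Complex.one_re,
      Complex.one_im, hre, him, ← hr]
    rw [hφ]; ring
  rw [key]
  have h1 := sin_sub_mul_cos_nonneg hφ0.le hφ1
  have h2 := Real.sin_lt hφ0
  nlinarith [mul_nonneg hr0.le h1, mul_le_mul_of_nonneg_right hlog hs]

/-- Division by z is multiplication by its conjugate and by a positive number. Thus g preserves the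
upper half plane, which keeps it off the negative axis. -/
lemma logQuot_im_pos {z : ℂ} (hz : 0 < z.im) : 0 < (logQuot z).im := by
  have hz0 : z ≠ 0 := by rintro h; simp [h] at hz
  have h := im_neg_log_one_sub_mul_conj_pos hz
  rw [logQuot_of_ne hz0, div_eq_mul_inv, Complex.inv_def, ← mul_assoc]
  rw [Complex.im_mul_ofReal]
  have : 0 < (Complex.normSq z)⁻¹ := inv_pos.2 (Complex.normSq_pos.2 hz0)
  positivity

lemma logQuot_conj {z : ℂ} (hz : z ∈ slitDomain) :
    logQuot ((starRingEnd ℂ) z) = (starRingEnd ℂ) (logQuot z) := by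
  rcases eq_or_ne z 0 with rfl | h0
  · simp [logQuot_zero]
  · rw [logQuot_of_ne h0, logQuot_of_ne (by simpa using h0), map_div₀, map_neg]
    have : (1 - (starRingEnd ℂ) z) = (starRingEnd ℂ) (1 - z) := by simp
    rw [this, Complex.log_conj _ (Complex.mem_slitPlane_iff_arg.1 hz).1]

/-- On the real part of the slit plane, `g = logQuot x` is positive, and `g - 1` has the sign
of `x`. -/
lemma logQuot_ofReal {x : ℝ} (hx : x < 1) (hx0 : x ≠ 0) :
    ∃ g : ℝ, logQuot x = g ∧ 0 < g ∧ 0 < Real.log g / x := by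
  have h1 : 0 < 1 - x := by linarith
  have hq : logQuot x = ((-Real.log (1 - x) / x : ℝ) : ℂ) := by
    rw [logQuot_of_ne (by exact_mod_cast hx0)]
    push_cast
    rw [Complex.ofReal_log h1.le]
    push_cast; rfl
  refine ⟨_, hq, ?_⟩
  have hlt : Real.log (1 - x) < -x := by
    have := Real.log_lt_sub_one_of_pos h1 (by intro h; apply hx0; linarith)
    linarith
  rcases lt_or_gt_of_ne hx0 with h | h
  · have hl : 0 < Real.log (1 - x) := Real.log_pos (by linarith)
    have hg : 0 < -Real.log (1 - x) / x := div_pos_of_neg_of_neg (by linarith) h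
    refine ⟨hg, div_pos_of_neg_of_neg (Real.log_neg hg ?_) h⟩
    rw [div_lt_one_of_neg h]; linarith
  · have hg : 1 < -Real.log (1 - x) / x := by rw [lt_div_iff₀ h]; linarith
    exact ⟨by linarith, div_pos (Real.log_pos hg) h⟩

lemma eq_ofReal_of_im_eq_zero {z : ℂ} (h : z.im = 0) : z = (z.re : ℂ) :=
  Complex.ext (by simp) (by simp [h])

lemma re_lt_one_of_mem_slitDomain {z : ℂ} (hz : z ∈ slitDomain) (h : z.im = 0) : z.re < 1 := by
  rcases hz with h' | h'
  · simpa using h'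
  · simp [h] at h'

/-- Off the real axis g is not real, by `logQuot_im_pos` and conjugation; on the real axis it is
positive. -/
lemma logQuot_mem_slitPlane {z : ℂ} (hz : z ∈ slitDomain) : logQuot z ∈ Complex.slitPlane := by
  rcases lt_trichotomy z.im 0 with h | h | h
  · right
    have := logQuot_im_pos (z := (starRingEnd ℂ) z) (by simpa using h)
    rw [logQuot_conj hz, Complex.conj_im] at this
    linarith
  · rcases eq_or_ne z 0 with rfl | h0
    · rw [logQuot_zero]; exact Complex.one_mem_slitPlane
    · have hzr := eq_ofReal_of_im_eq_zero h
      obtain ⟨g, hg, hpos, -⟩ := logQuot_ofReal (re_lt_one_of_mem_slitDomain hz h)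
        (fun h' => h0 (by rw [hzr, h']; simp))
      rw [hzr, hg]
      left; simpa using hpos
  · exact Or.inr (logQuot_im_pos h).ne'

lemma logQuot_ne_zero {z : ℂ} (hz : z ∈ slitDomain) : logQuot z ≠ 0 :=
  Complex.slitPlane_ne_zero (logQuot_mem_slitPlane hz)

lemma mul_logLogQuot (z : ℂ) : z * logLogQuot z = 2 * Complex.log (logQuot z) := by
  have := sub_smul_dslope (fun z => Complex.log (logQuot z)) 0 z
  simp only [sub_zero, smul_eq_mul, logQuot_zero, Complex.log_one] at this
  rw [logLogQuot, mul_left_comm, this]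

lemma logLogQuot_of_ne {z : ℂ} (hz : z ≠ 0) :
    logLogQuot z = 2 * Complex.log (logQuot z) / z := by
  rw [eq_div_iff hz, mul_comm, mul_logLogQuot]

lemma differentiableAt_logQuot {z : ℂ} (hz : z ∈ slitDomain) : DifferentiableAt ℂ logQuot z :=
  (differentiableOn_logQuot z hz).differentiableAt (isOpen_slitDomain.mem_nhds hz)

lemma differentiableOn_logLogQuot : DifferentiableOn ℂ logLogQuot slitDomain := by
  refine DifferentiableOn.const_mul ?_ 2
  exact (Complex.differentiableOn_dslope slitDomain_mem_nhds_zero).2 fun z hz =>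
    ((differentiableAt_logQuot hz).clog (logQuot_mem_slitPlane hz)).differentiableWithinAt

lemma differentiableAt_logLogQuot {z : ℂ} (hz : z ∈ slitDomain) :
    DifferentiableAt ℂ logLogQuot z :=
  (differentiableOn_logLogQuot z hz).differentiableAt (isOpen_slitDomain.mem_nhds hz)

/-- `g + z g' = 1/(1-z)` for `g = logQuot`. -/
lemma logQuot_add_mul_deriv {z : ℂ} (hz : z ∈ slitDomain) :
    logQuot z + z * deriv logQuot z = 1 / (1 - z) := by
  have h1 := (hasDerivAt_id z).mul (differentiableAt_logQuot hz).hasDerivAt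
  have h2 := hasDerivAt_neg_log_one_sub hz
  have : (id * logQuot) = fun z => -Complex.log (1 - z) := funext fun z => mul_logQuot z
  rw [this] at h1
  simpa using h1.unique h2

/-- `h + z h' = 2 g'/g` for `g = logQuot` and `h = logLogQuot`. -/
lemma logLogQuot_add_mul_deriv {z : ℂ} (hz : z ∈ slitDomain) :
    logLogQuot z + z * deriv logLogQuot z = 2 * (deriv logQuot z / logQuot z) := by
  have h1 := (hasDerivAt_id z).mul (differentiableAt_logLogQuot hz).hasDerivAt
  have h2 := ((differentiableAt_logQuot hz).hasDerivAt.clog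
    (logQuot_mem_slitPlane hz)).const_mul 2
  have : (id * logLogQuot) = fun z => 2 * Complex.log (logQuot z) :=
    funext fun z => mul_logLogQuot z
  rw [this] at h1
  simpa using h1.unique h2

/-- Differentiating g + z g' = 1/(1-z) at 0 gives 2 g'(0) = 1. This is why the factor 2 in the
log-log term normalises its value at 0 to 1. -/
lemma deriv_logQuot_zero : deriv logQuot 0 = 1 / 2 := by
  have hd : DifferentiableOn ℂ (deriv logQuot) slitDomain :=
    differentiableOn_logQuot.deriv isOpen_slitDomain
  have hd0 : DifferentiableAt ℂ (deriv logQuot) 0 :=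
    (hd 0 zero_mem_slitDomain).differentiableAt slitDomain_mem_nhds_zero
  have h1 := (differentiableAt_logQuot zero_mem_slitDomain).hasDerivAt.add
    ((hasDerivAt_id (0 : ℂ)).mul hd0.hasDerivAt)
  have h2 : HasDerivAt (fun z : ℂ => 1 / (1 - z)) 1 0 := by
    have := ((hasDerivAt_id (0 : ℂ)).const_sub 1).inv (by simp)
    refine (this.congr_deriv (by simp)).congr_of_eventuallyEq (.of_forall fun z => ?_)
    simp
  have h3 : (logQuot + id * deriv logQuot) =ᶠ[𝓝 0] fun z : ℂ => 1 / (1 - z) := by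
    filter_upwards [slitDomain_mem_nhds_zero] with z hz
    exact logQuot_add_mul_deriv hz
  have := (h1.congr_of_eventuallyEq h3.symm).unique h2
  simp at this
  linear_combination this / 2

lemma logLogQuot_zero : logLogQuot 0 = 1 := by
  have := logLogQuot_add_mul_deriv zero_mem_slitDomain
  rw [logQuot_zero, deriv_logQuot_zero] at this
  simpa using this

lemma logLogQuot_conj {z : ℂ} (hz : z ∈ slitDomain) :
    logLogQuot ((starRingEnd ℂ) z) = (starRingEnd ℂ) (logLogQuot z) := by
  rcases eq_or_ne z 0 with rfl | h0
  · simp [logLogQuot_zero]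
  · rw [logLogQuot_of_ne h0, logLogQuot_of_ne (by simpa using h0), map_div₀, map_mul,
      logQuot_conj hz, Complex.log_conj _
      (Complex.mem_slitPlane_iff_arg.1 (logQuot_mem_slitPlane hz)).1, Complex.conj_ofNat]

/-- As g lies in the upper half plane, ln g has positive imaginary part. If h were real and
nonpositive, z h = 2 ln g would have nonpositive imaginary part. -/
lemma logLogQuot_mem_slitPlane_of_im_pos {z : ℂ} (hz : 0 < z.im) :
    logLogQuot z ∈ Complex.slitPlane := by
  have hg := logQuot_im_pos hz
  have hl : 0 < (Complex.log (logQuot z)).im := by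
    rw [Complex.log_im]
    rcases (Complex.arg_nonneg_iff.2 hg.le).lt_or_eq with h | h
    · exact h
    · exact absurd (Complex.arg_eq_zero_iff.1 h.symm).2 hg.ne'
  have hm := congrArg Complex.im (mul_logLogQuot z)
  by_contra hns
  rw [Complex.mem_slitPlane_iff, not_or, not_lt, not_not] at hns
  have : (2 * Complex.log (logQuot z)).im = 2 * (Complex.log (logQuot z)).im := by
    simp
  rw [this, Complex.mul_im, hns.2] at hm
  nlinarith

lemma logLogQuot_mem_slitPlane {z : ℂ} (hz : z ∈ slitDomain) :
    logLogQuot z ∈ Complex.slitPlane := by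
  rcases lt_trichotomy z.im 0 with h | h | h
  · have := logLogQuot_mem_slitPlane_of_im_pos (z := (starRingEnd ℂ) z) (by simpa using h)
    rw [logLogQuot_conj hz] at this
    rw [Complex.mem_slitPlane_iff] at this ⊢
    simpa using this
  · rcases eq_or_ne z 0 with rfl | h0
    · rw [logLogQuot_zero]; exact Complex.one_mem_slitPlane
    · have hzr := eq_ofReal_of_im_eq_zero h
      obtain ⟨g, hg, hpos, hlog⟩ := logQuot_ofReal (re_lt_one_of_mem_slitDomain hz h)
        (fun h' => h0 (by rw [hzr, h']; simp))
      rw [hzr] at h0 ⊢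
      have : logLogQuot (z.re : ℂ) = ((2 * (Real.log g / z.re) : ℝ) : ℂ) := by
        rw [logLogQuot_of_ne h0, hg]
        push_cast
        rw [Complex.ofReal_log hpos.le]; ring
      rw [this]
      left
      rw [Complex.ofReal_re]
      positivity
  · exact logLogQuot_mem_slitPlane_of_im_pos h

lemma logLogQuot_ne_zero {z : ℂ} (hz : z ∈ slitDomain) : logLogQuot z ≠ 0 :=
  Complex.slitPlane_ne_zero (logLogQuot_mem_slitPlane hz)

lemma singularFn_eq {γ δ : ℝ} {z : ℂ} (hz : z ∈ slitDomain) :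
    singularFn γ δ z
      = (1 - z) ^ (-(1 / 2) : ℂ) * logQuot z ^ (γ : ℂ) * logLogQuot z ^ (δ : ℂ) := by
  rcases eq_or_ne z 0 with rfl | h0
  · simp [singularFn, logQuot_zero, logLogQuot_zero]
  · have hlog : 1 / z * Complex.log (1 / (1 - z)) = logQuot z := by
      rw [logQuot_of_ne h0, one_div (1 - z), Complex.log_inv _
        (Complex.mem_slitPlane_iff_arg.1 hz).1]
      ring
    rw [singularFn, if_neg h0, hlog, logLogQuot_of_ne h0]
    ring_nf

/-- The logarithmic derivative of `singularFn γ δ`. -/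
def singularLogDeriv (γ δ : ℝ) (z : ℂ) : ℂ :=
  1 / 2 * (1 / (1 - z)) + γ * (deriv logQuot z / logQuot z)
    + δ * (deriv logLogQuot z / logLogQuot z)

lemma hasDerivAt_singularFn {γ δ : ℝ} {z : ℂ} (hz : z ∈ slitDomain) :
    HasDerivAt (singularFn γ δ) (singularFn γ δ z * singularLogDeriv γ δ z) z := by
  have h1 := ((hasDerivAt_id z).const_sub 1).cpow_const (c := (-(1 / 2) : ℂ)) hz
  have h2 := (differentiableAt_logQuot hz).hasDerivAt.cpow_const (c := (γ : ℂ))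
    (logQuot_mem_slitPlane hz)
  have h3 := (differentiableAt_logLogQuot hz).hasDerivAt.cpow_const (c := (δ : ℂ))
    (logLogQuot_mem_slitPlane hz)
  have h := (h1.mul h2).mul h3
  have heq : singularFn γ δ =ᶠ[𝓝 z] fun z =>
      (1 - id z) ^ (-(1 / 2) : ℂ) * logQuot z ^ (γ : ℂ) * logLogQuot z ^ (δ : ℂ) := by
    filter_upwards [isOpen_slitDomain.mem_nhds hz] with w hw
    exact singularFn_eq hw
  refine (h.congr_of_eventuallyEq heq).congr_deriv ?_
  have e1 : (1 - z) ≠ 0 := Complex.slitPlane_ne_zero hz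
  have e2 := logQuot_ne_zero hz
  have e3 := logLogQuot_ne_zero hz
  simp only [id, Pi.mul_apply]
  rw [singularFn_eq hz, singularLogDeriv, Complex.cpow_sub _ _ e1, Complex.cpow_sub _ _ e2,
    Complex.cpow_sub _ _ e3]
  simp only [Complex.cpow_one]
  field_simp

/-! ## Size of `singularFn` and its derivative on the unit disc -/

/-- A function that is continuous on the slit plane is bounded above on the unit disc if it is
bounded above near `1`. -/
lemma exists_bound_of_near_one {φ : ℂ → ℝ} (hφ : ContinuousOn φ slitDomain) {A : ℝ}
    (hA : ∀ z : ℂ, ‖z‖ < 1 → ‖1 - z‖ ≤ 1 / 8 → φ z ≤ A) :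
    ∃ C : ℝ, 0 < C ∧ ∀ z : ℂ, ‖z‖ < 1 → φ z ≤ C := by
  set S : Set ℂ := Metric.closedBall 0 1 ∩ {z | 1 / 8 ≤ ‖1 - z‖}
  have hS : IsCompact S := (isCompact_closedBall 0 1).inter_right
    (isClosed_le continuous_const (by fun_prop))
  -- The only point of the closed unit disc on the slit is 1, and it has been cut away.
  have hsub : S ⊆ slitDomain := by
    rintro z ⟨hz, hz'⟩
    by_contra hns
    simp only [slitDomain, Set.mem_ofPred_eq, Complex.mem_slitPlane_iff, not_or, not_lt, not_not,
      Complex.sub_re, Complex.one_re, Complex.sub_im, Complex.one_im] at hns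
    rw [mem_closedBall_zero_iff] at hz
    have hre : z.re = 1 := by
      have := (Complex.re_le_norm z).trans hz
      linarith [hns.1]
    have : z = 1 := Complex.ext (by simp [hre]) (by simp; linarith [hns.2])
    subst this
    norm_num at hz'
  obtain ⟨B, hB⟩ := (hS.image_of_continuousOn (hφ.mono hsub)).bddAbove
  refine ⟨max (max A B) 1, by positivity, fun z hz => ?_⟩
  rcases le_or_gt ‖1 - z‖ (1 / 8) with h | h
  · exact (hA z hz h).trans ((le_max_left _ _).trans (le_max_left _ _))
  · exact (hB ⟨z, ⟨by simpa using hz.le, h.le⟩, rfl⟩).trans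
      ((le_max_right _ _).trans (le_max_left _ _))

/-- `1 + ln (2 / x)`. -/
def logScale (x : ℝ) : ℝ := 1 + Real.log (2 / x)

lemma one_le_logScale {x : ℝ} (h0 : 0 < x) (h2 : x ≤ 2) : 1 ≤ logScale x := by
  have : 0 ≤ Real.log (2 / x) := Real.log_nonneg (by rw [le_div_iff₀ h0]; linarith)
  rw [logScale]; linarith

lemma norm_one_sub_pos {z : ℂ} (hz : ‖z‖ < 1) : 0 < ‖1 - z‖ := by
  rw [norm_pos_iff, sub_ne_zero]
  rintro rfl
  simp at hz

lemma norm_one_sub_le_two {z : ℂ} (hz : ‖z‖ < 1) : ‖1 - z‖ ≤ 2 := by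
  have := norm_sub_le (1 : ℂ) z
  rw [norm_one] at this
  linarith

lemma one_le_logScale_norm {z : ℂ} (hz : ‖z‖ < 1) : 1 ≤ logScale ‖1 - z‖ :=
  one_le_logScale (norm_one_sub_pos hz) (norm_one_sub_le_two hz)

lemma mem_slitDomain_of_norm_lt {z : ℂ} (hz : ‖z‖ < 1) : z ∈ slitDomain :=
  ball_subset_slitDomain (by simpa using hz)

lemma continuousOn_logScale : ContinuousOn (fun z : ℂ => logScale ‖1 - z‖) slitDomain := by
  unfold logScale
  refine continuousOn_const.add (ContinuousOn.log ?_ ?_)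
  · refine continuousOn_const.div (by fun_prop) fun z hz => ?_
    exact (norm_pos_iff.2 (Complex.slitPlane_ne_zero hz)).ne'
  · intro z hz
    have := (norm_pos_iff.2 (Complex.slitPlane_ne_zero hz))
    positivity

lemma norm_log_le (w : ℂ) : ‖Complex.log w‖ ≤ |Real.log ‖w‖| + Real.pi := by
  refine (Complex.norm_le_abs_re_add_abs_im _).trans ?_
  rw [Complex.log_re, Complex.log_im]
  gcongr
  exact Complex.abs_arg_le_pi w

lemma abs_log_norm_le (w : ℂ) : |Real.log ‖w‖| ≤ ‖Complex.log w‖ := by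
  rw [← Complex.log_re]; exact Complex.abs_re_le_norm _

/-- The behaviour of `logQuot` near the singularity `1`. -/
lemma logQuot_near_one {z : ℂ} (hz : ‖z‖ < 1) (hz1 : ‖1 - z‖ ≤ 1 / 8) :
    7 / 8 ≤ ‖z‖ ∧ 2 ≤ ‖logQuot z‖ ∧ logScale ‖1 - z‖ ≤ 2 * ‖logQuot z‖ ∧
      ‖logQuot z‖ ≤ 8 * logScale ‖1 - z‖ := by
  have hx := norm_one_sub_pos hz
  set x := ‖1 - z‖ with hxdef
  have hz0 : 7 / 8 ≤ ‖z‖ := by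
    have := norm_sub_norm_le (1 : ℂ) (1 - z)
    rw [norm_one, sub_sub_cancel] at this
    linarith
  -- The radius 1/8 makes -ln|1-z| at least 2, which dominates the additive constant 1 + ln 2 of the
  -- scale.
  have hlog8 : 2 ≤ Real.log 8 := by
    have h := Real.log_two_gt_d9
    have : Real.log 8 = 3 * Real.log 2 := by
      rw [show (8 : ℝ) = 2 ^ 3 by norm_num, Real.log_pow]; norm_num
    rw [this]; linarith
  have hL : Real.log x ≤ -Real.log 8 := by
    rw [← Real.log_inv]
    exact Real.log_le_log hx (by norm_num at hz1 ⊢; exact hz1)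
  have hlogS : logScale x = 1 + Real.log 2 - Real.log x := by
    rw [logScale, Real.log_div (by norm_num) hx.ne']; ring
  have habs : |Real.log x| = -Real.log x := abs_of_nonpos (by linarith)
  have hmul : ‖z‖ * ‖logQuot z‖ = ‖Complex.log (1 - z)‖ := by
    rw [← norm_mul, mul_logQuot, norm_neg]
  have h1 := abs_log_norm_le (1 - z)
  have h2 := norm_log_le (1 - z)
  rw [← hxdef, habs, ← hmul] at h1 h2
  have hg : 0 ≤ ‖logQuot z‖ := norm_nonneg _
  have h3 := Real.log_two_lt_d9
  have h4 := Real.log_two_gt_d9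
  have h5 := Real.pi_lt_d2
  have h6 : -Real.log x ≤ ‖logQuot z‖ := h1.trans (mul_le_of_le_one_left hg hz.le)
  have h7 : 7 / 8 * ‖logQuot z‖ ≤ ‖z‖ * ‖logQuot z‖ := mul_le_mul_of_nonneg_right hz0 hg
  refine ⟨hz0, by linarith, by linarith, by linarith⟩

lemma exists_logScale_le_logQuot :
    ∃ C : ℝ, 0 < C ∧ ∀ z : ℂ, ‖z‖ < 1 → logScale ‖1 - z‖ ≤ C * ‖logQuot z‖ := by
  obtain ⟨C, hC, h⟩ := exists_bound_of_near_one (A := 2)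
    (continuousOn_logScale.div differentiableOn_logQuot.continuousOn.norm
      fun z hz => norm_ne_zero_iff.2 (logQuot_ne_zero hz))
    fun z hz hz1 => by
      have := logQuot_near_one hz hz1
      rw [Pi.div_apply, div_le_iff₀ (by linarith)]; linarith
  refine ⟨C, hC, fun z hz => ?_⟩
  rw [← div_le_iff₀ (norm_pos_iff.2 (logQuot_ne_zero (mem_slitDomain_of_norm_lt hz)))]
  exact h z hz

lemma exists_logQuot_le_logScale :
    ∃ C : ℝ, 0 < C ∧ ∀ z : ℂ, ‖z‖ < 1 → ‖logQuot z‖ ≤ C * logScale ‖1 - z‖ := by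
  have hc : ContinuousOn (fun z => ‖logQuot z‖ - 8 * logScale ‖1 - z‖) slitDomain :=
    differentiableOn_logQuot.continuousOn.norm.sub (continuousOn_const.mul continuousOn_logScale)
  obtain ⟨C, hC, h⟩ := exists_bound_of_near_one (A := 0) hc
    fun z hz hz1 => by
      have := logQuot_near_one hz hz1
      linarith
  refine ⟨C + 8, by positivity, fun z hz => ?_⟩
  have h1 := h z hz
  have h2 := one_le_logScale_norm hz
  nlinarith

lemma logLogQuot_near_one {z : ℂ} (hz : ‖z‖ < 1) (hz1 : ‖1 - z‖ ≤ 1 / 8) :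
    1 ≤ ‖logLogQuot z‖ ∧ ‖logLogQuot z‖ ≤ 3 * (Real.log (8 * logScale ‖1 - z‖) + 4) := by
  obtain ⟨h1, h2, -, h4⟩ := logQuot_near_one hz hz1
  have hmul : ‖z‖ * ‖logLogQuot z‖ = 2 * ‖Complex.log (logQuot z)‖ := by
    rw [← norm_mul, mul_logLogQuot, norm_mul]; norm_num
  have hh : 0 ≤ ‖logLogQuot z‖ := norm_nonneg _
  have h5 : Real.log 2 ≤ Real.log ‖logQuot z‖ := Real.log_le_log (by norm_num) h2
  have h6 : Real.log ‖logQuot z‖ ≤ Real.log (8 * logScale ‖1 - z‖) :=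
    Real.log_le_log (by linarith) h4
  have h7 := abs_log_norm_le (logQuot z)
  have h8 := norm_log_le (logQuot z)
  have h9 := Real.log_two_gt_d9
  have h10 := Real.pi_lt_d2
  rw [abs_of_nonneg (by linarith)] at h7 h8
  have h11 : ‖z‖ * ‖logLogQuot z‖ ≤ ‖logLogQuot z‖ := mul_le_of_le_one_left hh hz.le
  have h12 : 7 / 8 * ‖logLogQuot z‖ ≤ ‖z‖ * ‖logLogQuot z‖ := mul_le_mul_of_nonneg_right h1 hh
  constructor <;> linarith

lemma exists_one_le_logLogQuot :
    ∃ C : ℝ, 0 < C ∧ ∀ z : ℂ, ‖z‖ < 1 → 1 ≤ C * ‖logLogQuot z‖ := by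
  have hc : ContinuousOn (fun z => 1 / ‖logLogQuot z‖) slitDomain :=
    continuousOn_const.div differentiableOn_logLogQuot.continuousOn.norm
      fun z hz => norm_ne_zero_iff.2 (logLogQuot_ne_zero hz)
  obtain ⟨C, hC, h⟩ := exists_bound_of_near_one (A := 1) hc
    fun z hz hz1 => by
      have := logLogQuot_near_one hz hz1
      rw [div_le_iff₀ (by linarith)]; linarith
  refine ⟨C, hC, fun z hz => ?_⟩
  rw [← div_le_iff₀ (norm_pos_iff.2 (logLogQuot_ne_zero (mem_slitDomain_of_norm_lt hz)))]
  exact h z hz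

/-- Near 1 the size of h is the logarithm of the scale, hence below every positive power of it. This
crude bound suffices because the exponent has room whenever δ > 0. -/
lemma exists_logLogQuot_le {η : ℝ} (hη : 0 < η) :
    ∃ C : ℝ, 0 < C ∧ ∀ z : ℂ, ‖z‖ < 1 → ‖logLogQuot z‖ ≤ C * logScale ‖1 - z‖ ^ η := by
  set B := 3 * (8 ^ η / η + 4)
  have hB : 0 < B := by positivity
  have hc : ContinuousOn (fun z => ‖logLogQuot z‖ - B * logScale ‖1 - z‖ ^ η) slitDomain :=
    differentiableOn_logLogQuot.continuousOn.norm.sub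
      (continuousOn_const.mul (continuousOn_logScale.rpow_const fun z _ => Or.inr hη.le))
  obtain ⟨C, hC, h⟩ := exists_bound_of_near_one (A := 0) hc
    fun z hz hz1 => by
      have h1 := (logLogQuot_near_one hz hz1).2
      have h2 := one_le_logScale_norm hz
      have h3 := Real.log_le_rpow_div (x := 8 * logScale ‖1 - z‖) (by positivity) hη
      rw [Real.mul_rpow (by norm_num) (by linarith)] at h3
      have h4 : 1 ≤ logScale ‖1 - z‖ ^ η := Real.one_le_rpow h2 hη.le
      have : B * logScale ‖1 - z‖ ^ η
          = 3 * (8 ^ η * logScale ‖1 - z‖ ^ η / η + 4 * logScale ‖1 - z‖ ^ η) := by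
        simp only [B]; ring
      linarith
  refine ⟨C + B, by positivity, fun z hz => ?_⟩
  have h1 := h z hz
  have h2 : 1 ≤ logScale ‖1 - z‖ ^ η := Real.one_le_rpow (one_le_logScale_norm hz) hη.le
  nlinarith

/-- Serves to read g' and h' off the identities for g + z g' and h + z h', by solving for the
derivative away from 0. -/
lemma norm_deriv_le_of_add_mul_deriv {z u v w : ℂ} {B : ℝ} (hz : 7 / 8 ≤ ‖z‖)
    (h : u + z * v = w) (hw : ‖w‖ ≤ B) : ‖v‖ ≤ 2 * (B + ‖u‖) := by
  have h1 : ‖z‖ * ‖v‖ ≤ B + ‖u‖ := by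
    rw [← norm_mul, show z * v = w - u by rw [← h]; ring]
    exact (norm_sub_le _ _).trans (by linarith)
  nlinarith [norm_nonneg v]

lemma deriv_logQuot_near_one {z : ℂ} (hz : ‖z‖ < 1) (hz1 : ‖1 - z‖ ≤ 1 / 8) :
    ‖1 - z‖ * ‖deriv logQuot z / logQuot z‖ ≤ 4 := by
  obtain ⟨h1, h2, -⟩ := logQuot_near_one hz hz1
  have hx := norm_one_sub_pos hz
  have h := norm_deriv_le_of_add_mul_deriv (B := 1 / ‖1 - z‖) h1
    (logQuot_add_mul_deriv (mem_slitDomain_of_norm_lt hz)) (by rw [norm_div, norm_one])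
  rw [norm_div, ← mul_div_assoc, div_le_iff₀ (by linarith)]
  calc ‖1 - z‖ * ‖deriv logQuot z‖ ≤ ‖1 - z‖ * (2 * (1 / ‖1 - z‖ + ‖logQuot z‖)) := by gcongr
    _ = 2 + 2 * (‖1 - z‖ * ‖logQuot z‖) := by field_simp
    _ ≤ 4 * ‖logQuot z‖ := by nlinarith

lemma continuousOn_deriv_logQuot_div :
    ContinuousOn (fun z => deriv logQuot z / logQuot z) slitDomain :=
  (differentiableOn_logQuot.deriv isOpen_slitDomain).continuousOn.div
    differentiableOn_logQuot.continuousOn fun _ hz => logQuot_ne_zero hz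

lemma continuousOn_deriv_logLogQuot_div :
    ContinuousOn (fun z => deriv logLogQuot z / logLogQuot z) slitDomain :=
  (differentiableOn_logLogQuot.deriv isOpen_slitDomain).continuousOn.div
    differentiableOn_logLogQuot.continuousOn fun _ hz => logLogQuot_ne_zero hz

lemma deriv_logLogQuot_near_one {z : ℂ} (hz : ‖z‖ < 1) (hz1 : ‖1 - z‖ ≤ 1 / 8) :
    ‖1 - z‖ * ‖deriv logLogQuot z / logLogQuot z‖ ≤ 20 := by
  obtain ⟨h1, -, -⟩ := logQuot_near_one hz hz1
  obtain ⟨h2, -⟩ := logLogQuot_near_one hz hz1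
  have hx := norm_one_sub_pos hz
  have h3 := deriv_logQuot_near_one hz hz1
  have h := norm_deriv_le_of_add_mul_deriv (B := 8 / ‖1 - z‖) h1
    (logLogQuot_add_mul_deriv (mem_slitDomain_of_norm_lt hz)) (by
      rw [le_div_iff₀ hx, norm_mul, Complex.norm_ofNat]; linarith)
  rw [norm_div, ← mul_div_assoc, div_le_iff₀ (by linarith)]
  calc ‖1 - z‖ * ‖deriv logLogQuot z‖
      ≤ ‖1 - z‖ * (2 * (8 / ‖1 - z‖ + ‖logLogQuot z‖)) := by gcongr
    _ = 16 + 2 * (‖1 - z‖ * ‖logLogQuot z‖) := by field_simp; ring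
    _ ≤ 20 * ‖logLogQuot z‖ := by nlinarith

/-- Each of the three logarithmic derivatives is O(1/|1-z|), so differentiating f costs exactly one
such factor. -/
lemma exists_singularLogDeriv_le (γ δ : ℝ) :
    ∃ C : ℝ, 0 < C ∧ ∀ z : ℂ, ‖z‖ < 1 → ‖singularLogDeriv γ δ z‖ ≤ C / ‖1 - z‖ := by
  have hn : ContinuousOn (fun z : ℂ => ‖1 - z‖) slitDomain := by fun_prop
  obtain ⟨A, hA, h1⟩ := exists_bound_of_near_one (hn.mul continuousOn_deriv_logQuot_div.norm)
    fun z hz hz1 => deriv_logQuot_near_one hz hz1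
  obtain ⟨B, hB, h2⟩ := exists_bound_of_near_one (hn.mul continuousOn_deriv_logLogQuot_div.norm)
    fun z hz hz1 => deriv_logLogQuot_near_one hz hz1
  refine ⟨1 + |γ| * A + |δ| * B, by positivity, fun z hz => ?_⟩
  have hx := norm_one_sub_pos hz
  rw [le_div_iff₀ hx, mul_comm, singularLogDeriv]
  calc ‖1 - z‖ * ‖1 / 2 * (1 / (1 - z)) + γ * (deriv logQuot z / logQuot z)
        + δ * (deriv logLogQuot z / logLogQuot z)‖
      ≤ ‖1 - z‖ * (‖1 / 2 * (1 / (1 - z))‖ + ‖γ * (deriv logQuot z / logQuot z)‖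
        + ‖δ * (deriv logLogQuot z / logLogQuot z)‖) := by
        gcongr; exact norm_add₃_le
    _ = 1 / 2 + |γ| * (‖1 - z‖ * ‖deriv logQuot z / logQuot z‖)
        + |δ| * (‖1 - z‖ * ‖deriv logLogQuot z / logLogQuot z‖) := by
        simp only [norm_mul, Complex.norm_real, Real.norm_eq_abs]
        rw [norm_div (1 : ℂ) (1 - z), norm_div (1 : ℂ) 2, norm_one, Complex.norm_ofNat]
        field_simp
    _ ≤ _ := by
        gcongr
        · norm_num
        · exact h1 z hz
        · exact h2 z hz

lemma exists_logQuot_rpow_le (γ : ℝ) :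
    ∃ C : ℝ, 0 < C ∧ ∀ z : ℂ, ‖z‖ < 1 → ‖logQuot z‖ ^ γ ≤ C * logScale ‖1 - z‖ ^ γ := by
  rcases le_total 0 γ with hγ | hγ
  · obtain ⟨C, hC, h⟩ := exists_logQuot_le_logScale
    refine ⟨C ^ γ, by positivity, fun z hz => ?_⟩
    rw [← Real.mul_rpow hC.le (by linarith [one_le_logScale_norm hz])]
    exact Real.rpow_le_rpow (norm_nonneg _) (h z hz) hγ
  · obtain ⟨C, hC, h⟩ := exists_logScale_le_logQuot
    refine ⟨(C⁻¹) ^ γ, by positivity, fun z hz => ?_⟩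
    have h1 := one_le_logScale_norm hz
    rw [← Real.mul_rpow (by positivity) (by linarith)]
    refine Real.rpow_le_rpow_of_nonpos (by positivity) ?_ hγ
    rw [inv_mul_le_iff₀ hC]
    exact h z hz

/-- For δ ≤ 0 it is enough that |h| is bounded below, and η = 0 is allowed; for δ > 0 the growth of
h must be paid for with a positive η. -/
lemma exists_logLogQuot_rpow_le {δ η : ℝ} (hη : 0 < η ∨ 0 ≤ η ∧ δ ≤ 0) :
    ∃ C : ℝ, 0 < C ∧ ∀ z : ℂ, ‖z‖ < 1 → ‖logLogQuot z‖ ^ δ ≤ C * logScale ‖1 - z‖ ^ η := by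
  rcases le_or_gt δ 0 with hδ | hδ
  · obtain ⟨C, hC, h⟩ := exists_one_le_logLogQuot
    have hη : 0 ≤ η := by rcases hη with h | h <;> [exact h.le; exact h.1]
    refine ⟨(C⁻¹) ^ δ, by positivity, fun z hz => ?_⟩
    have h1 := Real.one_le_rpow (one_le_logScale_norm hz) hη
    refine le_trans (Real.rpow_le_rpow_of_nonpos (by positivity) ?_ hδ)
      (le_mul_of_one_le_right (by positivity) h1)
    rw [inv_le_iff_one_le_mul₀' hC]
    exact h z hz
  · have hη : 0 < η := by rcases hη with h | h <;> linarith
    obtain ⟨C, hC, h⟩ := exists_logLogQuot_le (div_pos hη hδ)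
    refine ⟨C ^ δ, by positivity, fun z hz => ?_⟩
    have h1 := one_le_logScale_norm hz
    refine (Real.rpow_le_rpow (norm_nonneg _) (h z hz) hδ.le).trans_eq ?_
    rw [Real.mul_rpow hC.le (by positivity), ← Real.rpow_mul (by linarith),
      div_mul_cancel₀ _ hδ.ne']

/-- `|f'(z)|² = O(|1 - z|⁻³ (1 + ln (2 / |1 - z|))^β)` on the unit disc. -/
lemma exists_norm_deriv_singularFn_sq_le {γ δ β : ℝ} (h : 2 * γ < β ∨ 2 * γ ≤ β ∧ δ ≤ 0) :
    ∃ C : ℝ, 0 < C ∧ ∀ z : ℂ, ‖z‖ < 1 →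
      ‖deriv (singularFn γ δ) z‖ ^ 2 ≤ C * (logScale ‖1 - z‖ ^ β / ‖1 - z‖ ^ 3) := by
  obtain ⟨A, hA, h1⟩ := exists_singularLogDeriv_le γ δ
  obtain ⟨B, hB, h2⟩ := exists_logQuot_rpow_le γ
  -- The slack β/2 - γ is what the log-log factor may cost; squaring turns the total exponent γ +
  -- (β/2 - γ) into β.
  obtain ⟨D, hD, h3⟩ := exists_logLogQuot_rpow_le (δ := δ) (η := β / 2 - γ) (by
    rcases h with h | h
    · left; linarith
    · right; exact ⟨by linarith [h.1], h.2⟩)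
  refine ⟨(B * D * A) ^ 2, by positivity, fun z hz => ?_⟩
  have hS := mem_slitDomain_of_norm_lt hz
  have hx := norm_one_sub_pos hz
  have hl := one_le_logScale_norm hz
  rw [(hasDerivAt_singularFn hS).deriv, norm_mul, singularFn_eq hS, norm_mul, norm_mul,
    Complex.norm_cpow_real, Complex.norm_cpow_real,
    show (-(1 / 2) : ℂ) = ((-(1 / 2) : ℝ) : ℂ) by push_cast; rfl, Complex.norm_cpow_real]
  have key : ‖1 - z‖ ^ (-(1 / 2) : ℝ) * ‖logQuot z‖ ^ γ * ‖logLogQuot z‖ ^ δ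
      * ‖singularLogDeriv γ δ z‖
      ≤ ‖1 - z‖ ^ (-(1 / 2) : ℝ) * (B * logScale ‖1 - z‖ ^ γ)
        * (D * logScale ‖1 - z‖ ^ (β / 2 - γ)) * (A / ‖1 - z‖) := by
    gcongr
    · exact h2 z hz
    · exact h3 z hz
    · exact h1 z hz
  refine (pow_le_pow_left₀ (by positivity) key 2).trans_eq ?_
  have e1 : (‖1 - z‖ ^ (-(1 / 2) : ℝ)) ^ 2 = ‖1 - z‖⁻¹ := by
    rw [← Real.rpow_natCast, ← Real.rpow_mul hx.le, ← Real.rpow_neg_one]; norm_num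
  have e2 : (logScale ‖1 - z‖ ^ γ * logScale ‖1 - z‖ ^ (β / 2 - γ)) ^ 2
      = logScale ‖1 - z‖ ^ β := by
    rw [← Real.rpow_add (by linarith), ← Real.rpow_natCast, ← Real.rpow_mul (by linarith)]
    congr 1; push_cast; ring
  calc _ = (‖1 - z‖ ^ (-(1 / 2) : ℝ)) ^ 2 * (B * D * A) ^ 2
        * (logScale ‖1 - z‖ ^ γ * logScale ‖1 - z‖ ^ (β / 2 - γ)) ^ 2 / ‖1 - z‖ ^ 2 := by ring
    _ = _ := by rw [e1, e2]; field_simp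

/-! ## Taylor series on the unit disc -/

/-- The power series `A` converges to `f` on the open unit disc. -/
def HasTaylor (f : ℂ → ℂ) (A : PowerSeries ℂ) : Prop :=
  ∀ z : ℂ, ‖z‖ < 1 → HasSum (fun n => PowerSeries.coeff n A * z ^ n) (f z)

/-- The Taylor series of `f` at `0`. -/
def taylor (f : ℂ → ℂ) : PowerSeries ℂ :=
  PowerSeries.mk fun n => (n.factorial : ℂ)⁻¹ * iteratedDeriv n f 0

lemma hasTaylor_taylor {f : ℂ → ℂ} (hf : DifferentiableOn ℂ f (Metric.ball 0 1)) :
    HasTaylor f (taylor f) := by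
  intro z hz
  have := Complex.hasSum_taylorSeries_on_ball hf (z := z) (by simpa using hz)
  refine this.congr_fun ?_ |> id
  intro n
  simp [taylor]; ring

namespace HasTaylor

variable {f g : ℂ → ℂ} {A B : PowerSeries ℂ}

lemma unique (hA : HasTaylor f A) (hB : HasTaylor f B) : A = B := by
  have key : ∀ {C : PowerSeries ℂ}, HasTaylor f C → HasFPowerSeriesAt f
      (FormalMultilinearSeries.ofScalars ℂ fun n => PowerSeries.coeff n C) 0 := by
    intro C hC
    rw [hasFPowerSeriesAt_iff]
    filter_upwards [Metric.ball_mem_nhds (0 : ℂ) one_pos] with z hz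
    rw [mem_ball_zero_iff] at hz
    simpa [mul_comm] using hC z hz
  ext n
  have := (key hA).eq_formalMultilinearSeries (key hB)
  have h2 := congrArg (fun p => FormalMultilinearSeries.coeff p n) this
  simpa using h2

lemma congr (hA : HasTaylor f A) (h : ∀ z : ℂ, ‖z‖ < 1 → f z = g z) : HasTaylor g A :=
  fun z hz => h z hz ▸ hA z hz

lemma summable_norm (hA : HasTaylor f A) {z : ℂ} (hz : ‖z‖ < 1) :
    Summable fun n => ‖PowerSeries.coeff n A * z ^ n‖ :=
  (hA z hz).summable.norm

lemma add (hA : HasTaylor f A) (hB : HasTaylor g B) : HasTaylor (f + g) (A + B) := by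
  intro z hz
  refine ((hA z hz).add (hB z hz)).congr_fun ?_ |> id
  intro n
  rw [map_add, add_mul]

lemma const_mul (c : ℂ) (hA : HasTaylor f A) :
    HasTaylor (fun z => c * f z) (PowerSeries.C c * A) := by
  intro z hz
  refine ((hA z hz).mul_left c).congr_fun ?_ |> id
  intro n
  rw [PowerSeries.coeff_C_mul, mul_assoc]

lemma mul (hA : HasTaylor f A) (hB : HasTaylor g B) : HasTaylor (f * g) (A * B) := by
  intro z hz
  have h := tsum_mul_tsum_eq_tsum_sum_antidiagonal_of_summable_norm
    (hA.summable_norm hz) (hB.summable_norm hz)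
  have hs := (summable_norm_sum_mul_antidiagonal_of_summable_norm
    (hA.summable_norm hz) (hB.summable_norm hz)).of_norm
  have heq : ∀ n, PowerSeries.coeff n (A * B) * z ^ n = ∑ kl ∈ Finset.HasAntidiagonal.antidiagonal n,
      PowerSeries.coeff kl.1 A * z ^ kl.1 * (PowerSeries.coeff kl.2 B * z ^ kl.2) := by
    intro n
    rw [PowerSeries.coeff_mul, Finset.sum_mul]
    refine Finset.sum_congr rfl fun kl hkl => ?_
    rw [← Finset.HasAntidiagonal.mem_antidiagonal.1 hkl, pow_add]; ring
  rw [(hA z hz).tsum_eq, (hB z hz).tsum_eq] at h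
  simp_rw [heq, Pi.mul_apply, h]
  exact hs.hasSum

lemma deriv (hA : HasTaylor f A) (hf : DifferentiableOn ℂ f (Metric.ball 0 1)) :
    HasTaylor (deriv f) (PowerSeries.derivative ℂ A) := by
  rw [hA.unique (hasTaylor_taylor hf)]
  have h := hasTaylor_taylor (hf.deriv Metric.isOpen_ball)
  convert h using 1
  ext n
  rw [PowerSeries.coeff_derivative, taylor, taylor, PowerSeries.coeff_mk, PowerSeries.coeff_mk,
    iteratedDeriv_succ', Nat.factorial_succ]
  have : (n.factorial : ℂ) ≠ 0 := by exact_mod_cast n.factorial_ne_zero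
  have : (n + 1 : ℂ) ≠ 0 := by exact_mod_cast n.succ_ne_zero
  push_cast
  field_simp

lemma coeff_zero (hA : HasTaylor f A) : PowerSeries.coeff 0 A = f 0 := by
  have h := hA 0 (by simp)
  have h2 := hasSum_single (f := fun n => PowerSeries.coeff n A * (0 : ℂ) ^ n) 0
    fun n hn => by simp [hn]
  simpa using h2.unique h

end HasTaylor

/-! ## A Parseval estimate -/

lemma sq_norm_le_of_norm_sub_le {u v : ℂ} {τ a : ℝ} (h : ‖u - v‖ ≤ τ) (hv : ‖v‖ ≤ a) :
    ‖u‖ ^ 2 ≤ ‖v‖ ^ 2 + (2 * a * τ + τ ^ 2) := by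
  have h1 : ‖u‖ ≤ ‖v‖ + τ := by
    have := norm_sub_norm_le u v
    linarith
  have hτ : 0 ≤ τ := (norm_nonneg _).trans h
  nlinarith [norm_nonneg u, norm_nonneg v]

/-- The partial sum of length `m` of `A` at the radius `ρ`, as a polynomial on the unit circle. -/
def circlePoly (A : PowerSeries ℂ) (ρ : ℝ) (m : ℕ) : Polynomial ℂ :=
  ∑ n ∈ Finset.range m, Polynomial.monomial n (PowerSeries.coeff n A * (ρ : ℂ) ^ n)

lemma circlePoly_eval (A : PowerSeries ℂ) (ρ : ℝ) (m : ℕ) (w : ℂ) :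
    (circlePoly A ρ m).eval w
      = ∑ n ∈ Finset.range m, PowerSeries.coeff n A * (ρ * w) ^ n := by
  simp [circlePoly, Polynomial.eval_finsetSum, mul_pow, mul_assoc]

lemma circlePoly_coeff (A : PowerSeries ℂ) (ρ : ℝ) (m n : ℕ) :
    (circlePoly A ρ m).coeff n
      = if n < m then PowerSeries.coeff n A * (ρ : ℂ) ^ n else 0 := by
  simp [circlePoly, Polynomial.coeff_monomial]

lemma circleAverage_circlePoly (A : PowerSeries ℂ) {ρ : ℝ} (hρ : 0 ≤ ρ) (m : ℕ) :
    Real.circleAverage (fun w => ‖(circlePoly A ρ m).eval w‖ ^ 2) 0 1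
      = ∑ n ∈ Finset.range m, ‖PowerSeries.coeff n A‖ ^ 2 * ρ ^ (2 * n) := by
  rw [← Polynomial.sum_sq_norm_coeff_eq_circleAverage]
  rw [Finset.sum_subset (s₂ := Finset.range m)]
  · refine Finset.sum_congr rfl fun n hn => ?_
    rw [circlePoly_coeff, if_pos (Finset.mem_range.1 hn), norm_mul, mul_pow, norm_pow,
      Complex.norm_real, Real.norm_eq_abs, abs_of_nonneg hρ, pow_mul', ]
  · intro n hn
    rw [Polynomial.mem_support_iff, circlePoly_coeff] at hn
    by_contra h
    rw [Finset.mem_range] at h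
    simp [h] at hn
  · intro n _ hn
    rw [Polynomial.notMem_support_iff.1 hn]; simp

/-- The truncation error is bounded by the tail of an absolutely convergent series that does not
depend on the point of the circle. With m = 0 the bound is one for f itself. -/
lemma HasTaylor.norm_circlePoly_sub_le {f : ℂ → ℂ} {A : PowerSeries ℂ} (hA : HasTaylor f A)
    {ρ : ℝ} (h0 : 0 ≤ ρ) (h1 : ρ < 1) (m : ℕ) {w : ℂ} (hw : ‖w‖ = 1) :
    ‖(circlePoly A ρ m).eval w - f (ρ * w)‖
      ≤ ∑' n, ‖PowerSeries.coeff (n + m) A‖ * ρ ^ (n + m) := by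
  have hz : ‖(ρ : ℂ) * w‖ < 1 := by
    rw [norm_mul, hw, Complex.norm_real, Real.norm_eq_abs, abs_of_nonneg h0]; linarith
  have hs := (hA _ hz).summable
  rw [circlePoly_eval, ← (hA _ hz).tsum_eq, ← hs.sum_add_tsum_nat_add m, sub_add_cancel_left,
    norm_neg]
  have hn := (summable_nat_add_iff m).2 hs.norm
  refine (norm_tsum_le_tsum_norm hn).trans_eq (tsum_congr fun n => ?_)
  rw [norm_mul, norm_pow, norm_mul, hw, Complex.norm_real, Real.norm_eq_abs, abs_of_nonneg h0,
    mul_one]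

lemma hasTaylor_geometric : HasTaylor (fun z => (1 - z)⁻¹) (PowerSeries.mk fun _ => 1) := by
  intro z hz
  simpa using hasSum_geometric_of_norm_lt_one hz

/-- If `|f(z)|² ≤ M / |1 - z|²` on the circle of radius `ρ`, then `∑ |a_n|² ρ^(2n)` is at most
`M / (1 - ρ²)`. -/
lemma HasTaylor.sum_sq_le {f : ℂ → ℂ} {A : PowerSeries ℂ} (hA : HasTaylor f A)
    {ρ M : ℝ} (h0 : 0 ≤ ρ) (h1 : ρ < 1) (hM : 0 ≤ M)
    (h : ∀ z : ℂ, ‖z‖ = ρ → ‖f z‖ ^ 2 ≤ M * ‖(1 - z)⁻¹‖ ^ 2) (N : ℕ) :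
    ∑ n ∈ Finset.range N, ‖PowerSeries.coeff n A‖ ^ 2 * ρ ^ (2 * n) ≤ M / (1 - ρ ^ 2) := by
  -- The comparison function 1/(1-z) has all coefficients 1 and mean square ∑ ρ^(2n) = 1/(1-ρ²).
  -- Parseval is applied to partial sums only, so the pointwise hypothesis has to be carried over to
  -- partial sums of both series.
  set B : PowerSeries ℂ := PowerSeries.mk fun _ => 1
  have hB : HasTaylor (fun z => (1 - z)⁻¹) B := hasTaylor_geometric
  set τ : ℕ → ℝ := fun m => ∑' n, ‖PowerSeries.coeff (n + m) A‖ * ρ ^ (n + m)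
  set σ : ℕ → ℝ := fun m => ∑' n, ‖PowerSeries.coeff (n + m) B‖ * ρ ^ (n + m)
  have hτ : Tendsto τ atTop (𝓝 0) :=
    tendsto_sum_nat_add fun n => ‖PowerSeries.coeff n A‖ * ρ ^ n
  have hσ : Tendsto σ atTop (𝓝 0) :=
    tendsto_sum_nat_add fun n => ‖PowerSeries.coeff n B‖ * ρ ^ n
  set a := τ 0
  set b := σ 0
  -- The error of passing from the partial sum of A to f, and M times that of passing from 1/(1-z)
  -- to its own partial sum.
  set e : ℕ → ℝ := fun m => (2 * a * τ m + τ m ^ 2) + M * (2 * (b + σ m) * σ m + σ m ^ 2)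
  have he : Tendsto e atTop (𝓝 0) := by
    have := ((hτ.const_mul (2 * a)).add (hτ.pow 2)).add
      ((((hσ.const_add b).const_mul 2).mul hσ).add (hσ.pow 2) |>.const_mul M)
    simpa [e] using this
  have hbound : ∀ m, ∀ w ∈ Metric.sphere (0 : ℂ) |1|, ‖(circlePoly A ρ m).eval w‖ ^ 2
      ≤ M * ‖(circlePoly B ρ m).eval w‖ ^ 2 + e m := by
    intro m w hw
    rw [abs_one, mem_sphere_zero_iff_norm] at hw
    have hz : ‖(ρ : ℂ) * w‖ = ρ := by
      rw [norm_mul, hw, Complex.norm_real, Real.norm_eq_abs, abs_of_nonneg h0, mul_one]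
    have hfa : ‖f (ρ * w)‖ ≤ a := by
      have := hA.norm_circlePoly_sub_le h0 h1 0 hw
      simpa [circlePoly, a, τ] using this
    have hgb : ‖(1 - ρ * w)⁻¹‖ ≤ b := by
      have := hB.norm_circlePoly_sub_le h0 h1 0 hw
      simpa [circlePoly, b, σ] using this
    have h2 := sq_norm_le_of_norm_sub_le (hA.norm_circlePoly_sub_le h0 h1 m hw) hfa
    have hq := hB.norm_circlePoly_sub_le h0 h1 m hw
    have hqb : ‖(circlePoly B ρ m).eval w‖ ≤ b + σ m := by
      have := norm_sub_norm_le ((circlePoly B ρ m).eval w) (1 - ρ * w)⁻¹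
      linarith
    rw [norm_sub_rev] at hq
    have h3 := sq_norm_le_of_norm_sub_le hq hqb
    have h4 := h _ hz
    have h5 := mul_le_mul_of_nonneg_left h3 hM
    simp only [e]
    linarith
  have hint : ∀ (p : Polynomial ℂ), CircleIntegrable (fun w => ‖p.eval w‖ ^ 2) 0 1 := fun p =>
    ContinuousOn.circleIntegrable' (by fun_prop)
  have hmain : ∀ m, ∑ n ∈ Finset.range m, ‖PowerSeries.coeff n A‖ ^ 2 * ρ ^ (2 * n)
      ≤ M / (1 - ρ ^ 2) + e m := by
    intro m
    have h2 := Real.circleAverage_mono (hint _)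
      (((hint (circlePoly B ρ m)).const_smul (a := M)).add (circleIntegrable_const (e m) 0 1))
      (hbound m)
    rw [circleAverage_circlePoly A h0] at h2
    refine h2.trans ?_
    rw [Real.circleAverage_add (hint (circlePoly B ρ m)).const_smul (circleIntegrable_const _ _ _),
      Real.circleAverage_const, Real.circleAverage_smul, circleAverage_circlePoly B h0]
    rw [smul_eq_mul, div_eq_mul_inv]
    gcongr
    have hlt : ρ ^ 2 < 1 := by nlinarith
    refine le_trans (le_of_eq ?_) ((summable_geometric_of_lt_one (sq_nonneg ρ) hlt).sum_le_tsum
      (Finset.range m) (fun i _ => by positivity) |>.trans_eq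
      (tsum_geometric_of_lt_one (sq_nonneg ρ) hlt))
    refine Finset.sum_congr rfl fun n _ => ?_
    simp [B, pow_mul]
  have hlim : Tendsto (fun m => M / (1 - ρ ^ 2) + e m) atTop (𝓝 (M / (1 - ρ ^ 2))) := by
    simpa using he.const_add (M / (1 - ρ ^ 2))
  refine ge_of_tendsto hlim ?_
  filter_upwards [eventually_ge_atTop N] with m hm
  exact (Finset.sum_le_sum_of_subset_of_nonneg (Finset.range_mono hm)
    fun i _ _ => by positivity).trans (hmain m)

/-! ## Dyadic blocks of Taylor coefficients -/

lemma logScale_antitone {x y : ℝ} (hx : 0 < x) (h : x ≤ y) : logScale y ≤ logScale x := by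
  unfold logScale
  have : 0 < y := hx.trans_le h
  gcongr

/-- From ln u ≤ b u^(1/b) one gets 1 + ln u ≤ (1 + b) u^(1/b); the exponent 1/b is chosen so that
the power b is linear in u. -/
lemma one_add_log_rpow_le {b u : ℝ} (hb : 0 < b) (hu : 1 ≤ u) :
    (1 + Real.log u) ^ b ≤ (1 + b) ^ b * u := by
  have h0 := Real.log_nonneg hu
  have h1 := Real.log_le_rpow_div (x := u) (by linarith) (inv_pos.2 hb)
  have h2 : 1 ≤ u ^ b⁻¹ := Real.one_le_rpow hu (inv_pos.2 hb).le
  rw [div_inv_eq_mul] at h1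
  calc (1 + Real.log u) ^ b ≤ ((1 + b) * u ^ b⁻¹) ^ b := by
        apply Real.rpow_le_rpow (by positivity) (by linarith) hb.le
    _ = (1 + b) ^ b * u := by
        rw [Real.mul_rpow (by positivity) (by positivity), ← Real.rpow_mul (by linarith),
          inv_mul_cancel₀ hb.ne', Real.rpow_one]

/-- The scale function varies slowly. -/
lemma exists_logScale_rpow_le (β : ℝ) : ∃ C : ℝ, 0 < C ∧ ∀ ε x : ℝ, 0 < ε → ε ≤ x → x ≤ 2 →
    logScale x ^ β ≤ C * logScale ε ^ β * (x / ε) := by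
  rcases le_or_gt 0 β with hβ | hβ
  · refine ⟨1, one_pos, fun ε x hε hx hx2 => ?_⟩
    have h1 := one_le_logScale (hε.trans_le hx) hx2
    have h2 := Real.rpow_le_rpow (by linarith) (logScale_antitone hε hx) hβ
    have h3 : 1 ≤ x / ε := by rwa [one_le_div hε]
    have h4 : 0 ≤ logScale ε ^ β := (Real.rpow_nonneg (by linarith) _).trans h2
    rw [one_mul]
    exact h2.trans (le_mul_of_one_le_right h4 h3)
  · set b := -β with hb
    have hb0 : 0 < b := by linarith
    refine ⟨(1 + b) ^ b, by positivity, fun ε x hε hx hx2 => ?_⟩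
    have hx0 := hε.trans_le hx
    have h1 := one_le_logScale hx0 hx2
    have h2 : 1 ≤ x / ε := by rwa [one_le_div hε]
    have h3 : logScale ε = logScale x + Real.log (x / ε) := by
      rw [logScale, logScale, Real.log_div two_ne_zero hε.ne', Real.log_div two_ne_zero hx0.ne',
        Real.log_div hx0.ne' hε.ne']; ring
    have h4 := Real.log_nonneg h2
    -- For negative β the scale at ε must not be much larger than at x. The ratio is at most
    -- logarithmic in x/ε because the scale at x is at least 1.
    have h5 : logScale ε ≤ logScale x * (1 + Real.log (x / ε)) := by nlinarith
    have hε1 : 0 < logScale ε := by linarith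
    have h6 : logScale ε ^ b ≤ logScale x ^ b * ((1 + b) ^ b * (x / ε)) := by
      refine (Real.rpow_le_rpow hε1.le h5 hb0.le).trans ?_
      rw [Real.mul_rpow (by linarith) (by linarith)]
      exact mul_le_mul_of_nonneg_left (one_add_log_rpow_le hb0 h2)
        (Real.rpow_nonneg (by linarith) _)
    have hxb : 0 < logScale x ^ b := Real.rpow_pos_of_pos (by linarith) _
    have hεb : 0 < logScale ε ^ b := Real.rpow_pos_of_pos hε1 _
    rw [show β = -b by rw [hb]; ring, Real.rpow_neg (by linarith), Real.rpow_neg hε1.le,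
      inv_le_iff_one_le_mul₀ hxb]
    have h7 : (1 + b) ^ b * (logScale ε ^ b)⁻¹ * (x / ε) * logScale x ^ b
        = logScale x ^ b * ((1 + b) ^ b * (x / ε)) / logScale ε ^ b := by ring
    rw [h7, one_le_div hεb]
    exact h6

/-- The inverse of 1 - 1/N is 1 + 1/(N-1) ≤ exp(1/(N-1)), and N/(N-1) ≤ 2. It keeps the weights
ρ^(2n) of a dyadic block bounded below. -/
lemma exp_neg_two_le_pow {N : ℕ} (hN : 2 ≤ N) :
    Real.exp (-2) ≤ (1 - 1 / (N : ℝ)) ^ N := by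
  have hN' : (2 : ℝ) ≤ N := by exact_mod_cast hN
  have h1 : (0 : ℝ) < N - 1 := by linarith
  have h2 : 1 - 1 / (N : ℝ) = (1 + 1 / ((N : ℝ) - 1))⁻¹ := by
    have : (N : ℝ) ≠ 0 := by linarith
    field_simp; ring
  rw [h2, Real.exp_neg, inv_pow]
  gcongr
  have h3 : 1 + 1 / ((N : ℝ) - 1) ≤ Real.exp (1 / ((N : ℝ) - 1)) := by
    have := Real.add_one_le_exp (1 / ((N : ℝ) - 1)); linarith
  calc (1 + 1 / ((N : ℝ) - 1)) ^ N ≤ Real.exp (1 / ((N : ℝ) - 1)) ^ N := by gcongr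
    _ = Real.exp (N * (1 / ((N : ℝ) - 1))) := by rw [← Real.exp_nat_mul]
    _ ≤ Real.exp 2 := by
      gcongr
      rw [mul_one_div, div_le_iff₀ h1]; linarith

lemma differentiableOn_singularFn (γ δ : ℝ) :
    DifferentiableOn ℂ (singularFn γ δ) (Metric.ball 0 1) := fun _ hz =>
  (hasDerivAt_singularFn (ball_subset_slitDomain hz)).differentiableAt.differentiableWithinAt

/-- The scale at 2^(-k) lies between k/2 and 3k; the two summands of the constant serve the two
signs of β. -/
lemma exists_logScale_inv_two_pow_rpow_le (β : ℝ) : ∃ C : ℝ, 0 < C ∧ ∀ k : ℕ, 1 ≤ k →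
    logScale (1 / 2 ^ k) ^ β ≤ C * (k : ℝ) ^ β := by
  refine ⟨3 ^ β + (1 / 2) ^ β, by positivity, fun k hk => ?_⟩
  have hk' : (1 : ℝ) ≤ k := by exact_mod_cast hk
  have h1 : logScale (1 / 2 ^ k) = 1 + (k + 1) * Real.log 2 := by
    rw [logScale, div_div_eq_mul_div, div_one, ← pow_succ', Real.log_pow]; push_cast; ring
  have h2 := Real.log_two_gt_d9
  have h3 := Real.log_two_lt_d9
  have hle : logScale (1 / 2 ^ k) ≤ 3 * k := by rw [h1]; nlinarith
  have hge : 1 / 2 * (k : ℝ) ≤ logScale (1 / 2 ^ k) := by rw [h1]; nlinarith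
  have hp : 0 ≤ (3 : ℝ) ^ β := by positivity
  have hq : 0 ≤ (1 / 2 : ℝ) ^ β := by positivity
  have hk0 : 0 ≤ (k : ℝ) ^ β := by positivity
  rcases le_total 0 β with hβ | hβ
  · have := Real.rpow_le_rpow (by linarith) hle hβ
    rw [Real.mul_rpow (by norm_num) (by linarith)] at this
    nlinarith
  · have := Real.rpow_le_rpow_of_nonpos (by linarith) hge hβ
    rw [Real.mul_rpow (by norm_num) (by linarith)] at this
    nlinarith

/-- The sums of squares of the Taylor coefficients of `singularFn γ δ` over dyadic blocks. -/
theorem exists_block_sum_sq_le {γ δ β : ℝ} (h : 2 * γ < β ∨ 2 * γ ≤ β ∧ δ ≤ 0)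
    {A : PowerSeries ℂ} (hA : HasTaylor (singularFn γ δ) A) :
    ∃ K : ℝ, 0 < K ∧ ∀ k : ℕ, 1 ≤ k →
      ∑ n ∈ Finset.Ico (2 ^ k) (2 ^ (k + 1)), ‖PowerSeries.coeff n A‖ ^ 2 ≤ K * (k : ℝ) ^ β := by
  obtain ⟨C, hC, h1⟩ := exists_norm_deriv_singularFn_sq_le h
  obtain ⟨D, hD, h2⟩ := exists_logScale_rpow_le β
  obtain ⟨E, hE, h3⟩ := exists_logScale_inv_two_pow_rpow_le β
  refine ⟨Real.exp 8 * (C * (D * E)), by positivity, fun k hk => ?_⟩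
  set N : ℕ := 2 ^ k with hN
  have hN2 : 2 ≤ N := by
    calc 2 = 2 ^ 1 := rfl
      _ ≤ 2 ^ k := Nat.pow_le_pow_right (by norm_num) hk
  have hN2' : (2 : ℝ) ≤ N := by exact_mod_cast hN2
  set ρ : ℝ := 1 - 1 / N with hρ
  have hε : 0 < 1 / (N : ℝ) := by positivity
  have hε2 : 1 / (N : ℝ) ≤ 1 / 2 := by gcongr
  have hρ0 : 1 / 2 ≤ ρ := by linarith
  have hρ1 : ρ < 1 := by linarith
  set S := logScale (1 / N)
  have hS : 0 < S := by linarith [one_le_logScale hε (by linarith)]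
  have hSβ : 0 < S ^ β := Real.rpow_pos_of_pos hS β
  -- On this circle |1-z| ≥ 1/N. Slow variation replaces the scale at |1-z| by the scale at 1/N at
  -- the price of a factor N|1-z|, which turns |1-z|⁻³ into N|1-z|⁻².
  have hcircle : ∀ z : ℂ, ‖z‖ = ρ →
      ‖deriv (singularFn γ δ) z‖ ^ 2 ≤ (C * (D * S ^ β * N)) * ‖(1 - z)⁻¹‖ ^ 2 := by
    intro z hz
    have hz1 : ‖z‖ < 1 := by linarith
    have hx := norm_one_sub_pos hz1
    have hεx : 1 / (N : ℝ) ≤ ‖1 - z‖ := by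
      have := norm_sub_norm_le (1 : ℂ) z
      rw [norm_one, hz] at this; linarith
    have h4 := h2 _ _ hε hεx (norm_one_sub_le_two hz1)
    refine (h1 z hz1).trans ?_
    rw [mul_assoc]
    refine mul_le_mul_of_nonneg_left ?_ hC.le
    rw [norm_inv, div_le_iff₀ (by positivity)]
    refine h4.trans_eq ?_
    change D * S ^ β * _ = _
    field_simp
  have hP := ((hA.deriv (differentiableOn_singularFn γ δ)).sum_sq_le (by linarith) hρ1
    (by positivity) hcircle (2 * N))
  -- Coefficient n - 1 of the derivative is n times coefficient n, with n ≥ N, and 2(n-1) ≤ 4N gives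
  -- the weight at least (e^(-2))^4.
  have hlow : ∀ n ∈ Finset.Ico N (2 * N), Real.exp (-8) * N ^ 2 * ‖PowerSeries.coeff n A‖ ^ 2
      ≤ ‖PowerSeries.coeff (n - 1) (PowerSeries.derivative ℂ A)‖ ^ 2 * ρ ^ (2 * (n - 1)) := by
    intro n hn
    rw [Finset.mem_Ico] at hn
    obtain ⟨j, rfl⟩ : ∃ j, n = j + 1 := ⟨n - 1, by omega⟩
    rw [Nat.add_sub_cancel, PowerSeries.coeff_derivative, norm_mul, mul_pow]
    have h5 : (N : ℝ) ^ 2 ≤ ‖(j : ℂ) + 1‖ ^ 2 := by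
      have : ‖(j : ℂ) + 1‖ = (j + 1 : ℝ) := by
        rw [← Nat.cast_succ, Complex.norm_natCast]; push_cast; rfl
      rw [this]
      gcongr
      exact_mod_cast hn.1
    have h6 : Real.exp (-8) ≤ ρ ^ (2 * j) := by
      calc Real.exp (-8) = Real.exp (-2) ^ 4 := by rw [← Real.exp_nat_mul]; norm_num
        _ ≤ (ρ ^ N) ^ 4 := by gcongr; exact exp_neg_two_le_pow hN2
        _ = ρ ^ (N * 4) := by rw [pow_mul]
        _ ≤ ρ ^ (2 * j) := pow_le_pow_of_le_one (by linarith) hρ1.le (by omega)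
    calc Real.exp (-8) * N ^ 2 * ‖PowerSeries.coeff (j + 1) A‖ ^ 2
        ≤ ρ ^ (2 * j) * ‖(j : ℂ) + 1‖ ^ 2 * ‖PowerSeries.coeff (j + 1) A‖ ^ 2 := by gcongr
      _ = _ := by ring
  have hsum : ∑ n ∈ Finset.Ico N (2 * N), Real.exp (-8) * N ^ 2 * ‖PowerSeries.coeff n A‖ ^ 2
      ≤ ∑ n ∈ Finset.range (2 * N),
        ‖PowerSeries.coeff n (PowerSeries.derivative ℂ A)‖ ^ 2 * ρ ^ (2 * n) := by
    refine (Finset.sum_le_sum hlow).trans ?_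
    rw [← Finset.sum_image (g := fun n => n - 1) (f := fun n =>
      ‖PowerSeries.coeff n (PowerSeries.derivative ℂ A)‖ ^ 2 * ρ ^ (2 * n))]
    · refine Finset.sum_le_sum_of_subset_of_nonneg ?_ fun i _ _ => by
        have : 0 ≤ ρ := by linarith
        positivity
      intro n hn
      simp only [Finset.mem_image, Finset.mem_Ico, Finset.mem_range] at hn ⊢
      omega
    · intro a ha b hb hab
      simp only [Finset.coe_Ico, Set.mem_Ico] at ha hb hab
      omega
  have h7 : C * (D * S ^ β * N) / (1 - ρ ^ 2) ≤ C * (D * S ^ β) * N ^ 2 := by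
    have hlt : 1 / (N : ℝ) ≤ 1 - ρ ^ 2 := by rw [hρ]; nlinarith
    rw [div_le_iff₀ (by linarith)]
    calc C * (D * S ^ β * N) = C * (D * S ^ β) * N ^ 2 * (1 / N) := by field_simp
      _ ≤ _ := by gcongr
  have h8 := (hsum.trans hP).trans h7
  rw [← Finset.mul_sum, mul_assoc, mul_comm (Real.exp (-8)), mul_assoc,
    mul_comm (C * (D * S ^ β)), mul_le_mul_iff_right₀ (by positivity), Real.exp_neg] at h8
  have h9 : S ^ β ≤ E * (k : ℝ) ^ β := by
    have := h3 k hk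
    simp only [S, hN]; push_cast; exact this
  rw [pow_succ', ← hN]
  rw [← div_eq_mul_inv, div_le_iff₀ (Real.exp_pos 8)] at h8
  refine h8.trans ?_
  calc C * (D * S ^ β) * Real.exp 8 ≤ C * (D * (E * (k : ℝ) ^ β)) * Real.exp 8 := by gcongr
    _ = _ := by ring

/-! ## Recursions for logarithmic derivatives and for linear differential equations -/

section Recursions

variable {K : Type*} [Field K]

/-- The coefficients of `A' / A`, where `A` has the coefficients `a` and `a 0 = 1`. -/
def logDerivSeq (a : ℕ → K) (n : ℕ) : K :=
  (n + 1) * a (n + 1) - ∑ i : Fin n, logDerivSeq a i * a (n - i)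
termination_by n
decreasing_by exact i.2

/-- The coefficients of the solution of `F' = c F` with `F(0) = 1`. -/
def odeSeq (c : ℕ → K) : ℕ → K
  | 0 => 1
  | n + 1 => (∑ i : Fin (n + 1), c (n - i) * odeSeq c i) / (n + 1)
termination_by n => n
decreasing_by exact i.2

lemma logDerivSeq_eq (a : ℕ → K) (n : ℕ) : logDerivSeq a n
    = (n + 1) * a (n + 1) - ∑ i ∈ Finset.range n, logDerivSeq a i * a (n - i) := by
  rw [logDerivSeq, Finset.sum_range]

lemma odeSeq_zero (c : ℕ → K) : odeSeq c 0 = 1 := by rw [odeSeq]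

lemma odeSeq_succ (c : ℕ → K) (n : ℕ) : odeSeq c (n + 1)
    = (∑ i ∈ Finset.range (n + 1), c (n - i) * odeSeq c i) / (n + 1) := by
  rw [odeSeq, Finset.sum_range]

lemma coeff_mul_eq_sum_range (A B : PowerSeries K) (n : ℕ) : PowerSeries.coeff n (A * B)
    = ∑ i ∈ Finset.range (n + 1), PowerSeries.coeff i A * PowerSeries.coeff (n - i) B := by
  rw [PowerSeries.coeff_mul]
  exact Finset.Nat.sum_antidiagonal_eq_sum_range_succ
    (fun i j => PowerSeries.coeff i A * PowerSeries.coeff j B) n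

lemma mk_logDerivSeq_mul {a : ℕ → K} (ha : a 0 = 1) :
    PowerSeries.mk (logDerivSeq a) * PowerSeries.mk a
      = PowerSeries.derivative K (PowerSeries.mk a) := by
  ext n
  rw [coeff_mul_eq_sum_range, PowerSeries.coeff_derivative]
  simp only [PowerSeries.coeff_mk]
  rw [Finset.sum_range_succ, logDerivSeq_eq a n, Nat.sub_self, ha]
  ring

lemma eq_mk_logDerivSeq {a : ℕ → K} (ha : a 0 = 1) {C : PowerSeries K}
    (h : C * PowerSeries.mk a = PowerSeries.derivative K (PowerSeries.mk a)) :
    C = PowerSeries.mk (logDerivSeq a) := by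
  have h0 : PowerSeries.mk a ≠ 0 := by
    intro h0
    have := congrArg (PowerSeries.coeff 0) h0
    simp [ha] at this
  exact mul_right_cancel₀ h0 (h.trans (mk_logDerivSeq_mul ha).symm)

lemma derivative_mk_odeSeq [CharZero K] (c : ℕ → K) :
    PowerSeries.derivative K (PowerSeries.mk (odeSeq c))
      = PowerSeries.mk c * PowerSeries.mk (odeSeq c) := by
  ext n
  have hn : (n + 1 : K) ≠ 0 := by exact_mod_cast n.succ_ne_zero
  rw [mul_comm, coeff_mul_eq_sum_range, PowerSeries.coeff_derivative]
  simp only [PowerSeries.coeff_mk]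
  rw [odeSeq_succ, div_mul_cancel₀ _ hn]
  exact Finset.sum_congr rfl fun i _ => mul_comm _ _

lemma eq_mk_odeSeq [CharZero K] {c : ℕ → K} {F : PowerSeries K}
    (h0 : PowerSeries.coeff 0 F = 1)
    (h : PowerSeries.derivative K F = PowerSeries.mk c * F) : F = PowerSeries.mk (odeSeq c) := by
  ext n
  rw [PowerSeries.coeff_mk]
  induction n using Nat.strong_induction_on with
  | _ n ih =>
    rcases n with _ | n
    · rw [h0, odeSeq_zero]
    · have hn : (n + 1 : K) ≠ 0 := by exact_mod_cast n.succ_ne_zero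
      have := congrArg (PowerSeries.coeff n) h
      rw [mul_comm, coeff_mul_eq_sum_range, PowerSeries.coeff_derivative] at this
      rw [odeSeq_succ, eq_div_iff hn, this]
      refine Finset.sum_congr rfl fun i hi => ?_
      rw [ih i (Finset.mem_range.1 hi), PowerSeries.coeff_mk, mul_comm]

/-- The recursions use field operations only, so they commute with ring homomorphisms. This links
the real coefficients with the complex power series used in the analysis and in the programs. -/
lemma map_logDerivSeq {L : Type*} [Field L] (φ : K →+* L) (a : ℕ → K) (n : ℕ) :
    φ (logDerivSeq a n) = logDerivSeq (fun i => φ (a i)) n := by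
  induction n using Nat.strong_induction_on with
  | _ n ih =>
    rw [logDerivSeq_eq, logDerivSeq_eq, map_sub, map_mul, map_add, map_natCast, map_one, map_sum]
    congr 1
    refine Finset.sum_congr rfl fun i hi => ?_
    rw [map_mul, ih i (Finset.mem_range.1 hi)]

lemma map_odeSeq {L : Type*} [Field L] (φ : K →+* L) (c : ℕ → K) (n : ℕ) :
    φ (odeSeq c n) = odeSeq (fun i => φ (c i)) n := by
  induction n using Nat.strong_induction_on with
  | _ n ih =>
    rcases n with _ | n
    · rw [odeSeq_zero, odeSeq_zero, map_one]
    · rw [odeSeq_succ, odeSeq_succ, map_div₀, map_add, map_natCast, map_one, map_sum]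
      congr 1
      refine Finset.sum_congr rfl fun i hi => ?_
      rw [map_mul, ih i (Finset.mem_range.1 hi)]

variable (K) in
/-- The coefficients of `(1/z) ln (1/(1-z))`. -/
def logQuotSeq (n : ℕ) : K := 1 / (n + 1)

variable (K) in
/-- The coefficients of `(2/z) ln ((1/z) ln (1/(1-z)))`. -/
def logLogQuotSeq (n : ℕ) : K := 2 * logDerivSeq (logQuotSeq K) n / (n + 1)

/-- The coefficients of the logarithmic derivative of `singularFn γ δ`. -/
def singularLogDerivSeq (γ δ : K) (n : ℕ) : K :=
  1 / 2 + γ * logDerivSeq (logQuotSeq K) n + δ * logDerivSeq (logLogQuotSeq K) n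

/-- The coefficients of `singularFn γ δ`. -/
def singularSeq (γ δ : K) : ℕ → K := odeSeq (singularLogDerivSeq γ δ)

lemma logQuotSeq_zero : logQuotSeq K 0 = 1 := by simp [logQuotSeq]

lemma logLogQuotSeq_zero [CharZero K] : logLogQuotSeq K 0 = 1 := by
  rw [logLogQuotSeq, logDerivSeq_eq]
  simp [logQuotSeq]
  norm_num

lemma map_logQuotSeq {L : Type*} [Field L] (φ : K →+* L) (n : ℕ) :
    φ (logQuotSeq K n) = logQuotSeq L n := by
  simp [logQuotSeq]

lemma map_logLogQuotSeq {L : Type*} [Field L] (φ : K →+* L) (n : ℕ) :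
    φ (logLogQuotSeq K n) = logLogQuotSeq L n := by
  simp [logLogQuotSeq, map_logDerivSeq, map_logQuotSeq, map_ofNat φ 2]

lemma map_singularSeq {L : Type*} [Field L] (φ : K →+* L) (γ δ : K) (n : ℕ) :
    φ (singularSeq γ δ n) = singularSeq (φ γ) (φ δ) n := by
  rw [singularSeq, map_odeSeq, singularSeq]
  congr 1
  ext i
  simp [singularLogDerivSeq, map_logDerivSeq, map_logQuotSeq, map_logLogQuotSeq, map_ofNat φ 2]

/-- In the sum of the two logarithmic derivatives the γ and δ terms cancel and 1/(1-z) remains. The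
product and 1/(1-z) therefore solve the same equation F' = F/(1-z) with F(0) = 1. -/
lemma mk_singularSeq_mul_neg [CharZero K] (γ δ : K) :
    PowerSeries.mk (singularSeq γ δ) * PowerSeries.mk (singularSeq (-γ) (-δ))
      = PowerSeries.mk fun _ => 1 := by
  have hc : PowerSeries.mk (singularLogDerivSeq γ δ)
      + PowerSeries.mk (singularLogDerivSeq (-γ) (-δ)) = PowerSeries.mk fun _ => (1 : K) := by
    ext n
    simp only [map_add, PowerSeries.coeff_mk, singularLogDerivSeq]
    ring
  rw [eq_mk_odeSeq (F := PowerSeries.mk (singularSeq γ δ) *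
    PowerSeries.mk (singularSeq (-γ) (-δ))) (c := fun _ => 1)]
  · rw [← eq_mk_odeSeq (F := PowerSeries.mk fun _ => (1 : K)) (by simp)]
    ext n
    rw [coeff_mul_eq_sum_range, PowerSeries.coeff_derivative]
    simp
  · rw [coeff_mul_eq_sum_range]
    simp [singularSeq, odeSeq_zero]
  · rw [Derivation.leibniz, singularSeq, singularSeq, derivative_mk_odeSeq, derivative_mk_odeSeq,
      ← hc, smul_eq_mul, smul_eq_mul]
    ring

end Recursions

/-! ## The Taylor coefficients of `singularFn` -/

lemma hasTaylor_logQuot : HasTaylor logQuot (PowerSeries.mk (logQuotSeq ℂ)) := by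
  intro z hz
  rcases eq_or_ne z 0 with rfl | h0
  · have h2 := hasSum_single (f := fun n => PowerSeries.coeff n (PowerSeries.mk (logQuotSeq ℂ))
      * (0 : ℂ) ^ n) 0 fun n hn => by simp [hn]
    simpa [logQuot_zero, logQuotSeq_zero] using h2
  · have h := (hasSum_nat_add_iff' 1).2 (Complex.hasSum_taylorSeries_neg_log hz)
    have h2 := h.div_const z
    rw [logQuot_of_ne h0]
    simp only [Finset.sum_range_one, pow_zero, Nat.cast_zero, div_zero, sub_zero] at h2
    refine h2.congr_fun ?_ |> id
    intro n
    rw [PowerSeries.coeff_mk, logQuotSeq]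
    push_cast
    field_simp
    ring

lemma differentiableOn_ball_logQuot : DifferentiableOn ℂ logQuot (Metric.ball 0 1) :=
  differentiableOn_logQuot.mono ball_subset_slitDomain

lemma differentiableOn_ball_logLogQuot : DifferentiableOn ℂ logLogQuot (Metric.ball 0 1) :=
  differentiableOn_logLogQuot.mono ball_subset_slitDomain

/-- The quotient is analytic because f has no zero, and its series is determined by the product with
A being the derivative of A. -/
lemma hasTaylor_logDeriv {f : ℂ → ℂ} {a : ℕ → ℂ} (hf : DifferentiableOn ℂ f (Metric.ball 0 1))
    (hne : ∀ z : ℂ, ‖z‖ < 1 → f z ≠ 0) (ha : HasTaylor f (PowerSeries.mk a)) (ha0 : a 0 = 1) :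
    HasTaylor (fun z => deriv f z / f z) (PowerSeries.mk (logDerivSeq a)) := by
  have hd : DifferentiableOn ℂ (fun z => deriv f z / f z) (Metric.ball 0 1) :=
    (hf.deriv Metric.isOpen_ball).div hf fun z hz => hne z (by simpa using hz)
  have h := hasTaylor_taylor hd
  have heq := ((h.mul ha).congr (g := deriv f) fun z hz => by
    simp [div_mul_cancel₀ _ (hne z hz)]).unique (ha.deriv hf)
  rwa [eq_mk_logDerivSeq ha0 heq] at h

lemma hasTaylor_id : HasTaylor id (PowerSeries.X) := by
  intro z hz
  have h2 := hasSum_single (f := fun n => PowerSeries.coeff n (PowerSeries.X : PowerSeries ℂ)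
      * z ^ n) 1 fun n hn => by simp [PowerSeries.coeff_X, hn]
  simpa using h2

/-- Coefficient n of h + z h' is n + 1 times that of h; comparison with 2 g'/g gives the formula. -/
lemma hasTaylor_logLogQuot : HasTaylor logLogQuot (PowerSeries.mk (logLogQuotSeq ℂ)) := by
  have hg := hasTaylor_logDeriv differentiableOn_ball_logQuot
    (fun z hz => logQuot_ne_zero (mem_slitDomain_of_norm_lt hz)) hasTaylor_logQuot logQuotSeq_zero
  have hh := hasTaylor_taylor differentiableOn_ball_logLogQuot
  have h1 := hh.add (hasTaylor_id.mul (hh.deriv differentiableOn_ball_logLogQuot))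
  have h2 := hg.const_mul 2
  have heq := h1.unique (h2.congr fun z hz =>
    (logLogQuot_add_mul_deriv (mem_slitDomain_of_norm_lt hz)).symm)
  convert hh using 1
  ext n
  have hn := congrArg (PowerSeries.coeff n) heq
  have hn0 : (n + 1 : ℂ) ≠ 0 := by exact_mod_cast n.succ_ne_zero
  rw [PowerSeries.coeff_mk, logLogQuotSeq, div_eq_iff hn0]
  rw [PowerSeries.coeff_C_mul, PowerSeries.coeff_mk, map_add] at hn
  rw [← hn]
  rcases n with _ | n
  · simp
  · rw [PowerSeries.coeff_succ_X_mul, PowerSeries.coeff_derivative]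
    push_cast; ring

lemma hasTaylor_singularFn (γ δ : ℝ) :
    HasTaylor (singularFn γ δ) (PowerSeries.mk (singularSeq (γ : ℂ) (δ : ℂ))) := by
  have hg := hasTaylor_logDeriv differentiableOn_ball_logQuot
    (fun z hz => logQuot_ne_zero (mem_slitDomain_of_norm_lt hz)) hasTaylor_logQuot logQuotSeq_zero
  have hh := hasTaylor_logDeriv differentiableOn_ball_logLogQuot
    (fun z hz => logLogQuot_ne_zero (mem_slitDomain_of_norm_lt hz)) hasTaylor_logLogQuot
    logLogQuotSeq_zero
  have hc := ((hasTaylor_geometric.const_mul (1 / 2)).add (hg.const_mul γ)).add (hh.const_mul δ)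
  have hf := hasTaylor_taylor (differentiableOn_singularFn γ δ)
  have heq := (hf.deriv (differentiableOn_singularFn γ δ)).unique ((hc.mul hf).congr fun z hz => by
    rw [(hasDerivAt_singularFn (mem_slitDomain_of_norm_lt hz)).deriv, mul_comm (singularFn γ δ z)]
    simp [singularLogDeriv])
  have h0 : PowerSeries.coeff 0 (taylor (singularFn γ δ)) = 1 := by
    rw [hf.coeff_zero]; simp [singularFn]
  have := eq_mk_odeSeq (c := singularLogDerivSeq (γ : ℂ) δ) h0 (by
    rw [heq]
    congr 1
    ext n
    simp [singularLogDerivSeq, PowerSeries.coeff_C_mul])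
  rwa [this] at hf

theorem isTaylorOnDisc_singularFn (γ δ : ℝ) :
    IsTaylorOnDisc (singularFn γ δ) (singularSeq γ δ) := by
  intro z hz
  refine (hasTaylor_singularFn γ δ z hz).congr_fun ?_ |> id
  intro n
  rw [PowerSeries.coeff_mk, ← Complex.ofRealHom_eq_coe, ← Complex.ofRealHom_eq_coe,
    ← Complex.ofRealHom_eq_coe, map_singularSeq]

theorem exists_block_sum_singularSeq_sq_le {γ δ β : ℝ} (h : 2 * γ < β ∨ 2 * γ ≤ β ∧ δ ≤ 0) :
    ∃ K : ℝ, 0 < K ∧ ∀ k : ℕ, 1 ≤ k →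
      ∑ n ∈ Finset.Ico (2 ^ k) (2 ^ (k + 1)), singularSeq γ δ n ^ 2 ≤ K * (k : ℝ) ^ β := by
  obtain ⟨K, hK, hb⟩ := exists_block_sum_sq_le h (hasTaylor_singularFn γ δ)
  refine ⟨K, hK, fun k hk => (le_of_eq ?_).trans (hb k hk)⟩
  refine Finset.sum_congr rfl fun n _ => ?_
  rw [PowerSeries.coeff_mk, ← Complex.ofRealHom_eq_coe, ← Complex.ofRealHom_eq_coe,
    ← map_singularSeq, Complex.ofRealHom_eq_coe, Complex.norm_real, Real.norm_eq_abs, sq_abs]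

/-! ## Norms and products of lower-triangular Toeplitz matrices -/

lemma ltt_apply (a : ℕ → ℝ) (i j : ℕ) : ltt a i j = if j ≤ i then a (i - j) else 0 := rfl

/-- On and below the diagonal, entry (i, j) of the product is coefficient i - j of the product of
the two series. -/
lemma leading_ltt_mul_leading_ltt {l r : ℕ → ℝ}
    (h : PowerSeries.mk l * PowerSeries.mk r = PowerSeries.mk fun _ => 1) (n : ℕ) :
    leading n (ltt l) * leading n (ltt r) = leading n Mcount := by
  ext i j
  rw [Matrix.mul_apply]
  simp only [leading, Matrix.submatrix_apply, Mcount, ltt_apply]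
  rw [Fin.sum_univ_eq_sum_range (fun k => (if k ≤ (i : ℕ) then l (i - k) else 0) *
    (if (j : ℕ) ≤ k then r (k - j) else 0)) n]
  split_ifs with hij
  · rw [← Finset.sum_subset (s₁ := Finset.Ico (j : ℕ) (i + 1))]
    · rw [Finset.sum_Ico_eq_sum_range]
      have h2 := congrArg (PowerSeries.coeff (i - j : ℕ)) h
      rw [mul_comm, coeff_mul_eq_sum_range] at h2
      simp only [PowerSeries.coeff_mk] at h2
      rw [← h2, show (i : ℕ) + 1 - j = i - j + 1 by omega]
      refine Finset.sum_congr rfl fun m hm => ?_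
      rw [Finset.mem_range] at hm
      rw [if_pos (by omega), if_pos (by omega), Nat.add_sub_cancel_left, mul_comm,
        show (i : ℕ) - (j + m) = i - j - m by omega]
    · intro k hk
      rw [Finset.mem_Ico] at hk
      exact Finset.mem_range.2 (by omega)
    · intro k _ hk
      rw [Finset.mem_Ico] at hk
      by_cases h1 : k ≤ (i : ℕ)
      · rw [if_neg (show ¬ (j : ℕ) ≤ k by omega), mul_zero]
      · rw [if_neg h1, zero_mul]
  · refine Finset.sum_eq_zero fun k _ => ?_
    by_cases h1 : k ≤ (i : ℕ)
    · rw [if_neg (show ¬ (j : ℕ) ≤ k by omega), mul_zero]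
    · rw [if_neg h1, zero_mul]

lemma sum_col_sq_le (a : ℕ → ℝ) {n : ℕ} (j : Fin n) :
    ∑ i, leading n (ltt a) i j ^ 2 ≤ ∑ i ∈ Finset.range n, a i ^ 2 := by
  simp only [leading, Matrix.submatrix_apply, ltt_apply]
  rw [Fin.sum_univ_eq_sum_range (fun i => (if (j : ℕ) ≤ i then a (i - j) else 0) ^ 2) n,
    ← Finset.sum_subset (s₁ := Finset.Ico (j : ℕ) n), Finset.sum_Ico_eq_sum_range]
  · calc _ = ∑ m ∈ Finset.range (n - j), a m ^ 2 := by
          refine Finset.sum_congr rfl fun m _ => ?_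
          rw [if_pos (by omega), Nat.add_sub_cancel_left]
      _ ≤ _ := Finset.sum_le_sum_of_subset_of_nonneg
          (Finset.range_mono (Nat.sub_le _ _)) fun i _ _ => sq_nonneg _
  · intro k hk
    rw [Finset.mem_Ico] at hk
    exact Finset.mem_range.2 hk.2
  · intro k hk1 hk
    rw [Finset.mem_Ico] at hk
    rw [Finset.mem_range] at hk1
    rw [if_neg (by omega), zero_pow two_ne_zero]

lemma sum_row_sq_le (a : ℕ → ℝ) {n : ℕ} (i : Fin n) :
    ∑ j, leading n (ltt a) i j ^ 2 ≤ ∑ i ∈ Finset.range n, a i ^ 2 := by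
  simp only [leading, Matrix.submatrix_apply, ltt_apply]
  rw [Fin.sum_univ_eq_sum_range (fun j => (if j ≤ (i : ℕ) then a (i - j) else 0) ^ 2) n,
    ← Finset.sum_subset (s₁ := Finset.range ((i : ℕ) + 1))]
  · calc _ = ∑ j ∈ Finset.range ((i : ℕ) + 1), a ((i : ℕ) + 1 - 1 - j) ^ 2 := by
          refine Finset.sum_congr rfl fun m hm => ?_
          rw [Finset.mem_range] at hm
          rw [if_pos (by omega), Nat.add_sub_cancel]
      _ = ∑ j ∈ Finset.range ((i : ℕ) + 1), a j ^ 2 :=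
          Finset.sum_range_reflect (fun j => a j ^ 2) _
      _ ≤ _ := Finset.sum_le_sum_of_subset_of_nonneg
          (Finset.range_mono (by omega)) fun i _ _ => sq_nonneg _
  · exact Finset.range_mono (by omega)
  · intro k hk1 hk
    rw [Finset.mem_range] at hk hk1
    rw [if_neg (by omega), zero_pow two_ne_zero]

/-- The first column contains all of a 0, …, a (n-1), and every other column an initial piece of
them. -/
lemma colNorm_leading_ltt (a : ℕ → ℝ) {n : ℕ} (hn : 0 < n) :
    colNorm (leading n (ltt a)) = √(∑ i ∈ Finset.range n, a i ^ 2) := by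
  have : Nonempty (Fin n) := ⟨⟨0, hn⟩⟩
  refine le_antisymm (ciSup_le fun j => Real.sqrt_le_sqrt (sum_col_sq_le a j)) ?_
  refine le_trans (le_of_eq ?_) (le_ciSup (Set.finite_range _).bddAbove (⟨0, hn⟩ : Fin n))
  congr 1
  simp only [leading, Matrix.submatrix_apply, ltt_apply]
  rw [← Fin.sum_univ_eq_sum_range (fun i => a i ^ 2) n]
  simp

lemma rowNorm_leading_ltt_le (a : ℕ → ℝ) (n : ℕ) :
    rowNorm (leading n (ltt a)) ≤ √(∑ i ∈ Finset.range n, a i ^ 2) :=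
  Real.iSup_le (fun i => Real.sqrt_le_sqrt (sum_row_sq_le a i)) (Real.sqrt_nonneg _)

lemma rowNorm_nonneg {n : ℕ} (A : Matrix (Fin n) (Fin n) ℝ) : 0 ≤ rowNorm A :=
  Real.iSup_nonneg fun _ => Real.sqrt_nonneg _

lemma tendsto_colNorm_leading_ltt {a : ℕ → ℝ} (h : Summable fun n => a n ^ 2) :
    Tendsto (fun n => colNorm (leading n (ltt a))) atTop (𝓝 √(∑' n, a n ^ 2)) := by
  refine Tendsto.congr' ?_ ((Real.continuous_sqrt.tendsto _).comp h.hasSum.tendsto_sum_nat)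
  filter_upwards [eventually_gt_atTop 0] with n hn
  exact (colNorm_leading_ltt a hn).symm

/-! ## Sums over dyadic blocks -/

lemma sum_range_two_pow_eq (u : ℕ → ℝ) {k m : ℕ} (h : k ≤ m) :
    ∑ n ∈ Finset.range (2 ^ m), u n = ∑ n ∈ Finset.range (2 ^ k), u n
      + ∑ j ∈ Finset.Ico k m, ∑ n ∈ Finset.Ico (2 ^ j) (2 ^ (j + 1)), u n := by
  induction m, h using Nat.le_induction with
  | base => simp
  | succ m hm ih =>
    rw [Finset.sum_Ico_succ_top hm, ← add_assoc, ← ih, Finset.sum_range_add_sum_Ico _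
      (Nat.pow_le_pow_right (by norm_num) (by omega))]

/-- A series of nonnegative terms with dyadic blocks of size `O(k ^ (-1 - η))` converges, with a
tail after `2 ^ k` terms of size `O(k ^ (-η / 2))`. -/
lemma summable_of_block_le {u : ℕ → ℝ} (hu : ∀ n, 0 ≤ u n) {K η : ℝ} (hK : 0 < K) (hη : 0 < η)
    (h : ∀ k : ℕ, 1 ≤ k → ∑ n ∈ Finset.Ico (2 ^ k) (2 ^ (k + 1)), u n ≤ K * (k : ℝ) ^ (-1 - η)) :
    Summable u ∧ ∃ D : ℝ, 0 < D ∧ ∀ k : ℕ, 1 ≤ k →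
      ∑' n, u n ≤ ∑ n ∈ Finset.range (2 ^ k), u n + D * (k : ℝ) ^ (-(η / 2)) := by
  have hs : Summable fun j : ℕ => (j : ℝ) ^ (-1 - η / 2) :=
    Real.summable_nat_rpow.2 (by linarith)
  set T := ∑' j : ℕ, (j : ℝ) ^ (-1 - η / 2)
  have hT : 0 ≤ T := tsum_nonneg fun j => by positivity
  have hpart : ∀ k m : ℕ, 1 ≤ k → k ≤ m → ∑ n ∈ Finset.range (2 ^ m), u n
      ≤ ∑ n ∈ Finset.range (2 ^ k), u n + K * T * (k : ℝ) ^ (-(η / 2)) := by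
    intro k m hk hkm
    rw [sum_range_two_pow_eq u hkm]
    gcongr
    have hk0 : (0 : ℝ) < k := by exact_mod_cast hk
    calc ∑ j ∈ Finset.Ico k m, ∑ n ∈ Finset.Ico (2 ^ j) (2 ^ (j + 1)), u n
        ≤ ∑ j ∈ Finset.Ico k m, K * (k : ℝ) ^ (-(η / 2)) * (j : ℝ) ^ (-1 - η / 2) := by
          refine Finset.sum_le_sum fun j hj => ?_
          rw [Finset.mem_Ico] at hj
          have hkj : (k : ℝ) ≤ j := by exact_mod_cast hj.1
          refine (h j (hk.trans hj.1)).trans ?_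
          -- Half of the surplus η makes the sum over the blocks converge, the other half is the
          -- rate of the tail.
          rw [mul_assoc, show -1 - η = -(η / 2) + (-1 - η / 2) by ring,
            Real.rpow_add (hk0.trans_le hkj)]
          refine mul_le_mul_of_nonneg_left (mul_le_mul_of_nonneg_right ?_ (by positivity)) hK.le
          exact Real.rpow_le_rpow_of_nonpos hk0 hkj (by linarith)
      _ = K * (k : ℝ) ^ (-(η / 2)) * ∑ j ∈ Finset.Ico k m, (j : ℝ) ^ (-1 - η / 2) := by
          rw [Finset.mul_sum]
      _ ≤ K * (k : ℝ) ^ (-(η / 2)) * T := by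
          gcongr
          exact hs.sum_le_tsum _ fun j _ => by positivity
      _ = _ := by ring
  have hall : ∀ k N : ℕ, 1 ≤ k → ∑ n ∈ Finset.range N, u n
      ≤ ∑ n ∈ Finset.range (2 ^ k), u n + K * T * (k : ℝ) ^ (-(η / 2)) := by
    intro k N hk
    refine le_trans ?_ (hpart k (max k N) hk (le_max_left _ _))
    refine Finset.sum_le_sum_of_subset_of_nonneg (Finset.range_mono ?_) fun i _ _ => hu i
    exact (le_max_right k N).trans Nat.lt_two_pow_self.le
  have hsum : Summable u := summable_of_sum_range_le hu fun N => hall 1 N le_rfl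
  -- The summand 1 only serves to make the constant visibly positive.
  refine ⟨hsum, K * T + 1, by positivity, fun k hk => ?_⟩
  refine (Real.tsum_le_of_sum_range_le hu fun N => hall k N hk).trans ?_
  gcongr
  linarith

/-- If the dyadic blocks of squares are of size `O(k ^ (1 + 2 α))`, the square root of the partial
sums is `O(log ^ (1 + α))`. -/
lemma sqrt_sum_sq_isBigO_of_block_le {a : ℕ → ℝ} {K α : ℝ} (hK : 0 < K) (hα : 0 < α)
    (h : ∀ k : ℕ, 1 ≤ k →
      ∑ n ∈ Finset.Ico (2 ^ k) (2 ^ (k + 1)), a n ^ 2 ≤ K * (k : ℝ) ^ (1 + 2 * α)) :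
    (fun n : ℕ => √(∑ i ∈ Finset.range n, a i ^ 2))
      =O[atTop] fun n : ℕ => Real.log n ^ (1 + α) := by
  set D := ∑ n ∈ Finset.range (2 ^ 1), a n ^ 2
  have hD : 0 ≤ D := Finset.sum_nonneg fun _ _ => sq_nonneg _
  refine IsBigO.of_bound (√(D + K) * 3 ^ (1 + α)) ?_
  filter_upwards [eventually_ge_atTop 2] with N hN
  have hN' : (2 : ℝ) ≤ N := by exact_mod_cast hN
  set m := Nat.log 2 N + 1
  have hm1 : 1 ≤ m := by omega
  have hm1' : (1 : ℝ) ≤ m := by exact_mod_cast hm1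
  have hlogN : Real.log 2 ≤ Real.log N := Real.log_le_log (by norm_num) hN'
  have hlog2 := Real.log_two_gt_d9
  have hm : (m : ℝ) ≤ 3 * Real.log N := by
    have h1 : (2 : ℝ) ^ (Nat.log 2 N) ≤ N := by exact_mod_cast Nat.pow_log_le_self 2 (by omega)
    have h2 := Real.log_le_log (by positivity) h1
    rw [Real.log_pow] at h2
    simp only [m]
    push_cast
    have h3 : 0 ≤ (Nat.log 2 N : ℝ) := by positivity
    nlinarith
  have hsum : ∑ i ∈ Finset.range N, a i ^ 2 ≤ (D + K) * ((m : ℝ) ^ (1 + α)) ^ 2 := by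
    have hpow : ((m : ℝ) ^ (1 + α)) ^ 2 = m * (m : ℝ) ^ (1 + 2 * α) := by
      rw [← Real.rpow_natCast, ← Real.rpow_mul (by linarith),
        show (1 + α) * ((2 : ℕ) : ℝ) = 1 + (1 + 2 * α) by push_cast; ring,
        Real.rpow_add (by linarith), Real.rpow_one]
    calc ∑ i ∈ Finset.range N, a i ^ 2 ≤ ∑ i ∈ Finset.range (2 ^ m), a i ^ 2 :=
          Finset.sum_le_sum_of_subset_of_nonneg
            (Finset.range_mono (Nat.lt_pow_succ_log_self (by norm_num) N).le)
            fun i _ _ => sq_nonneg _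
      _ = D + ∑ j ∈ Finset.Ico 1 m, ∑ n ∈ Finset.Ico (2 ^ j) (2 ^ (j + 1)), a n ^ 2 :=
          sum_range_two_pow_eq _ hm1
      _ ≤ D + ∑ j ∈ Finset.Ico 1 m, K * (m : ℝ) ^ (1 + 2 * α) := by
          gcongr with j hj
          rw [Finset.mem_Ico] at hj
          refine (h j hj.1).trans ?_
          have : (j : ℝ) ≤ m := by exact_mod_cast hj.2.le
          gcongr
      _ ≤ D + m * (K * (m : ℝ) ^ (1 + 2 * α)) := by
          rw [Finset.sum_const, nsmul_eq_mul, Nat.card_Ico]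
          gcongr
          exact Nat.sub_le _ _
      _ ≤ D * (m * (m : ℝ) ^ (1 + 2 * α)) + m * (K * (m : ℝ) ^ (1 + 2 * α)) := by
          gcongr
          refine le_mul_of_one_le_right hD (one_le_mul_of_one_le_of_one_le hm1' ?_)
          exact Real.one_le_rpow hm1' (by linarith)
      _ = _ := by rw [hpow]; ring
  rw [Real.norm_of_nonneg (Real.sqrt_nonneg _),
    Real.norm_of_nonneg (Real.rpow_nonneg (by linarith) _)]
  calc √(∑ i ∈ Finset.range N, a i ^ 2) ≤ √((D + K) * ((m : ℝ) ^ (1 + α)) ^ 2) :=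
        Real.sqrt_le_sqrt hsum
    _ = √(D + K) * (m : ℝ) ^ (1 + α) := by
        rw [Real.sqrt_mul (by linarith), Real.sqrt_sq (by positivity)]
    _ ≤ √(D + K) * (3 * Real.log N) ^ (1 + α) := by gcongr
    _ = _ := by rw [Real.mul_rpow (by norm_num) (by linarith)]; ring

lemma rowNorm_isBigO {a : ℕ → ℝ} {K α : ℝ} (hK : 0 < K) (hα : 0 < α)
    (h : ∀ k : ℕ, 1 ≤ k →
      ∑ n ∈ Finset.Ico (2 ^ k) (2 ^ (k + 1)), a n ^ 2 ≤ K * (k : ℝ) ^ (1 + 2 * α)) :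
    (fun n : ℕ => rowNorm (leading n (ltt a))) =O[atTop] fun n : ℕ => Real.log n ^ (1 + α) := by
  refine IsBigO.trans (IsBigO.of_bound 1 (.of_forall fun n => ?_))
    (sqrt_sum_sq_isBigO_of_block_le hK hα h)
  rw [Real.norm_of_nonneg (rowNorm_nonneg _), Real.norm_of_nonneg (Real.sqrt_nonneg _), one_mul]
  exact rowNorm_leading_ltt_le a n

/-! ## Primitive recursive rational arithmetic -/

/-- Codes of rational numbers: `(p, m, d)` stands for `(p - m) / (d + 1)`. -/
abbrev RatCode : Type := ℕ × ℕ × ℕ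

namespace RatCode

/-- The real number with a given code. -/
def val (q : RatCode) : ℝ := ((q.1 : ℝ) - q.2.1) / (q.2.2 + 1)

/-- The code of a natural number. -/
def ofNat (n : ℕ) : RatCode := (n, 0, 0)

/-- Sum of codes. -/
def add (q r : RatCode) : RatCode :=
  (q.1 * (r.2.2 + 1) + r.1 * (q.2.2 + 1), q.2.1 * (r.2.2 + 1) + r.2.1 * (q.2.2 + 1),
    q.2.2 * r.2.2 + q.2.2 + r.2.2)

/-- Negation of codes. -/
def neg (q : RatCode) : RatCode := (q.2.1, q.1, q.2.2)

/-- Product of codes. -/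
def mul (q r : RatCode) : RatCode :=
  (q.1 * r.1 + q.2.1 * r.2.1, q.1 * r.2.1 + q.2.1 * r.1, q.2.2 * r.2.2 + q.2.2 + r.2.2)

/-- Quotient of a code by `n + 1`. -/
def divSucc (q : RatCode) (n : ℕ) : RatCode := (q.1, q.2.1, q.2.2 * n + q.2.2 + n)

/-- Sum of the first `n` codes of a sequence. -/
def sum (f : ℕ → RatCode) (n : ℕ) : RatCode :=
  Nat.rec (ofNat 0) (fun i s => add s (f i)) n

lemma val_ofNat (n : ℕ) : val (ofNat n) = n := by simp [val, ofNat]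

lemma val_add (q r : RatCode) : val (add q r) = val q + val r := by
  have h1 : (q.2.2 + 1 : ℝ) ≠ 0 := by positivity
  have h2 : (r.2.2 + 1 : ℝ) ≠ 0 := by positivity
  have h3 : (q.2.2 * r.2.2 + q.2.2 + r.2.2 + 1 : ℝ) = (q.2.2 + 1) * (r.2.2 + 1) := by ring
  simp only [val, add]
  push_cast
  rw [h3]
  field_simp
  ring

lemma val_neg (q : RatCode) : val (neg q) = -val q := by
  simp only [val, neg]; rw [← neg_div, neg_sub]

lemma val_mul (q r : RatCode) : val (mul q r) = val q * val r := by
  have h1 : (q.2.2 + 1 : ℝ) ≠ 0 := by positivity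
  have h2 : (r.2.2 + 1 : ℝ) ≠ 0 := by positivity
  have h3 : (q.2.2 * r.2.2 + q.2.2 + r.2.2 + 1 : ℝ) = (q.2.2 + 1) * (r.2.2 + 1) := by ring
  simp only [val, mul]
  push_cast
  rw [h3]
  field_simp
  ring

lemma val_divSucc (q : RatCode) (n : ℕ) : val (divSucc q n) = val q / (n + 1) := by
  have h1 : (q.2.2 + 1 : ℝ) ≠ 0 := by positivity
  have h2 : (n + 1 : ℝ) ≠ 0 := by positivity
  have h3 : (q.2.2 * n + q.2.2 + n + 1 : ℝ) = (q.2.2 + 1) * (n + 1) := by ring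
  simp only [val, divSucc]
  push_cast
  rw [h3]
  field_simp

lemma val_sum (f : ℕ → RatCode) (n : ℕ) :
    val (sum f n) = ∑ i ∈ Finset.range n, val (f i) := by
  induction n with
  | zero => simp [sum, val_ofNat]
  | succ n ih => rw [Finset.sum_range_succ, ← ih, ← val_add]; rfl

section Primrec

variable {α : Type*} [Primcodable α]

lemma primrec_ofNat {f : α → ℕ} (hf : Primrec f) : Primrec fun a => ofNat (f a) :=
  hf.pair ((Primrec.const 0).pair (Primrec.const 0))

lemma primrec_neg {f : α → RatCode} (hf : Primrec f) : Primrec fun a => neg (f a) :=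
  (Primrec.fst.comp (Primrec.snd.comp hf)).pair
    ((Primrec.fst.comp hf).pair (Primrec.snd.comp (Primrec.snd.comp hf)))

lemma primrec_add {f g : α → RatCode} (hf : Primrec f) (hg : Primrec g) :
    Primrec fun a => add (f a) (g a) := by
  have f1 := Primrec.fst.comp hf
  have f2 := Primrec.fst.comp (Primrec.snd.comp hf)
  have f3 := Primrec.snd.comp (Primrec.snd.comp hf)
  have g1 := Primrec.fst.comp hg
  have g2 := Primrec.fst.comp (Primrec.snd.comp hg)
  have g3 := Primrec.snd.comp (Primrec.snd.comp hg)
  have f4 := Primrec.succ.comp f3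
  have g4 := Primrec.succ.comp g3
  exact (Primrec.nat_add.comp (Primrec.nat_mul.comp f1 g4) (Primrec.nat_mul.comp g1 f4)).pair
    ((Primrec.nat_add.comp (Primrec.nat_mul.comp f2 g4) (Primrec.nat_mul.comp g2 f4)).pair
      (Primrec.nat_add.comp (Primrec.nat_add.comp (Primrec.nat_mul.comp f3 g3) f3) g3))

lemma primrec_mul {f g : α → RatCode} (hf : Primrec f) (hg : Primrec g) :
    Primrec fun a => mul (f a) (g a) := by
  have f1 := Primrec.fst.comp hf
  have f2 := Primrec.fst.comp (Primrec.snd.comp hf)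
  have f3 := Primrec.snd.comp (Primrec.snd.comp hf)
  have g1 := Primrec.fst.comp hg
  have g2 := Primrec.fst.comp (Primrec.snd.comp hg)
  have g3 := Primrec.snd.comp (Primrec.snd.comp hg)
  exact (Primrec.nat_add.comp (Primrec.nat_mul.comp f1 g1) (Primrec.nat_mul.comp f2 g2)).pair
    ((Primrec.nat_add.comp (Primrec.nat_mul.comp f1 g2) (Primrec.nat_mul.comp f2 g1)).pair
      (Primrec.nat_add.comp (Primrec.nat_add.comp (Primrec.nat_mul.comp f3 g3) f3) g3))

lemma primrec_divSucc {f : α → RatCode} {n : α → ℕ} (hf : Primrec f) (hn : Primrec n) :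
    Primrec fun a => divSucc (f a) (n a) := by
  have f3 := Primrec.snd.comp (Primrec.snd.comp hf)
  exact (Primrec.fst.comp hf).pair ((Primrec.fst.comp (Primrec.snd.comp hf)).pair
    (Primrec.nat_add.comp (Primrec.nat_add.comp (Primrec.nat_mul.comp f3 hn) f3) hn))

lemma primrec_sum {f : α → ℕ → RatCode} {n : α → ℕ} (hf : Primrec₂ f) (hn : Primrec n) :
    Primrec fun a => sum (f a) (n a) := by
  refine Primrec.nat_rec' (h := fun a p => add p.2 (f a p.1)) hn
    (Primrec.const (ofNat 0)) ?_
  exact primrec_add (Primrec.snd.comp Primrec.snd)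
    (hf.comp Primrec.fst (Primrec.fst.comp Primrec.snd))

end Primrec

end RatCode

/-! ## Course-of-values recursion -/

section CourseOfValues

variable {α σ : Type*}

/-- The list of the first `n` values of the sequence defined by course-of-values recursion. -/
def courseList (step : α → List σ → σ) (a : α) (n : ℕ) : List σ :=
  Nat.rec [] (fun _ l => l ++ [step a l]) n

/-- The sequence defined by course-of-values recursion. -/
def courseVal (step : α → List σ → σ) (a : α) (n : ℕ) : σ := step a (courseList step a n)

lemma courseList_eq (step : α → List σ → σ) (a : α) (n : ℕ) :
    courseList step a n = (List.range n).map (courseVal step a) := by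
  induction n with
  | zero => rfl
  | succ n ih =>
    rw [List.range_succ, List.map_append, ← ih]; rfl

lemma length_courseList (step : α → List σ → σ) (a : α) (n : ℕ) :
    (courseList step a n).length = n := by
  rw [courseList_eq]; simp

lemma getD_courseList (step : α → List σ → σ) (a : α) {n i : ℕ} (h : i < n) (d : σ) :
    (courseList step a n).getD i d = courseVal step a i := by
  rw [courseList_eq]; simp [h]

/-- Course-of-values recursion is ordinary primitive recursion on the list of all earlier values. -/
lemma primrec_courseVal [Primcodable α] [Primcodable σ] {step : α → List σ → σ}
    (h : Primrec₂ step) : Primrec₂ (courseVal step) := by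
  refine h.comp Primrec.fst (Primrec.nat_rec' (h := fun (p : α × ℕ) (q : ℕ × List σ) =>
    q.2 ++ [step p.1 q.2]) Primrec.snd (Primrec.const []) ?_)
  exact Primrec.list_concat.comp (Primrec.snd.comp Primrec.snd)
    (h.comp (Primrec.fst.comp Primrec.fst) (Primrec.snd.comp Primrec.snd))

end CourseOfValues

/-! ### The coefficient recursions on rational codes -/

namespace RatCode

/-- One step of the recursion of `logDerivSeq`. -/
def logDerivStep (A : ℕ → RatCode) (_ : Unit) (l : List RatCode) : RatCode :=
  add (mul (ofNat (l.length + 1)) (A (l.length + 1)))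
    (neg (sum (fun i => mul (l.getD i (ofNat 0)) (A (l.length - i))) l.length))

/-- `logDerivSeq` on codes. -/
def logDeriv (A : ℕ → RatCode) : ℕ → RatCode := courseVal (logDerivStep A) ()

lemma val_logDeriv (A : ℕ → RatCode) (n : ℕ) :
    val (logDeriv A n) = logDerivSeq (fun i => val (A i)) n := by
  induction n using Nat.strong_induction_on with
  | _ n ih =>
    rw [logDeriv, courseVal, logDerivStep, length_courseList, val_add, val_mul, val_ofNat,
      val_neg, val_sum, logDerivSeq_eq, sub_eq_add_neg]
    push_cast
    congr 2
    refine Finset.sum_congr rfl fun i hi => ?_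
    rw [Finset.mem_range] at hi
    rw [val_mul, getD_courseList _ _ hi, ← ih i hi]; rfl

lemma primrec_logDeriv {A : ℕ → RatCode} (hA : Primrec A) : Primrec (logDeriv A) := by
  have hlen : Primrec fun p : Unit × List RatCode => p.2.length :=
    Primrec.list_length.comp Primrec.snd
  have hstep : Primrec₂ (logDerivStep A) := by
    refine primrec_add (primrec_mul (primrec_ofNat (Primrec.succ.comp hlen))
      (hA.comp (Primrec.succ.comp hlen))) (primrec_neg (primrec_sum ?_ hlen))
    exact primrec_mul ((Primrec.list_getD (ofNat 0)).comp (Primrec.snd.comp Primrec.fst)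
      Primrec.snd) (hA.comp (Primrec.nat_sub.comp (hlen.comp Primrec.fst) Primrec.snd))
  exact (primrec_courseVal hstep).comp (Primrec.const ()) Primrec.id

/-- One step of the recursion of `odeSeq`. -/
def odeStep {α : Type*} (c : α → ℕ → RatCode) (a : α) (l : List RatCode) : RatCode :=
  if l.length = 0 then ofNat 1 else
    divSucc (sum (fun i => mul (c a (l.length - 1 - i)) (l.getD i (ofNat 0))) l.length)
      (l.length - 1)

lemma val_courseVal_odeStep {α : Type*} (c : α → ℕ → RatCode) (a : α) (n : ℕ) :
    val (courseVal (odeStep c) a n) = odeSeq (fun i => val (c a i)) n := by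
  induction n using Nat.strong_induction_on with
  | _ n ih =>
    rw [courseVal, odeStep, length_courseList]
    rcases n with _ | n
    · rw [if_pos rfl, val_ofNat, odeSeq_zero]; simp
    · rw [if_neg n.succ_ne_zero, val_divSucc, val_sum, odeSeq_succ, Nat.add_sub_cancel]
      congr 1
      refine Finset.sum_congr rfl fun i hi => ?_
      rw [Finset.mem_range] at hi
      rw [val_mul, getD_courseList _ _ hi, ← ih i hi]

lemma primrec_courseVal_odeStep {α : Type*} [Primcodable α] {c : α → ℕ → RatCode}
    (hc : Primrec₂ c) : Primrec₂ (courseVal (odeStep c)) := by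
  have hlen : Primrec fun p : α × List RatCode => p.2.length :=
    Primrec.list_length.comp Primrec.snd
  have hpred : Primrec fun p : α × List RatCode => p.2.length - 1 :=
    Primrec.nat_sub.comp hlen (Primrec.const 1)
  refine primrec_courseVal (Primrec.ite (Primrec.eq.comp hlen (Primrec.const 0))
    (Primrec.const _) (primrec_divSucc (primrec_sum ?_ hlen) hpred))
  exact primrec_mul (hc.comp (Primrec.fst.comp Primrec.fst)
    (Primrec.nat_sub.comp (hpred.comp Primrec.fst) Primrec.snd))
    ((Primrec.list_getD (ofNat 0)).comp (Primrec.snd.comp Primrec.fst) Primrec.snd)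

/-- `logQuotSeq` on codes. -/
def logQuot (n : ℕ) : RatCode := (1, 0, n)

/-- `logLogQuotSeq` on codes. -/
def logLogQuot (n : ℕ) : RatCode := divSucc (mul (ofNat 2) (logDeriv logQuot n)) n

/-- `singularLogDerivSeq` on codes. -/
def singularLogDeriv (p : RatCode × RatCode) (n : ℕ) : RatCode :=
  add (add (1, 0, 1) (mul p.1 (logDeriv logQuot n))) (mul p.2 (logDeriv logLogQuot n))

/-- `singularSeq` on codes. -/
def singular : RatCode × RatCode → ℕ → RatCode := courseVal (odeStep singularLogDeriv)

lemma val_logQuot (n : ℕ) : val (logQuot n) = logQuotSeq ℝ n := by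
  simp [val, logQuot, logQuotSeq]

lemma val_logLogQuot (n : ℕ) : val (logLogQuot n) = logLogQuotSeq ℝ n := by
  rw [logLogQuot, val_divSucc, val_mul, val_ofNat, val_logDeriv, logLogQuotSeq]
  simp only [val_logQuot]
  push_cast; rfl

lemma val_singular (p : RatCode × RatCode) (n : ℕ) :
    val (singular p n) = singularSeq (val p.1) (val p.2) n := by
  rw [singular, val_courseVal_odeStep, singularSeq]
  congr 1
  ext i
  rw [singularLogDeriv, val_add, val_add, val_mul, val_mul, val_logDeriv, val_logDeriv,
    singularLogDerivSeq]
  simp only [val_logQuot, val_logLogQuot]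
  congr 2
  simp only [val]; norm_num

lemma primrec_logQuot : Primrec logQuot :=
  (Primrec.const 1).pair ((Primrec.const 0).pair Primrec.id)

lemma primrec_logLogQuot : Primrec logLogQuot :=
  primrec_divSucc (primrec_mul (Primrec.const _) (primrec_logDeriv primrec_logQuot)) Primrec.id

/-- Joint in the parameters and the index, because the rational approximations of the parameters
change with the accuracy demanded. -/
lemma primrec_singular : Primrec₂ singular := by
  refine primrec_courseVal_odeStep ?_
  exact primrec_add (primrec_add (Primrec.const _) (primrec_mul (Primrec.fst.comp Primrec.fst)
    ((primrec_logDeriv primrec_logQuot).comp Primrec.snd)))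
    (primrec_mul (Primrec.snd.comp Primrec.fst)
      ((primrec_logDeriv primrec_logLogQuot).comp Primrec.snd))

/-- Partial sums of the squares of `singularSeq` on codes. -/
def singularSqSum (p : RatCode × RatCode) (N : ℕ) : RatCode :=
  sum (fun n => mul (singular p n) (singular p n)) N

lemma val_singularSqSum (p : RatCode × RatCode) (N : ℕ) : val (singularSqSum p N)
    = ∑ n ∈ Finset.range N, singularSeq (val p.1) (val p.2) n ^ 2 := by
  rw [singularSqSum, val_sum]
  refine Finset.sum_congr rfl fun n _ => ?_
  rw [val_mul, val_singular, sq]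

lemma primrec_singularSqSum : Primrec₂ singularSqSum := by
  have h : Primrec fun q : (((RatCode × RatCode) × ℕ) × ℕ) => singular q.1.1 q.2 :=
    primrec_singular.comp (Primrec.fst.comp Primrec.fst) Primrec.snd
  exact primrec_sum (f := fun (q : (RatCode × RatCode) × ℕ) n =>
    mul (singular q.1 n) (singular q.1 n)) (primrec_mul h h) Primrec.snd

end RatCode

/-! ## Dependence of the coefficients on the parameters -/

/-- Closes the induction of `abs_logDerivSeq_le`; it is the reason for the growth factor 4 there. -/
lemma add_sum_four_pow_le (n : ℕ) :
    ((n : ℝ) + 1) + ∑ i ∈ Finset.range n, (4 : ℝ) ^ (i + 1) ≤ 4 ^ (n + 1) := by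
  induction n with
  | zero => norm_num
  | succ n ih =>
    rw [Finset.sum_range_succ]
    have : (1 : ℝ) ≤ 4 ^ (n + 1) := one_le_pow₀ (by norm_num)
    push_cast
    rw [pow_succ (4 : ℝ) (n + 1)]
    linarith

lemma sum_four_pow_add_two_pow_le (n : ℕ) :
    ∑ i ∈ Finset.range (n + 1), ((4 : ℝ) ^ i + 2 ^ i) ≤ 4 ^ (n + 1) := by
  induction n with
  | zero => norm_num
  | succ n ih =>
    rw [Finset.sum_range_succ]
    have : (2 : ℝ) ^ (n + 1) ≤ 4 ^ (n + 1) := pow_le_pow_left₀ (by norm_num) (by norm_num) _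
    have h0 : (0 : ℝ) < 4 ^ (n + 1) := by positivity
    rw [pow_succ (4 : ℝ) (n + 1)]
    linarith

/-- The true coefficients are far smaller. An explicit geometric rate is all that the computation of
the norm needs, since the accuracy of the parameters can be raised at will. -/
lemma abs_logDerivSeq_le {a : ℕ → ℝ} {A : ℝ} (hA : 0 ≤ A) (h : ∀ n, |a n| ≤ A ^ n) (n : ℕ) :
    |logDerivSeq a n| ≤ (4 * A) ^ (n + 1) := by
  induction n using Nat.strong_induction_on with
  | _ n ih =>
    rw [logDerivSeq_eq]
    calc |((n : ℝ) + 1) * a (n + 1) - ∑ i ∈ Finset.range n, logDerivSeq a i * a (n - i)|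
        ≤ |((n : ℝ) + 1) * a (n + 1)| + |∑ i ∈ Finset.range n, logDerivSeq a i * a (n - i)| :=
          abs_sub _ _
      _ ≤ ((n : ℝ) + 1) * A ^ (n + 1)
          + ∑ i ∈ Finset.range n, (4 * A) ^ (i + 1) * A ^ (n - i) := by
          gcongr
          · rw [abs_mul, abs_of_nonneg (by positivity)]
            gcongr; exact h _
          · refine (Finset.abs_sum_le_sum_abs _ _).trans (Finset.sum_le_sum fun i hi => ?_)
            rw [abs_mul]
            gcongr
            · exact ih i (Finset.mem_range.1 hi)
            · exact h _
      _ = A ^ (n + 1) * (((n : ℝ) + 1) + ∑ i ∈ Finset.range n, (4 : ℝ) ^ (i + 1)) := by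
          rw [mul_add, Finset.mul_sum, mul_comm]
          congr 1
          refine Finset.sum_congr rfl fun i hi => ?_
          rw [Finset.mem_range] at hi
          rw [mul_pow, mul_assoc, ← pow_add, show i + 1 + (n - i) = n + 1 by omega, mul_comm]
      _ ≤ A ^ (n + 1) * 4 ^ (n + 1) := by gcongr; exact add_sum_four_pow_le n
      _ = _ := by rw [mul_pow, mul_comm]

lemma abs_odeSeq_le {c : ℕ → ℝ} {B : ℝ} (hB : 0 ≤ B) (h : ∀ n, |c n| ≤ B ^ (n + 1)) (n : ℕ) :
    |odeSeq c n| ≤ (2 * B) ^ n := by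
  induction n using Nat.strong_induction_on with
  | _ n ih =>
    rcases n with _ | n
    · simp [odeSeq_zero]
    · have hn : (1 : ℝ) ≤ n + 1 := by
        have : (0 : ℝ) ≤ n := n.cast_nonneg
        linarith
      rw [odeSeq_succ, abs_div, abs_of_nonneg (by linarith : (0 : ℝ) ≤ n + 1)]
      refine (div_le_self (abs_nonneg _) hn).trans ?_
      calc |∑ i ∈ Finset.range (n + 1), c (n - i) * odeSeq c i|
          ≤ ∑ i ∈ Finset.range (n + 1), B ^ (n - i + 1) * (2 * B) ^ i := by
            refine (Finset.abs_sum_le_sum_abs _ _).trans (Finset.sum_le_sum fun i hi => ?_)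
            rw [abs_mul]
            gcongr
            · exact h _
            · exact ih i (Finset.mem_range.1 hi)
        _ = B ^ (n + 1) * ∑ i ∈ Finset.range (n + 1), (2 : ℝ) ^ i := by
            rw [Finset.mul_sum]
            refine Finset.sum_congr rfl fun i hi => ?_
            rw [Finset.mem_range] at hi
            rw [mul_pow, mul_left_comm, ← pow_add, show n - i + 1 + i = n + 1 by omega, mul_comm]
        _ ≤ B ^ (n + 1) * 2 ^ (n + 1) := by
            gcongr
            have := geom_sum_eq (show (2 : ℝ) ≠ 1 by norm_num) (n + 1)
            rw [this]; norm_num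
        _ = _ := by rw [mul_pow, mul_comm]

/-- Each term of the recursion is split as c F - c' F' = c (F - F') + (c - c') F'. The division by n
+ 1 is not exploited. -/
lemma abs_odeSeq_sub_le {c c' : ℕ → ℝ} {B e : ℝ} (hB : 0 ≤ B) (he : 0 ≤ e)
    (h : ∀ n, |c n| ≤ B ^ (n + 1)) (h' : ∀ n, |c' n| ≤ B ^ (n + 1))
    (hd : ∀ n, |c n - c' n| ≤ e * B ^ (n + 1)) (n : ℕ) :
    |odeSeq c n - odeSeq c' n| ≤ e * (4 * B) ^ n := by
  induction n using Nat.strong_induction_on with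
  | _ n ih =>
    rcases n with _ | n
    · simpa [odeSeq_zero] using he
    · have hn : (1 : ℝ) ≤ n + 1 := by
        have : (0 : ℝ) ≤ n := n.cast_nonneg
        linarith
      rw [odeSeq_succ, odeSeq_succ, ← sub_div, abs_div,
        abs_of_nonneg (by linarith : (0 : ℝ) ≤ n + 1), ← Finset.sum_sub_distrib]
      refine (div_le_self (abs_nonneg _) hn).trans ?_
      calc |∑ i ∈ Finset.range (n + 1), (c (n - i) * odeSeq c i - c' (n - i) * odeSeq c' i)|
          ≤ ∑ i ∈ Finset.range (n + 1), (B ^ (n - i + 1) * (e * (4 * B) ^ i)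
            + e * B ^ (n - i + 1) * (2 * B) ^ i) := by
            refine (Finset.abs_sum_le_sum_abs _ _).trans (Finset.sum_le_sum fun i hi => ?_)
            rw [show c (n - i) * odeSeq c i - c' (n - i) * odeSeq c' i
              = c (n - i) * (odeSeq c i - odeSeq c' i) + (c (n - i) - c' (n - i)) * odeSeq c' i
              by ring]
            refine (abs_add_le _ _).trans ?_
            rw [abs_mul, abs_mul]
            gcongr
            · exact h _
            · exact ih i (Finset.mem_range.1 hi)
            · exact hd _
            · exact abs_odeSeq_le hB h' i
        _ = e * B ^ (n + 1) * ∑ i ∈ Finset.range (n + 1), ((4 : ℝ) ^ i + 2 ^ i) := by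
            rw [Finset.mul_sum]
            refine Finset.sum_congr rfl fun i hi => ?_
            rw [Finset.mem_range] at hi
            have hpow : B ^ (n + 1) = B ^ (n - i + 1) * B ^ i := by
              rw [← pow_add]; congr 1; omega
            rw [mul_pow, mul_pow, hpow]
            ring
        _ ≤ e * B ^ (n + 1) * 4 ^ (n + 1) := by
            gcongr; exact sum_four_pow_add_two_pow_le n
        _ = _ := by rw [mul_pow]; ring

lemma abs_logDerivSeq_logQuotSeq_le (n : ℕ) :
    |logDerivSeq (logQuotSeq ℝ) n| ≤ 4 ^ (n + 1) := by
  have := abs_logDerivSeq_le (a := logQuotSeq ℝ) zero_le_one (fun n => by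
    rw [one_pow, logQuotSeq, abs_of_nonneg (by positivity)]
    exact div_le_one_of_le₀ (by linarith [(n.cast_nonneg : (0 : ℝ) ≤ n)]) (by positivity)) n
  simpa using this

lemma abs_logDerivSeq_logLogQuotSeq_le (n : ℕ) :
    |logDerivSeq (logLogQuotSeq ℝ) n| ≤ 128 ^ (n + 1) := by
  -- The bound 2 · 4^(n+1) = 8 · 4^n is at most 32^n only for n ≥ 1, so the constant term, which
  -- equals 1, is treated apart.
  have := abs_logDerivSeq_le (a := logLogQuotSeq ℝ) (A := 32) (by norm_num) (fun n => by
    rcases n with _ | n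
    · simp [logLogQuotSeq_zero]
    · have h1 := abs_logDerivSeq_logQuotSeq_le (n + 1)
      have h2 : (1 : ℝ) ≤ (n + 1 : ℕ) + 1 := by
        have : (0 : ℝ) ≤ n := n.cast_nonneg
        push_cast; linarith
      rw [logLogQuotSeq, abs_div, abs_of_nonneg (by linarith : (0 : ℝ) ≤ (n + 1 : ℕ) + 1)]
      refine (div_le_self (abs_nonneg _) h2).trans ?_
      rw [abs_mul, abs_two]
      calc 2 * |logDerivSeq (logQuotSeq ℝ) (n + 1)| ≤ 2 * 4 ^ (n + 1 + 1) := by gcongr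
        _ = 8 * 4 ^ (n + 1) := by ring
        _ ≤ 8 ^ (n + 1) * 4 ^ (n + 1) := by
          gcongr; exact le_self_pow₀ (by norm_num) (by omega)
        _ = 32 ^ (n + 1) := by rw [← mul_pow]; norm_num) n
  refine this.trans_eq ?_
  norm_num

lemma abs_singularLogDerivSeq_le {γ δ G : ℝ} (hG : 1 ≤ G) (hγ : |γ| ≤ G) (hδ : |δ| ≤ G) (n : ℕ) :
    |singularLogDerivSeq γ δ n| ≤ (256 * G) ^ (n + 1) := by
  have h1 := abs_logDerivSeq_logQuotSeq_le n
  have h2 := abs_logDerivSeq_logLogQuotSeq_le n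
  rw [singularLogDerivSeq]
  have hG' : G ≤ G ^ (n + 1) := le_self_pow₀ hG (by omega)
  calc _ ≤ |(1 / 2 : ℝ)| + |γ * logDerivSeq (logQuotSeq ℝ) n|
        + |δ * logDerivSeq (logLogQuotSeq ℝ) n| := abs_add_three _ _ _
    _ ≤ 1 / 2 + G * 4 ^ (n + 1) + G * 128 ^ (n + 1) := by
        rw [abs_mul, abs_mul, abs_of_pos (by norm_num : (0 : ℝ) < 1 / 2)]
        gcongr
    _ ≤ G * (1 + 4 ^ (n + 1) + 128 ^ (n + 1)) := by linarith
    _ ≤ G ^ (n + 1) * (256 ^ (n + 1)) := by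
        gcongr
        have e1 : (1 : ℝ) ≤ 4 ^ n := one_le_pow₀ (by norm_num)
        have e2 : (4 : ℝ) ^ n ≤ 256 ^ n := pow_le_pow_left₀ (by norm_num) (by norm_num) _
        have e3 : (128 : ℝ) ^ n ≤ 256 ^ n := pow_le_pow_left₀ (by norm_num) (by norm_num) _
        simp only [pow_succ]
        linarith
    _ = _ := by rw [mul_pow, mul_comm]

lemma abs_singularLogDerivSeq_sub_le {γ δ γ' δ' G e : ℝ} (hG : 1 ≤ G)
    (hγ : |γ - γ'| ≤ e) (hδ : |δ - δ'| ≤ e) (n : ℕ) :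
    |singularLogDerivSeq γ δ n - singularLogDerivSeq γ' δ' n| ≤ e * (256 * G) ^ (n + 1) := by
  have h1 := abs_logDerivSeq_logQuotSeq_le n
  have h2 := abs_logDerivSeq_logLogQuotSeq_le n
  have he : 0 ≤ e := (abs_nonneg _).trans hγ
  have hG' : 1 ≤ G ^ (n + 1) := one_le_pow₀ hG
  calc _ = |(γ - γ') * logDerivSeq (logQuotSeq ℝ) n
        + (δ - δ') * logDerivSeq (logLogQuotSeq ℝ) n| := by
        rw [singularLogDerivSeq, singularLogDerivSeq]; congr 1; ring
    _ ≤ e * 4 ^ (n + 1) + e * 128 ^ (n + 1) := by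
        refine (abs_add_le _ _).trans ?_
        rw [abs_mul, abs_mul]
        gcongr
    _ = e * (4 ^ (n + 1) + 128 ^ (n + 1)) := by ring
    _ ≤ e * (256 ^ (n + 1)) := by
        gcongr
        have e1 : (0 : ℝ) < 256 ^ n := by positivity
        have e2 : (4 : ℝ) ^ n ≤ 256 ^ n := pow_le_pow_left₀ (by norm_num) (by norm_num) _
        have e3 : (128 : ℝ) ^ n ≤ 256 ^ n := pow_le_pow_left₀ (by norm_num) (by norm_num) _
        simp only [pow_succ]
        linarith
    _ ≤ e * (256 ^ (n + 1) * G ^ (n + 1)) := by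
        gcongr
        exact le_mul_of_one_le_right (by positivity) hG'
    _ = _ := by rw [mul_pow]

lemma two_mul_le_four_pow (n : ℕ) : 2 * (n : ℝ) ≤ 4 ^ n := by
  have h1 : (n : ℝ) < 2 ^ n := by exact_mod_cast Nat.lt_two_pow_self
  have h2 := one_add_mul_le_pow (a := (3 : ℝ)) (by norm_num) n
  norm_num at h2
  linarith [(n.cast_nonneg : (0 : ℝ) ≤ n)]

/-- The partial sums of squares depend on the parameters in a Lipschitz way. -/
lemma abs_sum_singularSeq_sq_sub_le {γ δ γ' δ' G e : ℝ} (hG : 1 ≤ G) (hγ : |γ| ≤ G)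
    (hδ : |δ| ≤ G) (hγ' : |γ'| ≤ G) (hδ' : |δ'| ≤ G) (hγe : |γ - γ'| ≤ e) (hδe : |δ - δ'| ≤ e)
    (N : ℕ) : |∑ n ∈ Finset.range N, singularSeq γ δ n ^ 2
      - ∑ n ∈ Finset.range N, singularSeq γ' δ' n ^ 2| ≤ e * (1024 * G) ^ (3 * N) := by
  have he : 0 ≤ e := (abs_nonneg _).trans hγe
  -- Here 1024 = 4 · 256 combines the rates of `abs_odeSeq_sub_le` and `abs_singularLogDerivSeq_le`.
  -- In the exponent 3N, the part 2N comes from products of two coefficients, and N absorbs the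
  -- factor 2N of the sum.
  set E := 1024 * G
  have hE : 1 ≤ E := by linarith
  have hB : 0 ≤ 256 * G := by linarith
  have hr : ∀ {γ δ : ℝ}, |γ| ≤ G → |δ| ≤ G → ∀ n, |singularSeq γ δ n| ≤ E ^ n := by
    intro γ δ h1 h2 n
    refine (abs_odeSeq_le hB (abs_singularLogDerivSeq_le hG h1 h2) n).trans ?_
    exact pow_le_pow_left₀ (by positivity) (by simp only [E]; linarith) _
  have hd : ∀ n, |singularSeq γ δ n - singularSeq γ' δ' n| ≤ e * E ^ n := by
    intro n
    refine (abs_odeSeq_sub_le hB he (abs_singularLogDerivSeq_le hG hγ hδ)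
      (abs_singularLogDerivSeq_le hG hγ' hδ')
      (abs_singularLogDerivSeq_sub_le hG hγe hδe) n).trans_eq ?_
    simp only [E]; ring
  rw [← Finset.sum_sub_distrib]
  calc _ ≤ ∑ n ∈ Finset.range N, 2 * e * E ^ (2 * N) := by
        refine (Finset.abs_sum_le_sum_abs _ _).trans (Finset.sum_le_sum fun n hn => ?_)
        rw [Finset.mem_range] at hn
        rw [sq_sub_sq, abs_mul]
        calc |singularSeq γ δ n + singularSeq γ' δ' n| * |singularSeq γ δ n - singularSeq γ' δ' n|
            ≤ (E ^ n + E ^ n) * (e * E ^ n) := by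
              gcongr
              · exact (abs_add_le _ _).trans (add_le_add (hr hγ hδ n) (hr hγ' hδ' n))
              · exact hd n
          _ = 2 * e * E ^ (2 * n) := by ring
          _ ≤ _ := by gcongr
    _ = e * E ^ (2 * N) * (2 * N) := by
        rw [Finset.sum_const, Finset.card_range, nsmul_eq_mul]; ring
    _ ≤ e * E ^ (2 * N) * E ^ N := by
        gcongr
        refine (two_mul_le_four_pow N).trans ?_
        exact pow_le_pow_left₀ (by norm_num) (by simp only [E]; linarith) _
    _ = _ := by ring

/-! ## Computability of the norm -/

/-- `x` is approximated by a computable sequence of rational numbers at a geometric rate. -/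
def IsRatComputable (x : ℝ) : Prop :=
  ∃ f : ℕ → RatCode, Computable f ∧ ∀ n : ℕ, |x - (f n).val| ≤ 1 / 2 ^ n

lemma primrec_nat_pow {α : Type*} [Primcodable α] {f g : α → ℕ} (hf : Primrec f)
    (hg : Primrec g) : Primrec fun a => f a ^ g a := by
  have h : Primrec fun a => (Nat.rec 1 (fun _ m => m * f a) (g a) : ℕ) :=
    Primrec.nat_rec' (h := fun a (p : ℕ × ℕ) => p.2 * f a) hg (Primrec.const 1)
      (Primrec.nat_mul.comp (Primrec.snd.comp Primrec.snd) (hf.comp Primrec.fst))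
  refine h.of_eq fun a => ?_
  induction g a with
  | zero => rfl
  | succ n ih => rw [pow_succ, ← ih]

/-- Integers are encoded by n ↦ 2n and -(n+1) ↦ 2n+1, so parity reveals the sign. -/
lemma primrec_int_toNat : Primrec Int.toNat := by
  have h : Primrec fun z : ℤ => if Encodable.encode z % 2 = 0 then Encodable.encode z / 2 else 0 :=
    Primrec.ite (Primrec.eq.comp (Primrec.nat_mod.comp Primrec.encode (Primrec.const 2))
      (Primrec.const 0)) (Primrec.nat_div.comp Primrec.encode (Primrec.const 2)) (Primrec.const 0)
  refine h.of_eq fun z => ?_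
  rcases z with n | n
  · rw [show Encodable.encode (Int.ofNat n) = 2 * n from rfl, if_pos (by omega)]
    simp
  · rw [show Encodable.encode (Int.negSucc n) = 2 * n + 1 from rfl, if_neg (by omega)]
    rfl

lemma primrec_int_neg_toNat : Primrec fun z : ℤ => (-z).toNat := by
  have h : Primrec fun z : ℤ =>
      if Encodable.encode z % 2 = 0 then 0 else Encodable.encode z / 2 + 1 :=
    Primrec.ite (Primrec.eq.comp (Primrec.nat_mod.comp Primrec.encode (Primrec.const 2))
      (Primrec.const 0)) (Primrec.const 0)
      (Primrec.succ.comp (Primrec.nat_div.comp Primrec.encode (Primrec.const 2)))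
  refine h.of_eq fun z => ?_
  rcases z with n | n
  · rw [show Encodable.encode (Int.ofNat n) = 2 * n from rfl, if_pos (by omega)]
    simp
  · rw [show Encodable.encode (Int.negSucc n) = 2 * n + 1 from rfl, if_neg (by omega)]
    change _ = n + 1
    omega

lemma primrec_int_ofNat : Primrec fun n : ℕ => (n : ℤ) := by
  refine ((Primrec.ofNat ℤ).comp (Primrec.nat_mul.comp (Primrec.const 2) Primrec.id)).of_eq
    fun n => ?_
  have : Encodable.encode (n : ℤ) = 2 * n := rfl
  rw [id, ← this, Denumerable.ofNat_encode]

lemma IsComputableReal.isRatComputable {x : ℝ} (h : IsComputableReal x) : IsRatComputable x := by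
  obtain ⟨f, hf, hx⟩ := h
  have hpow : Primrec fun n : ℕ => 2 ^ n - 1 :=
    Primrec.nat_sub.comp (primrec_nat_pow (Primrec.const 2) Primrec.id) (Primrec.const 1)
  refine ⟨fun n => ((f n).toNat, (-f n).toNat, 2 ^ n - 1), (primrec_int_toNat.to_comp.comp hf).pair
    ((primrec_int_neg_toNat.to_comp.comp hf).pair hpow.to_comp), fun n => ?_⟩
  have h1 : ((f n).toNat : ℝ) - ((-f n).toNat : ℝ) = f n := by
    exact_mod_cast Int.toNat_sub_toNat_neg (f n)
  have h2 : ((2 ^ n - 1 : ℕ) : ℝ) + 1 = 2 ^ n := by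
    rw [Nat.cast_sub Nat.one_le_two_pow]; push_cast; ring
  simp only [RatCode.val]
  rw [h1, h2]
  exact hx n

lemma isRatComputable_val (q : RatCode) : IsRatComputable q.val :=
  ⟨fun _ => q, Computable.const q, fun n => by simp⟩

lemma IsRatComputable.neg_half_add {x : ℝ} (h : IsRatComputable x) :
    IsRatComputable (-(1 / 2 + x)) := by
  obtain ⟨f, hf, hx⟩ := h
  have hp : Primrec fun q => RatCode.neg (RatCode.add (1, 0, 1) q) :=
    RatCode.primrec_neg (RatCode.primrec_add (Primrec.const _) Primrec.id)
  refine ⟨fun n => RatCode.neg (RatCode.add (1, 0, 1) (f n)), hp.to_comp.comp hf, fun n => ?_⟩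
  have : RatCode.val (1, 0, 1) = 1 / 2 := by simp only [RatCode.val]; norm_num
  rw [RatCode.val_neg, RatCode.val_add, this,
    show -(1 / 2 + x) - -(1 / 2 + (f n).val) = -(x - (f n).val) by ring, abs_neg]
  exact hx n

/-- A modulus of continuity valid down to 0, so no lower bound for the sum of squares is needed; it
doubles the number of bits required. -/
lemma abs_sqrt_sub_sqrt_le {x y : ℝ} (hx : 0 ≤ x) (hy : 0 ≤ y) : |√x - √y| ≤ √|x - y| := by
  apply Real.le_sqrt_of_sq_le
  rw [sq_abs]
  have h1 := Real.sq_sqrt hx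
  have h2 := Real.sq_sqrt hy
  have h3 := Real.sqrt_nonneg x
  have h4 := Real.sqrt_nonneg y
  rcases le_total x y with h | h
  · have := Real.sqrt_le_sqrt h
    rw [abs_of_nonpos (by linarith)]
    nlinarith
  · have := Real.sqrt_le_sqrt h
    rw [abs_of_nonneg (by linarith)]
    nlinarith

/-- A dyadic approximation to the square root of a coded rational number. -/
def sqrtApprox (p : ℕ) (q : RatCode) : ℕ :=
  (Nat.sqrt (4 ^ (p + 2) * (q.1 - q.2.1) / (q.2.2 + 1)) + 2) / 4

lemma primrec_sqrtApprox : Primrec₂ sqrtApprox := by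
  have h1 : Primrec fun x : ℕ × RatCode => 4 ^ (x.1 + 2) * (x.2.1 - x.2.2.1) / (x.2.2.2 + 1) :=
    Primrec.nat_div.comp (Primrec.nat_mul.comp (primrec_nat_pow (Primrec.const 4)
      (Primrec.nat_add.comp Primrec.fst (Primrec.const 2)))
      (Primrec.nat_sub.comp (Primrec.fst.comp Primrec.snd)
        (Primrec.fst.comp (Primrec.snd.comp Primrec.snd))))
      (Primrec.succ.comp (Primrec.snd.comp (Primrec.snd.comp Primrec.snd)))
  exact Primrec.nat_div.comp (Primrec.nat_add.comp (Primrec.nat_sqrt.comp h1) (Primrec.const 2))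
    (Primrec.const 4)

lemma abs_natSqrt_sub_sqrt_le {w : ℝ} (hw : 0 ≤ w) : |√w - Nat.sqrt ⌊w⌋₊| ≤ 1 := by
  have h1 : ((Nat.sqrt ⌊w⌋₊ : ℕ) : ℝ) ≤ √w := by
    apply Real.le_sqrt_of_sq_le
    refine le_trans ?_ (Nat.floor_le hw)
    exact_mod_cast Nat.sqrt_le' _
  have h2 : √w ≤ (Nat.sqrt ⌊w⌋₊ : ℕ) + 1 := by
    rw [Real.sqrt_le_left (by positivity)]
    refine (Nat.lt_floor_add_one w).le.trans ?_
    have : ⌊w⌋₊ + 1 ≤ (Nat.sqrt ⌊w⌋₊ + 1) ^ 2 := Nat.succ_le_succ_sqrt' _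
    exact_mod_cast this
  rw [abs_le]; constructor <;> linarith

/-- The integer square root is taken with two extra bits: its error 1 becomes 1/4, and rounding to
the nearest integer adds 1/2. The missing quarter is left for the error in q. -/
lemma abs_sqrt_sub_sqrtApprox_le (p : ℕ) {q : RatCode} (hq : 0 ≤ q.val) :
    |√q.val - (sqrtApprox p q : ℝ) / 2 ^ p| ≤ 3 / 4 / 2 ^ p := by
  have hd : (0 : ℝ) < q.2.2 + 1 := by positivity
  have hle : q.2.1 ≤ q.1 := by
    by_contra hlt
    push Not at hlt
    have h1 : (q.1 : ℝ) < q.2.1 := by exact_mod_cast hlt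
    have : q.val < 0 := div_neg_of_neg_of_pos (by linarith) hd
    linarith
  set w := 4 ^ (p + 2) * q.val with hw
  have hw0 : 0 ≤ w := by positivity
  have hfl : ⌊w⌋₊ = 4 ^ (p + 2) * (q.1 - q.2.1) / (q.2.2 + 1) := by
    rw [← Nat.floor_div_eq_div (K := ℝ)]
    congr 1
    rw [hw, RatCode.val]
    push_cast [Nat.cast_sub hle]
    ring
  have h1 := abs_natSqrt_sub_sqrt_le hw0
  have hsqrt : √w = 4 * 2 ^ p * √q.val := by
    rw [hw, Real.sqrt_mul (by positivity), show (4 : ℝ) ^ (p + 2) = (4 * 2 ^ p) ^ 2 by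
      rw [mul_pow, ← pow_mul, mul_comm p 2, pow_mul, pow_add]; norm_num; ring,
      Real.sqrt_sq (by positivity)]
  set m := Nat.sqrt ⌊w⌋₊ with hm
  have h2 : |(m : ℝ) / 4 - (sqrtApprox p q : ℝ)| ≤ 1 / 2 := by
    rw [sqrtApprox, ← hfl, ← hm]
    have e1 : 4 * ((m + 2) / 4) ≤ m + 2 := Nat.mul_div_le _ _
    have e2 : m + 2 < 4 * ((m + 2) / 4) + 4 := by omega
    have e3 : (4 : ℝ) * ((m + 2) / 4 : ℕ) ≤ m + 2 := by exact_mod_cast e1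
    have e4 : (m : ℝ) + 1 + 2 ≤ 4 * ((m + 2) / 4 : ℕ) + 4 := by
      exact_mod_cast (by omega : m + 1 + 2 ≤ 4 * ((m + 2) / 4) + 4)
    rw [abs_le]; constructor <;> linarith
  have h3 : |2 ^ p * √q.val - (sqrtApprox p q : ℝ)| ≤ 3 / 4 := by
    rw [hsqrt] at h1
    rw [abs_le] at h1 h2 ⊢
    constructor <;> linarith [h1.1, h1.2, h2.1, h2.2]
  have hp : (0 : ℝ) < 2 ^ p := by positivity
  rw [le_div_iff₀ hp, ← abs_of_pos hp, ← abs_mul, abs_of_pos hp, sub_mul,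
    div_mul_cancel₀ _ hp.ne', mul_comm √q.val]
  exact h3

/-- The `ℓ²` norm of `singularSeq γ δ` is computable if the parameters are and the tails of the
sum of squares satisfy a bound of the form `O(k ^ (-η))` after `2 ^ k` terms. -/
theorem isComputableReal_sqrt_tsum_sq {γ δ D η : ℝ} (hγ : IsRatComputable γ)
    (hδ : IsRatComputable δ) (hs : Summable fun n => singularSeq γ δ n ^ 2) (hη : 0 < η)
    (htail : ∀ k : ℕ, 1 ≤ k → ∑' n, singularSeq γ δ n ^ 2
      ≤ ∑ n ∈ Finset.range (2 ^ k), singularSeq γ δ n ^ 2 + D * (k : ℝ) ^ (-η)) :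
    IsComputableReal √(∑' n, singularSeq γ δ n ^ 2) := by
  obtain ⟨a, ha, haγ⟩ := hγ
  obtain ⟨b, hb, hbδ⟩ := hδ
  -- The numbers A, Q and s are constants of the algorithm; it only has to exist, so they need not
  -- be found effectively.
  obtain ⟨A, hA⟩ := exists_nat_ge (max D 1)
  obtain ⟨Q, hQ⟩ := exists_nat_ge (1 / η)
  obtain ⟨s, hs'⟩ := exists_nat_ge (1024 * (max |γ| |δ| + 1))
  set G := max |γ| |δ| + 1
  have hG : 1 ≤ G := by
    have : 0 ≤ max |γ| |δ| := (abs_nonneg γ).trans (le_max_left _ _)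
    simp only [G]; linarith
  -- As Q η ≥ 1 and A ≥ D, the tail after 2^k terms is at most ε = 2^(-(2p+5)). The accuracy m
  -- cancels the Lipschitz constant, at most 2^(3sN), and leaves ε again. The square root of 2ε is
  -- 2^(-p)/4, the quarter left by `sqrtApprox`.
  set k : ℕ → ℕ := fun p => (A * 2 ^ (2 * p + 5)) ^ Q
  set N : ℕ → ℕ := fun p => 2 ^ k p
  set m : ℕ → ℕ := fun p => s * (3 * N p) + (2 * p + 5)
  have hN : Primrec N := primrec_nat_pow (Primrec.const 2) (primrec_nat_pow
    (Primrec.nat_mul.comp (Primrec.const A) (primrec_nat_pow (Primrec.const 2)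
      (Primrec.nat_add.comp (Primrec.nat_mul.comp (Primrec.const 2) Primrec.id)
        (Primrec.const 5)))) (Primrec.const Q))
  have hm : Primrec m := Primrec.nat_add.comp (Primrec.nat_mul.comp (Primrec.const s)
    (Primrec.nat_mul.comp (Primrec.const 3) hN))
    (Primrec.nat_add.comp (Primrec.nat_mul.comp (Primrec.const 2) Primrec.id) (Primrec.const 5))
  set V : ℕ → RatCode := fun p => RatCode.singularSqSum (a (m p), b (m p)) (N p)
  have hV : Computable V := RatCode.primrec_singularSqSum.to_comp.comp
    ((ha.comp hm.to_comp).pair (hb.comp hm.to_comp)) hN.to_comp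
  refine ⟨fun p => (sqrtApprox p (V p) : ℤ), primrec_int_ofNat.to_comp.comp
    (primrec_sqrtApprox.to_comp.comp Computable.id hV), fun p => ?_⟩
  set T := ∑' n, singularSeq γ δ n ^ 2
  have hT : 0 ≤ T := tsum_nonneg fun n => sq_nonneg _
  have hVval : (V p).val = ∑ n ∈ Finset.range (N p),
      singularSeq (a (m p)).val (b (m p)).val n ^ 2 := RatCode.val_singularSqSum _ _
  have hV0 : 0 ≤ (V p).val := by
    rw [hVval]; exact Finset.sum_nonneg fun _ _ => sq_nonneg _
  set ε : ℝ := 1 / 2 ^ (2 * p + 5)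
  have hε : 0 < ε := by positivity
  have hA1 : (1 : ℝ) ≤ A := (le_max_right _ _).trans hA
  have hAD : D ≤ A := (le_max_left _ _).trans hA
  have hX : (1 : ℝ) ≤ A * 2 ^ (2 * p + 5) :=
    one_le_mul_of_one_le_of_one_le hA1 (one_le_pow₀ (by norm_num))
  have h1 : |T - ∑ n ∈ Finset.range (N p), singularSeq γ δ n ^ 2| ≤ ε := by
    have hk : 1 ≤ k p := Nat.one_le_iff_ne_zero.2 (pow_ne_zero _ (by
      have : A ≠ 0 := by rintro rfl; norm_num at hA1
      positivity))
    have e1 := htail (k p) hk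
    have e2 := hs.sum_le_tsum (Finset.range (N p)) fun i _ => sq_nonneg _
    have e3 : D * (k p : ℝ) ^ (-η) ≤ ε := by
      have e4 : (k p : ℝ) ^ (-η) ≤ ((A : ℝ) * 2 ^ (2 * p + 5))⁻¹ := by
        simp only [k]
        push_cast
        rw [← Real.rpow_natCast, ← Real.rpow_mul (by linarith), ← Real.rpow_neg_one]
        apply Real.rpow_le_rpow_of_exponent_le hX
        rw [div_le_iff₀ hη] at hQ
        linarith
      calc D * (k p : ℝ) ^ (-η) ≤ A * ((A : ℝ) * 2 ^ (2 * p + 5))⁻¹ := by gcongr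
        _ = ε := by
          have : (A : ℝ) ≠ 0 := by linarith
          simp only [ε]; field_simp
    rw [abs_le]; constructor <;> linarith
  have h2 : |∑ n ∈ Finset.range (N p), singularSeq γ δ n ^ 2 - (V p).val| ≤ ε := by
    have hpow : (1 : ℝ) / 2 ^ m p ≤ 1 :=
      div_le_one_of_le₀ (one_le_pow₀ (by norm_num)) (by positivity)
    have hclose : ∀ {x y : ℝ}, |x| ≤ max |γ| |δ| → |x - y| ≤ 1 / 2 ^ m p → |y| ≤ G := by
      intro x y h1 h2
      have := abs_sub_abs_le_abs_sub y x
      rw [abs_sub_comm] at this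
      simp only [G]
      linarith
    rw [hVval]
    refine (abs_sum_singularSeq_sq_sub_le hG
      ((le_max_left _ _).trans (by simp only [G]; linarith))
      ((le_max_right _ _).trans (by simp only [G]; linarith))
      (hclose (le_max_left _ _) (haγ _)) (hclose (le_max_right _ _) (hbδ _))
      (haγ _) (hbδ _) (N p)).trans ?_
    have h2s : (1024 * G) ≤ 2 ^ s := by
      refine hs'.trans ?_
      exact_mod_cast Nat.lt_two_pow_self.le
    calc 1 / 2 ^ m p * (1024 * G) ^ (3 * N p) ≤ 1 / 2 ^ m p * (2 ^ s) ^ (3 * N p) := by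
          gcongr
      _ = ε := by
          simp only [m, ε]
          rw [pow_add, ← pow_mul]
          field_simp
  have h3 : |T - (V p).val| ≤ 2 * ε := by
    rw [abs_le] at h1 h2 ⊢
    constructor <;> linarith [h1.1, h1.2, h2.1, h2.2]
  have h4 := abs_sqrt_sub_sqrt_le hT hV0
  have h5 : √|T - (V p).val| ≤ 1 / 4 / 2 ^ p := by
    rw [Real.sqrt_le_left (by positivity)]
    refine h3.trans_eq ?_
    simp only [ε]
    rw [div_pow, ← pow_mul, mul_comm p 2, pow_add]
    field_simp
    norm_num
  have h6 := abs_sqrt_sub_sqrtApprox_le p hV0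
  have h7 : (3 / 4 / 2 ^ p : ℝ) = 1 / 2 ^ p - 1 / 4 / 2 ^ p := by ring
  rw [Int.cast_natCast]
  rw [h7] at h6
  have h8 := abs_add_le (√T - √(V p).val) (√(V p).val - (sqrtApprox p (V p) : ℝ) / 2 ^ p)
  rw [sub_add_sub_cancel] at h8
  linarith

/-! ## Reasoning about programs -/

namespace RAM

variable {y : ℕ → ℝ}

/-- From registers `ρ` and arrays `μ`, the program `c` halts within `T` units of time, with
addresses and integers at most `p`, and its result satisfies `Q`. -/
def Runs (y : ℕ → ℝ) (c : Cmd) (ρ : ℕ → ℕ) (μ : ℕ → ℕ → ℂ) (T p : ℕ)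
    (Q : (ℕ → ℕ) → (ℕ → ℕ → ℂ) → Prop) : Prop :=
  ∀ s : State, s.reg = ρ → s.mem = μ → ∃ s' : State, Exec y c s s' ∧ s'.time ≤ s.time + T ∧
    s'.peak ≤ max s.peak p ∧ Q s'.reg s'.mem

variable {c d : Cmd} {ρ : ℕ → ℕ} {μ : ℕ → ℕ → ℂ} {T T₁ T₂ p p' : ℕ}
  {Q Q₁ : (ℕ → ℕ) → (ℕ → ℕ → ℂ) → Prop}

lemma Runs.mono (h : Runs y c ρ μ T₁ p' Q₁) (hT : T₁ ≤ T) (hp : p' ≤ p)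
    (hQ : ∀ ρ' μ', Q₁ ρ' μ' → Q ρ' μ') : Runs y c ρ μ T p Q := by
  intro s h1 h2
  obtain ⟨s', e, ht, hpk, hq⟩ := h s h1 h2
  exact ⟨s', e, ht.trans (by omega), hpk.trans (by omega), hQ _ _ hq⟩

lemma Runs.seq (h₁ : Runs y c ρ μ T₁ p Q₁)
    (h₂ : ∀ ρ' μ', Q₁ ρ' μ' → Runs y d ρ' μ' T₂ p Q) :
    Runs y (.seq c d) ρ μ (T₁ + T₂) p Q := by
  intro s h1 h2
  obtain ⟨s', e, ht, hpk, hq⟩ := h₁ s h1 h2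
  obtain ⟨s'', e', ht', hpk', hq'⟩ := h₂ _ _ hq s' rfl rfl
  exact ⟨s'', .seq e e', by omega, by omega, hq'⟩

lemma runs_skip (hQ : Q ρ μ) : Runs y .skip ρ μ 1 p Q := by
  rintro s rfl rfl
  exact ⟨_, .skip s, by simp [State.tick], by simp [State.tick], hQ⟩

lemma runs_setReg {x : ℕ} {e : IExp} (he : e.eval ρ ≤ p)
    (hQ : Q (Function.update ρ x (e.eval ρ)) μ) :
    Runs y (.setReg x e) ρ μ (e.cost + 1) p Q := by
  rintro s rfl rfl
  refine ⟨_, .setReg s x e, by simp [State.tick, State.setReg], ?_, hQ⟩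
  simp only [State.tick, State.setReg]
  omega

lemma runs_setCell {k : ℕ} {i : IExp} {e : NExp} (hi : i.eval ρ ≤ p) (he : e.maxAddr ρ ≤ p)
    (hQ : Q ρ (Function.update μ k (Function.update (μ k) (i.eval ρ) (e.eval y ρ μ)))) :
    Runs y (.setCell k i e) ρ μ (i.cost + e.cost + 1) p Q := by
  rintro s rfl rfl
  refine ⟨_, .setCell s k i e, by simp [State.tick, State.setCell], ?_, hQ⟩
  simp only [State.tick, State.setCell]
  omega

lemma runs_ite {a b : IExp} (h₁ : a.eval ρ < b.eval ρ → Runs y c ρ μ T p Q)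
    (h₂ : ¬ a.eval ρ < b.eval ρ → Runs y d ρ μ T p Q) :
    Runs y (.ite a b c d) ρ μ (a.cost + b.cost + 1 + T) p Q := by
  rintro s rfl rfl
  by_cases h : a.eval s.reg < b.eval s.reg
  · obtain ⟨s', e, ht, hpk, hq⟩ := h₁ h (s.tick (a.cost + b.cost + 1) 0) rfl rfl
    refine ⟨s', .ite_true h e, ?_, ?_, hq⟩
    · simp only [State.tick] at ht; omega
    · simp only [State.tick] at hpk; omega
  · obtain ⟨s', e, ht, hpk, hq⟩ := h₂ h (s.tick (a.cost + b.cost + 1) 0) rfl rfl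
    refine ⟨s', .ite_false h e, ?_, ?_, hq⟩
    · simp only [State.tick] at ht; omega
    · simp only [State.tick] at hpk; omega

/-- A loop whose invariant `I j` says that `j` rounds are left. -/
lemma runs_loop {a b : IExp} {I : ℕ → (ℕ → ℕ) → (ℕ → ℕ → ℂ) → Prop}
    (hstep : ∀ j ρ μ, I (j + 1) ρ μ → a.eval ρ < b.eval ρ ∧ Runs y c ρ μ T p (I j))
    (hend : ∀ ρ μ, I 0 ρ μ → ¬ a.eval ρ < b.eval ρ) (n : ℕ) :
    ∀ ρ μ, I n ρ μ → Runs y (.loop a b c) ρ μ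
      (n * (T + (a.cost + b.cost + 1)) + (a.cost + b.cost + 1)) p (I 0) := by
  induction n with
  | zero =>
    rintro ρ μ hI s rfl rfl
    refine ⟨_, .loop_false (hend _ _ hI), ?_, ?_, hI⟩
    · simp [State.tick]
    · simp [State.tick]
  | succ n ih =>
    rintro ρ μ hI s rfl rfl
    obtain ⟨hlt, hrun⟩ := hstep _ _ _ hI
    obtain ⟨s', e, ht, hpk, hq⟩ := hrun (s.tick (a.cost + b.cost + 1) 0) rfl rfl
    obtain ⟨s'', e', ht', hpk', hq'⟩ := ih _ _ hq s' rfl rfl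
    refine ⟨s'', .loop_true hlt e e', ?_, ?_, hq'⟩
    · simp only [State.tick] at ht
      rw [add_mul, one_mul]
      omega
    · simp only [State.tick] at hpk
      omega

/-- Fill the cells `i < n` of the array `k` with the values of `e`, where register `2` holds
`i`. -/
def fill (k : ℕ) (n : IExp) (e : NExp) : Cmd :=
  .seq (.setReg 2 (.const 0)) (.loop (.reg 2) n
    (.seq (.setCell k (.reg 2) e) (.setReg 2 (.add (.reg 2) (.const 1)))))

/-- When cell i is written, other cells of the same array may already be overwritten, but cell i
itself is intact. So `hv` leaves the array arbitrary except at i, which permits updates in place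
that read only the cell being written. -/
lemma runs_fill {k : ℕ} {n : IExp} {e : NExp} {N : ℕ} {v : ℕ → ℂ}
    (hn : ∀ i, n.eval (Function.update ρ 2 i) = N) (hN : N ≤ p)
    (he : ∀ i < N, e.maxAddr (Function.update ρ 2 i) ≤ p)
    (hv : ∀ i < N, ∀ a : ℕ → ℂ, a i = μ k i →
      e.eval y (Function.update ρ 2 i) (Function.update μ k a) = v i) :
    Runs y (fill k n e) ρ μ ((n.cost + e.cost + 9) * (N + 1)) p fun ρ' μ' =>
      (∀ x, x ≠ 2 → ρ' x = ρ x) ∧ (∀ k', k' ≠ k → μ' k' = μ k') ∧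
      (∀ i < N, μ' k i = v i) ∧ (∀ i, N ≤ i → μ' k i = μ k i) := by
  set I : ℕ → (ℕ → ℕ) → (ℕ → ℕ → ℂ) → Prop := fun j ρ' μ' => ∃ i, i + j = N ∧
    ρ' = Function.update ρ 2 i ∧ ∃ a, μ' = Function.update μ k a ∧
      (∀ l < i, a l = v l) ∧ ∀ l, i ≤ l → a l = μ k l
  have hstep : ∀ j ρ' μ', I (j + 1) ρ' μ' → (IExp.reg 2).eval ρ' < n.eval ρ' ∧
      Runs y (.seq (.setCell k (.reg 2) e) (.setReg 2 (.add (.reg 2) (.const 1)))) ρ' μ'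
        (e.cost + 2 + 4) p (I j) := by
    rintro j ρ' μ' ⟨i, hij, rfl, a, rfl, ha1, ha2⟩
    have hiN : i < N := by omega
    have hreg : (IExp.reg 2).eval (Function.update ρ 2 i) = i := by simp [IExp.eval]
    refine ⟨by rw [hn, hreg]; exact hiN, ?_⟩
    refine Runs.mono (Runs.seq (T₁ := 1 + e.cost + 1) (T₂ := 4) (p := p)
      (Q₁ := fun ρ' μ' => ρ' = Function.update ρ 2 i ∧
        μ' = Function.update μ k (Function.update a i (v i)))
      (runs_setCell (i := .reg 2) (by rw [hreg]; omega) (he i hiN) ⟨rfl, ?_⟩) ?_) (by omega) le_rfl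
      fun _ _ h => h
    · rw [hreg, hv i hiN a (ha2 i le_rfl)]
      simp
    · rintro _ _ ⟨rfl, rfl⟩
      refine runs_setReg (e := .add (.reg 2) (.const 1)) ?_ ?_
      · simp [IExp.eval]; omega
      · refine ⟨i + 1, by omega, by simp [IExp.eval], _, rfl, fun l hl => ?_, fun l hl => ?_⟩
        · rcases eq_or_ne l i with rfl | h
          · simp
          · rw [Function.update_of_ne h]; exact ha1 l (by omega)
        · rw [Function.update_of_ne (by omega)]; exact ha2 l (by omega)
  have hend : ∀ ρ' μ', I 0 ρ' μ' → ¬ (IExp.reg 2).eval ρ' < n.eval ρ' := by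
    rintro ρ' μ' ⟨i, hij, rfl, -⟩
    rw [hn]
    simp [IExp.eval]; omega
  have hloop := runs_loop hstep hend N
  refine Runs.mono (Runs.seq (Q₁ := I N) (runs_setReg (e := .const 0) (by simp [IExp.eval])
    ⟨0, by omega, rfl, μ k, by simp, by simp, by simp⟩) hloop) ?_ le_rfl ?_
  · simp only [IExp.cost]
    nlinarith
  · rintro ρ' μ' ⟨i, hij, rfl, a, rfl, ha1, ha2⟩
    obtain rfl : i = N := by omega
    refine ⟨fun x hx => Function.update_of_ne hx _ _, fun k' hk => Function.update_of_ne hk _ _,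
      fun l hl => by rw [Function.update_self, ha1 l hl],
      fun l hl => by rw [Function.update_self, ha2 l hl]⟩

end RAM

/-! ## The discrete Fourier transform -/

/-- The discrete Fourier transform of length `N` with the root of unity `ω`. -/
def dft (ω : ℂ) (N : ℕ) (a : ℕ → ℂ) (i : ℕ) : ℂ := ∑ j ∈ Finset.range N, a j * ω ^ (i * j)

/-- The transforms of length `n` of the `s` residue classes of a sequence of length `s * n`. -/
def partialDft (ω : ℂ) (s n : ℕ) (a : ℕ → ℂ) (i : ℕ) : ℂ :=
  ∑ j ∈ Finset.range n, a (i % s + s * j) * ω ^ ((i - i % s) * j)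

lemma sum_range_two_mul (f : ℕ → ℂ) (n : ℕ) : ∑ j ∈ Finset.range (2 * n), f j
    = ∑ j ∈ Finset.range n, f (2 * j) + ∑ j ∈ Finset.range n, f (2 * j + 1) := by
  induction n with
  | zero => simp
  | succ n ih =>
    rw [show 2 * (n + 1) = 2 * n + 1 + 1 by ring, Finset.sum_range_succ, Finset.sum_range_succ, ih,
      Finset.sum_range_succ, Finset.sum_range_succ]
    ring

/-- One round of the fast Fourier transform: from the stride `2 * s` to the stride `s`. -/
lemma partialDft_step {ω : ℂ} {s n M : ℕ} (hs : 0 < s) (hM : M = s * n)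
    (hω : ω ^ (2 * M) = 1) (a : ℕ → ℂ) (i : ℕ) :
    partialDft ω s (2 * n) a i
      = partialDft ω (2 * s) n a (i % s + 2 * ((i - i % s) % M))
        + ω ^ (i - i % s) * partialDft ω (2 * s) n a (i % s + s + 2 * ((i - i % s) % M)) := by
  set q := i % s with hq
  set u := i - q with hu
  have hqs : q < s := Nat.mod_lt _ hs
  obtain ⟨k, hk⟩ : s ∣ u := Nat.dvd_sub_mod i
  have huM : u % M = s * (k % n) := by rw [hM, hk, Nat.mul_mod_mul_left]
  have h1 : (q + 2 * (u % M)) % (2 * s) = q := by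
    rw [huM, ← mul_assoc, Nat.add_mul_mod_self_left, Nat.mod_eq_of_lt (by omega)]
  have h2 : (q + s + 2 * (u % M)) % (2 * s) = q + s := by
    rw [huM, ← mul_assoc, Nat.add_mul_mod_self_left, Nat.mod_eq_of_lt (by omega)]
  -- At stride 2s the frequencies are even, and they matter only modulo the order 2M; the cells for
  -- u and u + M share their inputs.
  have hpow : ω ^ (2 * (u % M)) = ω ^ (2 * u) := by
    conv_rhs => rw [← Nat.div_add_mod u M, mul_add, pow_add, ← mul_assoc, pow_mul, hω, one_pow,
      one_mul]
  have e1 : partialDft ω (2 * s) n a (q + 2 * (u % M))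
      = ∑ j ∈ Finset.range n, a (q + s * (2 * j)) * ω ^ (u * (2 * j)) := by
    rw [partialDft, h1, Nat.add_sub_cancel_left]
    refine Finset.sum_congr rfl fun j _ => ?_
    rw [pow_mul, hpow, ← pow_mul]
    congr 2 <;> ring
  have e2 : partialDft ω (2 * s) n a (q + s + 2 * (u % M))
      = ∑ j ∈ Finset.range n, a (q + s * (2 * j + 1)) * ω ^ (u * (2 * j)) := by
    rw [partialDft, h2, Nat.add_sub_cancel_left]
    refine Finset.sum_congr rfl fun j _ => ?_
    rw [pow_mul, hpow, ← pow_mul]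
    congr 2 <;> ring
  rw [e1, e2, partialDft, ← hq, ← hu, sum_range_two_mul, Finset.mul_sum]
  congr 1
  refine Finset.sum_congr rfl fun j _ => ?_
  rw [mul_add u, pow_add, mul_one]
  ring

lemma partialDft_one (ω : ℂ) (N : ℕ) (a : ℕ → ℂ) {i : ℕ} :
    partialDft ω 1 N a i = dft ω N a i := by
  simp [partialDft, dft, Nat.mod_one]

lemma partialDft_start (ω : ℂ) {N : ℕ} (a : ℕ → ℂ) {i : ℕ} (hi : i < N) :
    partialDft ω N 1 a i = a i := by
  simp [partialDft, Nat.mod_eq_of_lt hi]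

/-- The hypothesis forces ω to have order exactly 2^(k+1); then this is a geometric sum. -/
lemma sum_pow_root_eq {ω : ℂ} {k : ℕ} (hω : ω ^ 2 ^ k = -1) (d : ℕ) :
    ∑ j ∈ Finset.range (2 ^ (k + 1)), ω ^ (d * j)
      = if 2 ^ (k + 1) ∣ d then (2 : ℂ) ^ (k + 1) else 0 := by
  have hω1 : ω ^ 2 ^ (k + 1) = 1 := by rw [pow_succ, pow_mul, hω]; norm_num
  have hord : orderOf ω = 2 ^ (k + 1) :=
    orderOf_eq_prime_pow (by rw [hω]; norm_num) hω1
  simp_rw [pow_mul]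
  split_ifs with h
  · have h1 : ω ^ d = 1 := orderOf_dvd_iff_pow_eq_one.1 (by rw [hord]; exact h)
    simp [h1]
  · have hne : ω ^ d ≠ 1 := fun h1 => h (hord ▸ orderOf_dvd_of_pow_eq_one h1)
    rw [geom_sum_eq hne, ← pow_mul, mul_comm, pow_mul, hω1, one_pow, sub_self, zero_div]

/-- Convolution through the discrete Fourier transform. -/
lemma dft_dft_mul_dft {ω : ℂ} {k : ℕ} (hω : ω ^ 2 ^ k = -1) {a b : ℕ → ℂ}
    (ha : ∀ i, 2 ^ k ≤ i → a i = 0) (hb : ∀ i, 2 ^ k ≤ i → b i = 0) {i : ℕ} (hi : i < 2 ^ k) :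
    dft ω (2 ^ (k + 1)) (fun j => dft ω (2 ^ (k + 1)) a j * dft ω (2 ^ (k + 1)) b j)
      ((2 ^ (k + 1) - i) % 2 ^ (k + 1))
      = 2 ^ (k + 1) * PowerSeries.coeff i (PowerSeries.mk a * PowerSeries.mk b) := by
  set N := 2 ^ (k + 1) with hN
  have hNk : N = 2 * 2 ^ k := by rw [hN, pow_succ']
  -- The frequency -i modulo N: the inverse transform is the forward transform read backwards, up to
  -- the factor N.
  set r := (N - i) % N with hr
  have hrN : N ∣ i + r := by
    rcases Nat.eq_zero_or_pos i with rfl | h0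
    · simp [hr]
    · rw [hr, Nat.mod_eq_of_lt (by omega), Nat.add_sub_cancel' (by omega)]
  have hω1 : ω ^ N = 1 := by rw [hNk, mul_comm, pow_mul, hω]; norm_num
  have h1 : dft ω N (fun j => dft ω N a j * dft ω N b j) r
      = ∑ l ∈ Finset.range N, ∑ m ∈ Finset.range N, a l * b m *
        ∑ j ∈ Finset.range N, ω ^ ((l + m + r) * j) := by
    simp only [dft, Finset.sum_mul_sum]
    simp_rw [Finset.sum_mul, Finset.mul_sum]
    rw [Finset.sum_comm]
    refine Finset.sum_congr rfl fun l _ => ?_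
    rw [Finset.sum_comm]
    refine Finset.sum_congr rfl fun m _ => Finset.sum_congr rfl fun j _ => ?_
    rw [show (l + m + r) * j = j * l + j * m + r * j by ring, pow_add, pow_add]
    ring
  have h2 : ∀ l m, a l * b m * ∑ j ∈ Finset.range N, ω ^ ((l + m + r) * j)
      = if l + m = i then 2 ^ (k + 1) * (a l * b m) else 0 := by
    intro l m
    rw [hN, sum_pow_root_eq hω, ← hN]
    by_cases hl : 2 ^ k ≤ l
    · simp [ha l hl]
    by_cases hm : 2 ^ k ≤ m
    · simp [hb m hm]
    -- There is no wraparound, since l, m and i are all below N/2.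
    have hiff : N ∣ l + m + r ↔ l + m = i := by
      constructor
      · intro h
        have h3 : (N : ℤ) ∣ (l + m : ℤ) - i := by
          have h4 : (N : ℤ) ∣ ((l + m + r : ℕ) : ℤ) := by exact_mod_cast h
          have h5 : (N : ℤ) ∣ ((i + r : ℕ) : ℤ) := by exact_mod_cast hrN
          have h6 := dvd_sub h4 h5
          push_cast at h6
          rwa [show (l : ℤ) + m + r - (i + r) = l + m - i by ring] at h6
        have := Int.eq_zero_of_abs_lt_dvd h3 (by rw [abs_lt]; constructor <;> omega)
        omega
      · intro h; rw [h]; exact hrN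
    by_cases hlm : l + m = i
    · rw [if_pos (hiff.2 hlm), if_pos hlm]; ring
    · rw [if_neg (fun h => hlm (hiff.1 h)), if_neg hlm, mul_zero]
  rw [h1, coeff_mul_eq_sum_range, Finset.mul_sum]
  simp_rw [h2]
  have h3 : ∀ l ∈ Finset.range N, ∑ m ∈ Finset.range N,
      (if l + m = i then (2 : ℂ) ^ (k + 1) * (a l * b m) else 0)
      = if l < i + 1 then 2 ^ (k + 1) * (a l * b (i - l)) else 0 := by
    intro l _
    split_ifs with h
    · rw [Finset.sum_eq_single (i - l)]
      · rw [if_pos (by omega)]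
      · intro m _ hm
        rw [if_neg (by omega)]
      · intro hm
        rw [Finset.mem_range] at hm
        omega
    · refine Finset.sum_eq_zero fun m _ => ?_
      rw [if_neg (by omega)]
  rw [Finset.sum_congr rfl h3, ← Finset.sum_filter]
  refine Finset.sum_congr ?_ fun l _ => by simp
  ext l
  simp only [Finset.mem_filter, Finset.mem_range]
  omega

namespace RAM

variable {y : ℕ → ℝ}

/-! ## The fast Fourier transform as a program -/

/-- One butterfly: cell `reg 2` of the next round, for the stride `reg 3`. -/
def fftCell : NExp :=
  .add (.cell 2 (.add (.mod (.reg 2) (.reg 3))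
      (.mul (.const 2) (.mod (.sub (.reg 2) (.mod (.reg 2) (.reg 3))) (.reg 1)))))
    (.mul (.cell 1 (.sub (.reg 2) (.mod (.reg 2) (.reg 3))))
      (.cell 2 (.add (.add (.mod (.reg 2) (.reg 3)) (.reg 3))
        (.mul (.const 2) (.mod (.sub (.reg 2) (.mod (.reg 2) (.reg 3))) (.reg 1))))))

/-- One round of the fast Fourier transform. -/
def fftRound : Cmd :=
  .seq (fill 3 (.reg 4) fftCell)
    (.seq (fill 2 (.reg 4) (.cell 3 (.reg 2))) (.setReg 3 (.div (.reg 3) (.const 2))))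

/-- The Fourier transform of the array `2`, of length `reg 4 = 2 * reg 1`, with the powers of the
root of unity in the array `1`. -/
def fft : Cmd := .seq (.setReg 3 (.reg 1)) (.loop (.const 0) (.reg 3) fftRound)

/-- The registers and the table of roots of unity are set up for series of length `2 ^ k`. -/
structure Ready (ω : ℂ) (k : ℕ) (ρ : ℕ → ℕ) (μ : ℕ → ℕ → ℂ) : Prop where
  len : ρ 1 = 2 ^ k
  size : ρ 4 = 2 ^ (k + 1)
  root : ω ^ 2 ^ k = -1
  table : ∀ u < 2 ^ (k + 1), μ 1 u = ω ^ u

lemma Ready.congr {ω : ℂ} {k : ℕ} {ρ ρ' : ℕ → ℕ} {μ μ' : ℕ → ℕ → ℂ} (h : Ready ω k ρ μ)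
    (h1 : ρ' 1 = ρ 1) (h4 : ρ' 4 = ρ 4) (hμ : μ' 1 = μ 1) : Ready ω k ρ' μ' :=
  ⟨h1.trans h.len, h4.trans h.size, h.root, fun u hu => by rw [hμ]; exact h.table u hu⟩

lemma Ready.pow_eq_one {ω : ℂ} {k : ℕ} {ρ : ℕ → ℕ} {μ : ℕ → ℕ → ℂ} (h : Ready ω k ρ μ) :
    ω ^ (2 * 2 ^ k) = 1 := by
  rw [mul_comm, pow_mul, h.root]; norm_num

variable {ω : ℂ} {k p : ℕ} {ρ : ℕ → ℕ} {μ : ℕ → ℕ → ℂ}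

lemma eval_update_of_reg {x i : ℕ} (hx : x ≠ 2) :
    (IExp.reg x).eval (Function.update ρ 2 i) = ρ x := by
  simp [IExp.eval, hx]

/-- A butterfly reads cells of array 2 at positions other than its own, so the new values are
collected in array 3 and copied back afterwards. -/
lemma runs_fftRound {s n : ℕ} {a : ℕ → ℂ} (h : Ready ω k ρ μ) (hs : 0 < s)
    (hsn : 2 ^ k = s * n) (h3 : ρ 3 = s) (hp : 4 * 2 ^ k ≤ p)
    (ha : ∀ i < 2 ^ (k + 1), μ 2 i = partialDft ω (2 * s) n a i) :
    Runs y fftRound ρ μ (184 * 2 ^ k) p fun ρ' μ' =>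
      (∀ x, x ≠ 2 → x ≠ 3 → ρ' x = ρ x) ∧ ρ' 3 = s / 2 ∧
      (∀ k', k' ≠ 2 → k' ≠ 3 → μ' k' = μ k') ∧
      ∀ i < 2 ^ (k + 1), μ' 2 i = partialDft ω s (2 * n) a i := by
  have hN : 2 ^ (k + 1) = 2 * 2 ^ k := pow_succ' _ _
  have hM : 0 < 2 ^ k := by positivity
  have hsM : s ≤ 2 ^ k := by
    rw [hsn]
    refine Nat.le_mul_of_pos_right _ (Nat.pos_of_ne_zero ?_)
    rintro rfl
    simp at hsn
  have hlen := h.len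
  have hsize := h.size
  have hcell : ∀ i < 2 ^ (k + 1), ∀ b : ℕ → ℂ, fftCell.eval y (Function.update ρ 2 i)
      (Function.update μ 3 b) = partialDft ω s (2 * n) a i := by
    intro i hi b
    rw [partialDft_step hs hsn h.pow_eq_one]
    have hq : i % s < s := Nat.mod_lt _ hs
    have hum : (i - i % s) % 2 ^ k < 2 ^ k := Nat.mod_lt _ hM
    obtain ⟨l, hl⟩ : s ∣ (i - i % s) % 2 ^ k :=
      (Nat.dvd_mod_iff (hsn ▸ Dvd.intro _ rfl)).2 (Nat.dvd_sub_mod i)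
    have hln : s * l + s ≤ 2 ^ k := by
      rw [hl, hsn] at hum
      have := Nat.lt_of_mul_lt_mul_left hum
      rw [hsn, ← Nat.mul_succ]
      exact Nat.mul_le_mul_left _ this
    rw [← ha _ (by omega), ← ha _ (by omega), ← h.table _ (by omega)]
    simp [fftCell, NExp.eval, IExp.eval, hlen, h3]
  have hr1 := runs_fill (y := y) (k := 3) (n := .reg 4) (e := fftCell) (ρ := ρ) (μ := μ) (p := p)
    (N := 2 ^ (k + 1)) (v := partialDft ω s (2 * n) a)
    (fun i => (eval_update_of_reg (by norm_num)).trans hsize) (by omega)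
    (fun i hi => by
      have hq : i % s < s := Nat.mod_lt _ hs
      have hum : (i - i % s) % 2 ^ k < 2 ^ k := Nat.mod_lt _ hM
      simp [fftCell, NExp.maxAddr, IExp.eval, hlen, h3]
      omega)
    (fun i hi b _ => hcell i hi b)
  refine Runs.mono (hr1.seq (T₂ := (1 + 2 + 9) * (2 ^ (k + 1) + 1) + 4) fun ρ1 μ1 h1 => ?_)
    ?_ le_rfl fun _ _ h => h
  swap
  · simp only [fftCell, NExp.cost, IExp.cost]; omega
  obtain ⟨hr1, hk1, hv1, -⟩ := h1
  have hr2 := runs_fill (y := y) (k := 2) (n := .reg 4) (e := .cell 3 (.reg 2)) (ρ := ρ1) (μ := μ1)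
    (p := p) (N := 2 ^ (k + 1)) (v := partialDft ω s (2 * n) a)
    (fun i => (eval_update_of_reg (by norm_num)).trans ((hr1 4 (by norm_num)).trans hsize))
    (by omega) (fun i hi => by simp [NExp.maxAddr, IExp.eval]; omega)
    (fun i hi b _ => by simp [NExp.eval, IExp.eval, hv1 i hi])
  refine hr2.seq fun ρ2 μ2 h2 => ?_
  obtain ⟨hr2, hk2, hv2, -⟩ := h2
  have h32 : ρ2 3 = s := by rw [hr2 3 (by norm_num), hr1 3 (by norm_num), h3]
  refine runs_setReg ?_ ⟨fun x hx2 hx3 => ?_, ?_, fun k' h2 h3 => ?_, hv2⟩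
  · simp only [IExp.eval, h32]; omega
  · rw [Function.update_of_ne hx3, hr2 x hx2, hr1 x hx2]
  · simp [IExp.eval, h32]
  · rw [hk2 k' h2, hk1 k' h3]

lemma runs_fft (h : Ready ω k ρ μ) (hp : 4 * 2 ^ k ≤ p) :
    Runs y fft ρ μ (200 * ((k + 1) * 2 ^ k)) p fun ρ' μ' =>
      (∀ x, x ≠ 2 → x ≠ 3 → ρ' x = ρ x) ∧ (∀ k', k' ≠ 2 → k' ≠ 3 → μ' k' = μ k') ∧
      ∀ i < 2 ^ (k + 1), μ' 2 i = dft ω (2 ^ (k + 1)) (μ 2) i := by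
  have hM : 0 < 2 ^ k := by positivity
  -- With j rounds left the current stride is 2^j and register 3 holds the next one, 2^j / 2; for j
  -- = 0 this is 0 and stops the loop.
  set I : ℕ → (ℕ → ℕ) → (ℕ → ℕ → ℂ) → Prop := fun j ρ' μ' => j ≤ k + 1 ∧
    (∀ x, x ≠ 2 → x ≠ 3 → ρ' x = ρ x) ∧ (∀ k', k' ≠ 2 → k' ≠ 3 → μ' k' = μ k') ∧
    ρ' 3 = 2 ^ j / 2 ∧
    ∀ i < 2 ^ (k + 1), μ' 2 i = partialDft ω (2 ^ j) (2 ^ (k + 1 - j)) (μ 2) i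
  have hstep : ∀ j ρ' μ', I (j + 1) ρ' μ' → (IExp.const 0).eval ρ' < (IExp.reg 3).eval ρ' ∧
      Runs y fftRound ρ' μ' (184 * 2 ^ k) p (I j) := by
    rintro j ρ' μ' ⟨hj, hr, hk, h3, ha⟩
    have h3' : ρ' 3 = 2 ^ j := by rw [h3, pow_succ]; simp
    have h2j : 0 < 2 ^ j := by positivity
    refine ⟨by simp [IExp.eval, h3'], ?_⟩
    refine (runs_fftRound (h.congr (hr 1 (by norm_num) (by norm_num))
      (hr 4 (by norm_num) (by norm_num)) (hk 1 (by norm_num) (by norm_num)))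
      h2j (n := 2 ^ (k - j)) (a := μ 2) ?_ h3' hp ?_).mono le_rfl le_rfl ?_
    · rw [← pow_add]; congr 1; omega
    · intro i hi
      rw [ha i hi, pow_succ', show k + 1 - (j + 1) = k - j by omega]
    · rintro ρ'' μ'' ⟨e1, e2, e3, e4⟩
      refine ⟨by omega, fun x hx hx' => (e1 x hx hx').trans (hr x hx hx'),
        fun k' hk1 hk2 => (e3 k' hk1 hk2).trans (hk k' hk1 hk2), e2, fun i hi => ?_⟩
      rw [e4 i hi, show k + 1 - j = k - j + 1 by omega, pow_succ' 2 (k - j)]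
  have hend : ∀ ρ' μ', I 0 ρ' μ' → ¬ (IExp.const 0).eval ρ' < (IExp.reg 3).eval ρ' := by
    rintro ρ' μ' ⟨-, -, -, h3, -⟩
    simp [IExp.eval, h3]
  refine Runs.mono (Runs.seq (Q₁ := I (k + 1)) (runs_setReg ?_ ?_) (runs_loop hstep hend (k + 1)))
    ?_ le_rfl ?_
  · simp only [IExp.eval, h.len]; omega
  · refine ⟨le_rfl, fun x _ hx => Function.update_of_ne hx _ _, fun _ _ _ => rfl, ?_, ?_⟩
    · simp [IExp.eval, h.len, pow_succ]
    · intro i hi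
      rw [Nat.sub_self, pow_zero, partialDft_start ω _ hi]
  · simp only [IExp.cost]
    nlinarith
  · rintro ρ' μ' ⟨-, hr, hk, -, ha⟩
    refine ⟨hr, hk, fun i hi => ?_⟩
    rw [ha i hi, pow_zero, Nat.sub_zero, partialDft_one]

/-! ## Products of power series as a program -/

/-- The power series with the coefficients in the array `k`. -/
def series (μ : ℕ → ℕ → ℂ) (k : ℕ) : PowerSeries ℂ := PowerSeries.mk (μ k)

/-- Load the first `reg 1` cells of an array into the array `2`, followed by zeros. -/
def loadPadded (ka : ℕ) : Cmd :=
  fill 2 (.reg 4) (.mul (.ofInt (.sub (.const 1) (.div (.reg 2) (.reg 1)))) (.cell ka (.reg 2)))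

/-- Multiply the power series in two arrays; the result is left in the array `5`. -/
def mulSeries (ka kb : ℕ) : Cmd :=
  .seq (loadPadded ka) (.seq fft (.seq (fill 4 (.reg 4) (.cell 2 (.reg 2)))
    (.seq (loadPadded kb) (.seq fft
      (.seq (fill 2 (.reg 4) (.mul (.cell 4 (.reg 2)) (.cell 2 (.reg 2)))) (.seq fft
        (fill 5 (.reg 1) (.div (.cell 2 (.mod (.sub (.reg 4) (.reg 2)) (.reg 4)))
          (.ofInt (.reg 4))))))))))

/-- A sequence cut off after `M` entries. -/
def cutOff (M : ℕ) (a : ℕ → ℂ) (i : ℕ) : ℂ := if i < M then a i else 0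

lemma cutOff_of_le {M i : ℕ} (a : ℕ → ℂ) (h : M ≤ i) : cutOff M a i = 0 := if_neg (by omega)

lemma coeff_mk_cutOff_mul {M i : ℕ} (hi : i < M) (a b : ℕ → ℂ) :
    PowerSeries.coeff i (PowerSeries.mk (cutOff M a) * PowerSeries.mk (cutOff M b))
      = PowerSeries.coeff i (PowerSeries.mk a * PowerSeries.mk b) := by
  rw [coeff_mul_eq_sum_range, coeff_mul_eq_sum_range]
  refine Finset.sum_congr rfl fun j hj => ?_
  rw [Finset.mem_range] at hj
  simp only [PowerSeries.coeff_mk, cutOff]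
  rw [if_pos (by omega), if_pos (by omega)]

/-- The factor 1 - i / 2^k in natural numbers is 1 on the first half of the range and 0 on the
second, so the padding needs no branching. -/
lemma runs_loadPadded {ka : ℕ} (h : Ready ω k ρ μ) (hka : ka ≠ 2) (hp : 4 * 2 ^ k ≤ p) :
    Runs y (loadPadded ka) ρ μ (57 * 2 ^ k) p fun ρ' μ' =>
      (∀ x, x ≠ 2 → ρ' x = ρ x) ∧ (∀ k', k' ≠ 2 → μ' k' = μ k') ∧
      ∀ i < 2 ^ (k + 1), μ' 2 i = cutOff (2 ^ k) (μ ka) i := by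
  have hN : 2 ^ (k + 1) = 2 * 2 ^ k := pow_succ' _ _
  have hM : 0 < 2 ^ k := by positivity
  refine (runs_fill (N := 2 ^ (k + 1)) (v := cutOff (2 ^ k) (μ ka))
    (fun i => (eval_update_of_reg (by norm_num)).trans h.size) (by omega)
    (fun i hi => ?_) (fun i hi b _ => ?_)).mono ?_ le_rfl
    fun _ _ h => ⟨h.1, h.2.1, h.2.2.1⟩
  · simp [NExp.maxAddr, IExp.eval]; omega
  · simp only [NExp.eval, IExp.eval, Function.update_self, Function.update_of_ne hka,
      Function.update_of_ne (show (1 : ℕ) ≠ 2 by norm_num), h.len, cutOff]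
    split_ifs with hlt
    · rw [Nat.div_eq_of_lt hlt]; simp
    · have : i / 2 ^ k = 1 := Nat.div_eq_of_lt_le (by omega) (by omega)
      rw [this]; simp
  · simp only [NExp.cost, IExp.cost]
    omega

/-- Three transforms of length 2^(k+1) dominate the cost. Arrays 2 to 5 are scratch space, hence the
conditions on the operands. -/
lemma runs_mulSeries {ka kb : ℕ} (h : Ready ω k ρ μ) (hka : 5 < ka) (hkb : 5 < kb)
    (hp : 4 * 2 ^ k ≤ p) :
    Runs y (mulSeries ka kb) ρ μ (900 * ((k + 1) * 2 ^ k)) p fun ρ' μ' =>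
      (∀ x, x ≠ 2 → x ≠ 3 → ρ' x = ρ x) ∧ (∀ k', k' < 2 ∨ 5 < k' → μ' k' = μ k') ∧
      ∀ i < 2 ^ k, μ' 5 i = PowerSeries.coeff i (series μ ka * series μ kb) := by
  have hN : 2 ^ (k + 1) = 2 * 2 ^ k := pow_succ' _ _
  have hM : 0 < 2 ^ k := by positivity
  have hsize := h.size
  have hlen := h.len
  refine Runs.mono ((runs_loadPadded h (by omega) hp).seq fun ρ1 μ1 h1 => ?_) (T₁ := 57 * 2 ^ k +
    (200 * ((k + 1) * 2 ^ k) + ((1 + 2 + 9) * (2 ^ (k + 1) + 1) + (57 * 2 ^ k +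
    (200 * ((k + 1) * 2 ^ k) + ((1 + 5 + 9) * (2 ^ (k + 1) + 1) + (200 * ((k + 1) * 2 ^ k)
    + (1 + 9 + 9) * (2 ^ k + 1))))))))
    (by nlinarith) le_rfl fun _ _ h => h
  obtain ⟨r1, m1, v1⟩ := h1
  have R1 := h.congr (r1 1 (by norm_num)) (r1 4 (by norm_num)) (m1 1 (by norm_num))
  refine (runs_fft R1 hp).seq fun ρ2 μ2 h2 => ?_
  obtain ⟨r2, m2, v2⟩ := h2
  have R2 := R1.congr (r2 1 (by norm_num) (by norm_num)) (r2 4 (by norm_num) (by norm_num))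
    (m2 1 (by norm_num) (by norm_num))
  refine (runs_fill (N := 2 ^ (k + 1)) (v := μ2 2)
    (fun i => (eval_update_of_reg (by norm_num)).trans R2.size) (by omega)
    (fun i hi => by simp [NExp.maxAddr, IExp.eval]; omega)
    (fun i hi b _ => by simp [NExp.eval, IExp.eval])).seq fun ρ3 μ3 h3 => ?_
  obtain ⟨r3, m3, v3, -⟩ := h3
  have R3 := R2.congr (r3 1 (by norm_num)) (r3 4 (by norm_num)) (m3 1 (by norm_num))
  refine (runs_loadPadded R3 (by omega) hp).seq fun ρ4 μ4 h4 => ?_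
  obtain ⟨r4, m4, v4⟩ := h4
  have R4 := R3.congr (r4 1 (by norm_num)) (r4 4 (by norm_num)) (m4 1 (by norm_num))
  refine (runs_fft R4 hp).seq fun ρ5 μ5 h5 => ?_
  obtain ⟨r5, m5, v5⟩ := h5
  have R5 := R4.congr (r5 1 (by norm_num) (by norm_num)) (r5 4 (by norm_num) (by norm_num))
    (m5 1 (by norm_num) (by norm_num))
  refine (runs_fill (N := 2 ^ (k + 1)) (v := fun i => μ5 4 i * μ5 2 i)
    (fun i => (eval_update_of_reg (by norm_num)).trans R5.size) (by omega)
    (fun i hi => by simp [NExp.maxAddr, IExp.eval]; omega)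
    (fun i hi b hb => by simp [NExp.eval, IExp.eval, hb])).seq fun ρ6 μ6 h6 => ?_
  obtain ⟨r6, m6, v6, -⟩ := h6
  have R6 := R5.congr (r6 1 (by norm_num)) (r6 4 (by norm_num)) (m6 1 (by norm_num))
  refine (runs_fft R6 hp).seq fun ρ7 μ7 h7 => ?_
  obtain ⟨r7, m7, v7⟩ := h7
  have R7 := R6.congr (r7 1 (by norm_num) (by norm_num)) (r7 4 (by norm_num) (by norm_num))
    (m7 1 (by norm_num) (by norm_num))
  refine (runs_fill (N := 2 ^ k)
    (v := fun i => PowerSeries.coeff i (series μ ka * series μ kb))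
    (fun i => (eval_update_of_reg (by norm_num)).trans R7.len) (by omega)
    (fun i hi => ?_) (fun i hi b _ => ?_)).mono (by simp [NExp.cost, IExp.cost]) le_rfl
    fun ρ8 μ8 h8 => ?_
  · simp only [NExp.maxAddr, IExp.eval, Function.update_of_ne (show (4 : ℕ) ≠ 2 by norm_num),
      R7.size, Function.update_self]
    have := Nat.mod_lt (2 ^ (k + 1) - i) (show 0 < 2 ^ (k + 1) by positivity)
    omega
  · simp only [NExp.eval, IExp.eval, Function.update_of_ne (show (4 : ℕ) ≠ 2 by norm_num),
      R7.size, Function.update_self, Function.update_of_ne (show (2 : ℕ) ≠ 5 by norm_num)]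
    have hr := Nat.mod_lt (2 ^ (k + 1) - i) (show 0 < 2 ^ (k + 1) by positivity)
    have hdft : ∀ {a b : ℕ → ℂ}, (∀ j < 2 ^ (k + 1), a j = b j) → ∀ i,
        dft ω (2 ^ (k + 1)) a i = dft ω (2 ^ (k + 1)) b i := fun hab i =>
      Finset.sum_congr rfl fun j hj => by rw [hab j (Finset.mem_range.1 hj)]
    have hA : ∀ j < 2 ^ (k + 1), μ5 4 j = dft ω (2 ^ (k + 1)) (cutOff (2 ^ k) (μ ka)) j := by
      intro j hj
      rw [m5 4 (by norm_num) (by norm_num), m4 4 (by norm_num), v3 j hj, v2 j hj, hdft v1]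
    have hB : ∀ j < 2 ^ (k + 1), μ5 2 j = dft ω (2 ^ (k + 1)) (cutOff (2 ^ k) (μ kb)) j := by
      intro j hj
      rw [v5 j hj, hdft v4, m3 kb (by omega), m2 kb (by omega) (by omega), m1 kb (by omega)]
    rw [v7 _ hr, hdft (b := fun j => dft ω (2 ^ (k + 1)) (cutOff (2 ^ k) (μ ka)) j
      * dft ω (2 ^ (k + 1)) (cutOff (2 ^ k) (μ kb)) j)
      (fun j hj => by rw [v6 j hj, hA j hj, hB j hj]),
      dft_dft_mul_dft h.root (fun i hi => cutOff_of_le _ hi) (fun i hi => cutOff_of_le _ hi) hi,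
      coeff_mk_cutOff_mul hi, series, series]
    push_cast
    rw [mul_div_cancel_left₀ _ (pow_ne_zero _ two_ne_zero)]
  · obtain ⟨r8, m8, v8, -⟩ := h8
    refine ⟨fun x hx hx' => ?_, fun k' hk' => ?_, v8⟩
    · rw [r8 x hx, r7 x hx hx', r6 x hx, r5 x hx hx', r4 x hx, r3 x hx, r2 x hx hx', r1 x hx]
    · rw [m8 k' (by omega), m7 k' (by omega) (by omega), m6 k' (by omega),
        m5 k' (by omega) (by omega), m4 k' (by omega), m3 k' (by omega),
        m2 k' (by omega) (by omega), m1 k' (by omega)]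

end RAM

/-! ## Newton iterations for power series -/

/-- Congruence of power series modulo `X ^ n`. -/
def SeriesCong (n : ℕ) (A B : PowerSeries ℂ) : Prop := PowerSeries.X ^ n ∣ A - B

namespace SeriesCong

variable {n m : ℕ} {A A' B B' C : PowerSeries ℂ}

lemma iff_coeff : SeriesCong n A B ↔
    ∀ i < n, PowerSeries.coeff i A = PowerSeries.coeff i B := by
  simp [SeriesCong, PowerSeries.X_pow_dvd_iff, sub_eq_zero]

lemma coeff (h : SeriesCong n A B) {i : ℕ} (hi : i < n) :
    PowerSeries.coeff i A = PowerSeries.coeff i B := iff_coeff.1 h i hi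

@[refl] lemma refl (A : PowerSeries ℂ) : SeriesCong n A A := by simp [SeriesCong]

@[symm] lemma symm (h : SeriesCong n A B) : SeriesCong n B A := by
  rw [iff_coeff] at *; exact fun i hi => (h i hi).symm

lemma trans (h : SeriesCong n A B) (h' : SeriesCong n B C) : SeriesCong n A C := by
  rw [iff_coeff] at *; exact fun i hi => (h i hi).trans (h' i hi)

lemma of_le (h : SeriesCong n A B) (hm : m ≤ n) : SeriesCong m A B := by
  rw [iff_coeff] at *; exact fun i hi => h i (by omega)

lemma mul (h : SeriesCong n A A') (h' : SeriesCong n B B') :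
    SeriesCong n (A * B) (A' * B') := dvd_mul_sub_mul h h'

lemma add (h : SeriesCong n A A') (h' : SeriesCong n B B') :
    SeriesCong n (A + B) (A' + B') := by
  have := dvd_add h h'
  rwa [show A - A' + (B - B') = A + B - (A' + B') by ring] at this

lemma sub (h : SeriesCong n A A') (h' : SeriesCong n B B') :
    SeriesCong n (A - B) (A' - B') := by
  have := dvd_sub h h'
  rwa [show A - A' - (B - B') = A - B - (A' - B') by ring] at this

lemma derivative (h : SeriesCong (n + 1) A B) :
    SeriesCong n (PowerSeries.derivative ℂ A) (PowerSeries.derivative ℂ B) := by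
  rw [iff_coeff] at *
  intro i hi
  rw [PowerSeries.coeff_derivative, PowerSeries.coeff_derivative, h (i + 1) (by omega)]

/-- Newton's iteration for the inverse. -/
lemma newton_inv (h : SeriesCong n (A * B) 1) :
    SeriesCong (2 * n) (A * (B * (2 - A * B))) 1 := by
  have h2 := mul_dvd_mul h h
  rw [← pow_add, ← two_mul] at h2
  rw [SeriesCong, show A * (B * (2 - A * B)) - 1 = -((A * B - 1) * (A * B - 1)) by ring]
  exact (dvd_neg).2 h2

/-- If `A ≡ C * D` and `D * B ≡ 1`, then `A * B ≡ C`. -/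
lemma mul_inv_cancel {D : PowerSeries ℂ} (h : SeriesCong n A (C * D)) (h' : SeriesCong n (D * B) 1) :
    SeriesCong n (A * B) C := by
  have h1 := h.mul (refl B)
  have h2 := (refl C).mul h'
  rw [mul_one, ← mul_assoc] at h2
  exact h1.trans h2

/-- Newton's iteration for the solution `F` of `F' = c F`. -/
lemma newton_ode {F E I V c : PowerSeries ℂ} (hF : PowerSeries.derivative ℂ F = c * F)
    (hn : 0 < n) (hE : SeriesCong n E F) (hI : SeriesCong (2 * n) (E * I) 1)
    (hV0 : PowerSeries.coeff 0 V = 0)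
    (hV : ∀ i < 2 * n - 1, ((i : ℂ) + 1) * PowerSeries.coeff (i + 1) V
      = PowerSeries.coeff i (c - PowerSeries.derivative ℂ E * I)) :
    SeriesCong (2 * n) (E + E * V) F := by
  obtain ⟨m, rfl⟩ : ∃ m, n = m + 1 := ⟨n - 1, by omega⟩
  -- U stands for F/E and satisfies U' ≡ U D with D = c - E'/E. Since U ≡ 1 modulo X^n and D ≡ 0
  -- modulo X^(n-1), the product (U - 1) D vanishes modulo X^(2n-1). Hence U' ≡ D there, and U is 1
  -- plus an antiderivative of D, namely 1 + V.
  set U := F * I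
  set D := c - PowerSeries.derivative ℂ E * I
  have hEU : SeriesCong (2 * (m + 1)) (E * U) F := by
    have := (refl F).mul hI
    rwa [mul_one, mul_left_comm] at this
  have hU1 : SeriesCong (m + 1) U 1 := (hE.symm.mul (refl I)).trans (hI.of_le (by omega))
  have hUD : SeriesCong (2 * m + 1) (PowerSeries.derivative ℂ U) (U * D) := by
    have h1 := (show SeriesCong (2 * m + 1 + 1) (E * U) F from hEU).derivative
    rw [Derivation.leibniz, smul_eq_mul, smul_eq_mul, hF] at h1
    have h2 := h1.mul (refl I)
    have h3 : SeriesCong (2 * m + 1) (PowerSeries.derivative ℂ U * (E * I))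
        (PowerSeries.derivative ℂ U) := by
      have := (refl (PowerSeries.derivative ℂ U)).mul (hI.of_le (show 2 * m + 1 ≤ _ by omega))
      rwa [mul_one] at this
    have h4 := h2.sub (refl (U * PowerSeries.derivative ℂ E * I))
    refine h3.symm.trans (trans ?_ (h4.trans ?_))
    · rw [show (E * PowerSeries.derivative ℂ U + U * PowerSeries.derivative ℂ E) * I
        - U * PowerSeries.derivative ℂ E * I = PowerSeries.derivative ℂ U * (E * I) by ring]
    · rw [show c * F * I - U * PowerSeries.derivative ℂ E * I = U * D by simp only [U, D]; ring]
  have hU' : SeriesCong m (PowerSeries.derivative ℂ U) 0 := by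
    have := hU1.derivative
    rwa [Derivation.map_one_eq_zero] at this
  have hD : SeriesCong m D 0 := by
    have h1 := (hU1.of_le (Nat.le_succ m)).mul (refl D)
    rw [one_mul] at h1
    exact h1.symm.trans ((hUD.of_le (by omega)).symm.trans hU')
  have hU'D : SeriesCong (2 * m + 1) (PowerSeries.derivative ℂ U) D := by
    refine hUD.trans ?_
    have h1 := mul_dvd_mul hU1 hD
    rw [sub_zero, ← pow_add] at h1
    have : SeriesCong (2 * m + 1) (U * D) D := by
      rw [SeriesCong, show U * D - D = (U - 1) * D by ring]
      exact (pow_dvd_pow _ (by omega)).trans h1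
    exact this
  have hUV : SeriesCong (2 * (m + 1)) U (1 + V) := by
    rw [iff_coeff]
    rintro (_ | i) hi
    · rw [hU1.coeff (Nat.succ_pos m), map_add, hV0, add_zero]
    · have h1 := hU'D.coeff (show i < 2 * m + 1 by omega)
      rw [PowerSeries.coeff_derivative, ← hV i (by omega)] at h1
      have hi0 : ((i : ℂ) + 1) ≠ 0 := by exact_mod_cast i.succ_ne_zero
      rw [mul_comm] at h1
      rw [mul_left_cancel₀ hi0 h1, map_add, PowerSeries.coeff_one, if_neg (by omega), zero_add]
  rw [show E + E * V = E * (1 + V) by ring]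
  exact ((refl E).mul hUV.symm).trans hEU

end SeriesCong

/-! ### Newton's iteration for the inverse as a program -/

namespace RAM

variable {y : ℕ → ℝ} {ω : ℂ} {k p : ℕ} {ρ : ℕ → ℕ} {μ : ℕ → ℕ → ℂ}

lemma seriesCong_series {a : ℕ} {n : ℕ} {A : PowerSeries ℂ} :
    SeriesCong n (series μ a) A ↔ ∀ i < n, μ a i = PowerSeries.coeff i A := by
  simp [SeriesCong.iff_coeff, series]

lemma series_congr {μ' : ℕ → ℕ → ℂ} {a : ℕ} (h : μ' a = μ a) : series μ' a = series μ a := by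
  rw [series, h, series]

/-- Fill the first `reg 1` cells of an array. -/
lemma runs_fill_len {b : ℕ} {e : NExp} {v : ℕ → ℂ} (h : Ready ω k ρ μ) (hb : b ≠ 1)
    (hp : 4 * 2 ^ k ≤ p) (he : ∀ i < 2 ^ k, e.maxAddr (Function.update ρ 2 i) ≤ p)
    (hv : ∀ i < 2 ^ k, ∀ a : ℕ → ℂ, a i = μ b i →
      e.eval y (Function.update ρ 2 i) (Function.update μ b a) = v i) :
    Runs y (fill b (.reg 1) e) ρ μ ((e.cost + 10) * (2 * 2 ^ k)) p fun ρ' μ' =>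
      Ready ω k ρ' μ' ∧ (∀ x, x ≠ 2 → x ≠ 3 → ρ' x = ρ x) ∧ (∀ k', k' ≠ b → μ' k' = μ k') ∧
      SeriesCong (2 ^ k) (series μ' b) (PowerSeries.mk v) := by
  have hM : 0 < 2 ^ k := by positivity
  refine (runs_fill (N := 2 ^ k) (fun i => (eval_update_of_reg (by norm_num)).trans h.len)
    (by omega) he hv).mono ?_ le_rfl fun ρ' μ' h' => ?_
  · simp only [IExp.cost]
    have : 2 ^ k + 1 ≤ 2 * 2 ^ k := by omega
    calc _ = (e.cost + 10) * (2 ^ k + 1) := by ring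
      _ ≤ _ := Nat.mul_le_mul_left _ this
  · obtain ⟨h1, h2, h3, -⟩ := h'
    refine ⟨h.congr (h1 1 (by norm_num)) (h1 4 (by norm_num)) (h2 1 (Ne.symm hb)),
      fun x hx _ => h1 x hx, h2, seriesCong_series.2 fun i hi => ?_⟩
    rw [PowerSeries.coeff_mk, h3 i hi]

lemma runs_mulSeries_cong {ka kb : ℕ} (h : Ready ω k ρ μ) (hka : 5 < ka) (hkb : 5 < kb)
    (hp : 4 * 2 ^ k ≤ p) :
    Runs y (mulSeries ka kb) ρ μ (900 * ((k + 1) * 2 ^ k)) p fun ρ' μ' =>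
      Ready ω k ρ' μ' ∧ (∀ x, x ≠ 2 → x ≠ 3 → ρ' x = ρ x) ∧
      (∀ k', k' < 2 ∨ 5 < k' → μ' k' = μ k') ∧
      SeriesCong (2 ^ k) (series μ' 5) (series μ ka * series μ kb) :=
  (runs_mulSeries h hka hkb hp).mono le_rfl le_rfl fun _ _ ⟨h1, h2, h3⟩ =>
    ⟨h.congr (h1 1 (by norm_num) (by norm_num)) (h1 4 (by norm_num) (by norm_num))
      (h2 1 (by norm_num)), h1, h2, seriesCong_series.2 h3⟩

/-- One Newton step `B ← B (2 - A B)`. -/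
def invStep (a b : ℕ) : Cmd :=
  .seq (mulSeries a b)
    (.seq (fill 17 (.reg 1) (.sub (.ofInt (.mul (.const 2) (.sub (.const 1) (.reg 2))))
      (.cell 5 (.reg 2))))
    (.seq (mulSeries b 17) (fill b (.reg 1) (.cell 5 (.reg 2)))))

/-- The cells of b from n on may hold anything, since `SeriesCong.newton_inv` uses only the
congruence modulo X^n. -/
lemma runs_invStep {a b n : ℕ} {A : PowerSeries ℂ} (h : Ready ω k ρ μ) (ha : 5 < a) (hb : 5 < b)
    (hb17 : b ≠ 17) (hp : 4 * 2 ^ k ≤ p)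
    (hA : SeriesCong (2 ^ k) (series μ a) A) (hn : 2 ^ k = 2 * n)
    (hinv : SeriesCong n (A * series μ b) 1) :
    Runs y (invStep a b) ρ μ (2000 * ((k + 1) * 2 ^ k)) p fun ρ' μ' =>
      Ready ω k ρ' μ' ∧ (∀ x, x ≠ 2 → x ≠ 3 → ρ' x = ρ x) ∧
      (∀ k', k' < 2 ∨ 5 < k' → k' ≠ 17 → k' ≠ b → μ' k' = μ k') ∧
      SeriesCong (2 ^ k) (A * series μ' b) 1 := by
  have hM : 0 < 2 ^ k := by positivity
  refine Runs.mono ((runs_mulSeries_cong h ha hb hp).seq fun ρ1 μ1 h1 => ?_)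
    (T₁ := 900 * ((k + 1) * 2 ^ k) + ((9 + 10) * (2 * 2 ^ k) + (900 * ((k + 1) * 2 ^ k)
      + (2 + 10) * (2 * 2 ^ k)))) (by nlinarith) le_rfl fun _ _ h => h
  obtain ⟨R1, r1, m1, v1⟩ := h1
  refine Runs.seq ((runs_fill_len R1 (b := 17) (by norm_num) hp
    (v := fun i => PowerSeries.coeff i (2 : PowerSeries ℂ) - μ1 5 i)
    (fun i hi => ?_) (fun i hi c _ => ?_)).mono le_rfl le_rfl
    fun _ _ h => h) fun ρ2 μ2 h2 => ?_
  · simp [NExp.maxAddr, IExp.eval]; omega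
  -- Truncated subtraction makes 2 (1 - i) the coefficient sequence of the constant series 2.
  · have h2 : PowerSeries.coeff i (2 : PowerSeries ℂ) = ((2 * (1 - i) : ℕ) : ℂ) := by
      rw [← map_ofNat (PowerSeries.C (R := ℂ)) 2, PowerSeries.coeff_C]
      rcases i with _ | i
      · simp
      · simp
    rw [h2]
    simp [NExp.eval, IExp.eval]
  obtain ⟨R2, r2, m2, v2⟩ := h2
  refine Runs.seq (runs_mulSeries_cong R2 hb (by norm_num) hp) fun ρ3 μ3 h3 => ?_
  obtain ⟨R3, r3, m3, v3⟩ := h3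
  refine ((runs_fill_len R3 (b := b) (by omega) hp (v := fun i => μ3 5 i)
    (fun i hi => ?_) (fun i hi c _ => ?_)).mono (by simp [NExp.cost, IExp.cost]) le_rfl
    fun ρ4 μ4 h4 => ?_)
  · simp [NExp.maxAddr, IExp.eval]; omega
  · simp [NExp.eval, IExp.eval, show (5 : ℕ) ≠ b by omega]
  obtain ⟨R4, r4, m4, v4⟩ := h4
  refine ⟨R4, fun x hx hx' => ?_, fun k' hk h17 hb' => ?_, ?_⟩
  · rw [r4 x hx hx', r3 x hx hx', r2 x hx hx', r1 x hx hx']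
  · rw [m4 k' hb', m3 k' hk, m2 k' h17, m1 k' hk]
  · have e1 : SeriesCong (2 ^ k) (series μ2 17) (2 - A * series μ b) := by
      refine v2.trans ?_
      have e0 : PowerSeries.mk (fun i => PowerSeries.coeff i (2 : PowerSeries ℂ) - μ1 5 i)
          = 2 - series μ1 5 := by
        ext i; simp [series]
      rw [e0]
      exact (SeriesCong.refl 2).sub (v1.trans (hA.mul (SeriesCong.refl _)))
    have e2 : series μ2 b = series μ b := series_congr
      ((m2 b hb17).trans (m1 b (by omega)))
    have e3 : SeriesCong (2 ^ k) (series μ4 b) (series μ b * (2 - A * series μ b)) := by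
      refine v4.trans (v3.trans ?_)
      rw [e2]
      exact (SeriesCong.refl _).mul e1
    refine ((SeriesCong.refl A).mul e3).trans ?_
    rw [hn]
    exact SeriesCong.newton_inv hinv

end RAM

namespace RAM

variable {y : ℕ → ℝ} {ω : ℂ} {k p : ℕ} {ρ : ℕ → ℕ} {μ : ℕ → ℕ → ℂ}

/-! ## Doubling the precision of the coefficients -/

/-- Improve the inverse `b` of the series `a`, and multiply it by the derivative of `a`, whose
coefficients are given by `e`. -/
def logDerivStep (a b d : ℕ) (e : NExp) : Cmd :=
  .seq (invStep a b) (.seq (fill 9 (.reg 1) e) (.seq (mulSeries 9 b)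
    (fill d (.reg 1) (.cell 5 (.reg 2)))))

/-- The precision m is separate from 2^k: a derivative read off the stored coefficients loses the
last one, whereas an explicit formula loses none. -/
lemma runs_logDerivStep {a b d n m : ℕ} {e : NExp} {v : ℕ → ℂ} {A : PowerSeries ℂ}
    (h : Ready ω k ρ μ) (ha : 5 < a) (hb : 5 < b) (hd : 5 < d) (hb17 : b ≠ 17) (hb9 : b ≠ 9)
    (hdb : d ≠ b) (hab : a ≠ b) (ha17 : a ≠ 17) (hp : 4 * 2 ^ k ≤ p)
    (hA : SeriesCong (2 ^ k) (series μ a) A) (hn : 2 ^ k = 2 * n)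
    (hinv : SeriesCong n (A * series μ b) 1) (hm : m ≤ 2 ^ k) (he : e.cost ≤ 20) (ha9 : a ≠ 9)
    (hev : ∀ ρ' μ', ρ' 2 < 2 ^ k → μ' a = μ a → e.maxAddr ρ' ≤ p ∧ e.eval y ρ' μ' = v (ρ' 2))
    (hv : SeriesCong m (PowerSeries.mk v) (PowerSeries.derivative ℂ A)) :
    Runs y (logDerivStep a b d e) ρ μ (3000 * ((k + 1) * 2 ^ k)) p fun ρ' μ' =>
      Ready ω k ρ' μ' ∧ (∀ x, x ≠ 2 → x ≠ 3 → ρ' x = ρ x) ∧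
      (∀ k', k' < 2 ∨ 5 < k' → k' ≠ 17 → k' ≠ 9 → k' ≠ b → k' ≠ d → μ' k' = μ k') ∧
      SeriesCong (2 ^ k) (A * series μ' b) 1 ∧
      SeriesCong m (series μ' d) (PowerSeries.derivative ℂ A * series μ' b) := by
  have hM : 0 < 2 ^ k := by positivity
  refine Runs.mono ((runs_invStep h ha hb hb17 hp hA hn hinv).seq fun ρ1 μ1 h1 => ?_)
    (T₁ := 2000 * ((k + 1) * 2 ^ k) + ((20 + 10) * (2 * 2 ^ k) + (900 * ((k + 1) * 2 ^ k)
      + (2 + 10) * (2 * 2 ^ k)))) (by nlinarith) le_rfl fun _ _ h => h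
  obtain ⟨R1, r1, m1, v1⟩ := h1
  have hμa : μ1 a = μ a := m1 a (by omega) ha17 hab
  refine Runs.seq ((runs_fill_len R1 (b := 9) (by norm_num) hp (v := v)
    (fun i hi => ?_) (fun i hi c _ => ?_)).mono (Nat.mul_le_mul_right _ (by omega)) le_rfl
    fun _ _ h => h) fun ρ2 μ2 h2 => ?_
  · exact (hev _ μ (by simpa using hi) rfl).1
  · rw [(hev _ _ (by simpa using hi) ((Function.update_of_ne ha9 _ _).trans hμa)).2]
    simp
  obtain ⟨R2, r2, m2, v2⟩ := h2
  refine Runs.seq (runs_mulSeries_cong R2 (by norm_num) hb hp) fun ρ3 μ3 h3 => ?_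
  obtain ⟨R3, r3, m3, v3⟩ := h3
  refine ((runs_fill_len R3 (b := d) (by omega) hp (v := fun i => μ3 5 i)
    (fun i hi => ?_) (fun i hi c _ => ?_)).mono (by simp [NExp.cost, IExp.cost]) le_rfl
    fun ρ4 μ4 h4 => ?_)
  · simp [NExp.maxAddr, IExp.eval]; omega
  · simp [NExp.eval, IExp.eval, show (5 : ℕ) ≠ d by omega]
  obtain ⟨R4, r4, m4, v4⟩ := h4
  have e2 : series μ2 b = series μ1 b := series_congr (m2 b hb9)
  have e4 : series μ4 b = series μ1 b := series_congr
    ((m4 b hdb.symm).trans ((m3 b (by omega)).trans (m2 b hb9)))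
  refine ⟨R4, fun x hx hx' => ?_, fun k' hk h17 h9 hb' hd' => ?_, ?_, ?_⟩
  · rw [r4 x hx hx', r3 x hx hx', r2 x hx hx', r1 x hx hx']
  · rw [m4 k' hd', m3 k' hk, m2 k' h9, m1 k' hk h17 hb']
  · rw [e4]; exact v1
  · rw [e4, ← e2]
    exact ((v4.trans v3).of_le hm).trans (((v2.of_le hm).trans hv).mul (SeriesCong.refl _))

/-- Coefficients of `(1/z) ln (1/(1-z))` and of its logarithmic derivative. -/
def logQuotStep : Cmd :=
  .seq (fill 8 (.reg 1) (.div (.const 1) (.ofInt (.add (.reg 2) (.const 1)))))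
    (logDerivStep 8 10 11 (.div (.ofInt (.add (.reg 2) (.const 1)))
      (.ofInt (.add (.reg 2) (.const 2)))))

lemma runs_logQuotStep {n : ℕ} (h : Ready ω k ρ μ) (hp : 4 * 2 ^ k ≤ p) (hn : 2 ^ k = 2 * n)
    (hinv : SeriesCong n (PowerSeries.mk (logQuotSeq ℂ) * series μ 10) 1) :
    Runs y logQuotStep ρ μ (3100 * ((k + 1) * 2 ^ k)) p fun ρ' μ' =>
      Ready ω k ρ' μ' ∧ (∀ x, x ≠ 2 → x ≠ 3 → ρ' x = ρ x) ∧
      (∀ k', k' < 2 ∨ 5 < k' → k' ≠ 17 → k' ≠ 8 → k' ≠ 9 → k' ≠ 10 → k' ≠ 11 → μ' k' = μ k') ∧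
      SeriesCong (2 ^ k) (PowerSeries.mk (logQuotSeq ℂ) * series μ' 10) 1 ∧
      SeriesCong (2 ^ k) (series μ' 11) (PowerSeries.mk (logDerivSeq (logQuotSeq ℂ))) := by
  have hM : 0 < 2 ^ k := by positivity
  refine Runs.mono (Runs.seq (runs_fill_len h (b := 8) (by norm_num) hp (v := logQuotSeq ℂ)
    (fun i hi => ?_) (fun i hi c _ => ?_)) (T₂ := 3000 * ((k + 1) * 2 ^ k)) fun ρ1 μ1 h1 => ?_)
    (p := p) ?_ le_rfl fun _ _ h => h
  · simp [NExp.maxAddr]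
  · simp [NExp.eval, IExp.eval, logQuotSeq]
  · obtain ⟨R1, r1, m1, v1⟩ := h1
    refine (runs_logDerivStep R1 (v := fun i => ((i : ℂ) + 1) / (i + 2)) (m := 2 ^ k)
      (by norm_num) (by norm_num) (by norm_num) (by norm_num) (by norm_num) (by norm_num)
      (by norm_num) (by norm_num) hp v1 hn ?_ le_rfl (by simp [NExp.cost, IExp.cost])
      (by norm_num) (fun ρ' μ' _ _ => ?_) ?_).mono le_rfl le_rfl fun ρ2 μ2 h2 => ?_
    · rw [series_congr (m1 10 (by norm_num))]
      exact hinv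
    · simp [NExp.maxAddr, NExp.eval, IExp.eval]
    · rw [SeriesCong.iff_coeff]
      intro i _
      rw [PowerSeries.coeff_derivative, PowerSeries.coeff_mk, PowerSeries.coeff_mk, logQuotSeq]
      push_cast
      ring
    · obtain ⟨R2, r2, m2, i2, v2⟩ := h2
      refine ⟨R2, fun x hx hx' => (r2 x hx hx').trans (r1 x hx hx'),
        fun k' hk a b c d e => (m2 k' hk a c d e).trans (m1 k' b), i2,
        v2.trans (SeriesCong.mul_inv_cancel ?_ i2)⟩
      rw [mk_logDerivSeq_mul (logQuotSeq_zero)]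
  · simp only [NExp.cost, IExp.cost]
    nlinarith

/-- Coefficients of `(2/z) ln ((1/z) ln (1/(1-z)))` and of its logarithmic derivative. -/
def logLogQuotStep : Cmd :=
  .seq (fill 12 (.reg 1) (.div (.mul (.const 2) (.cell 11 (.reg 2)))
      (.ofInt (.add (.reg 2) (.const 1)))))
    (logDerivStep 12 13 14 (.mul (.ofInt (.add (.reg 2) (.const 1)))
      (.cell 12 (.add (.reg 2) (.const 1)))))

/-- The derivative of h is formed from stored coefficients, so h'/h is known only modulo X^(2^k -
1). That is enough for the Newton step of f, which integrates it. -/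
lemma runs_logLogQuotStep {n : ℕ} (h : Ready ω k ρ μ) (hp : 4 * 2 ^ k ≤ p) (hn : 2 ^ k = 2 * n)
    (hC : SeriesCong (2 ^ k) (series μ 11) (PowerSeries.mk (logDerivSeq (logQuotSeq ℂ))))
    (hinv : SeriesCong n (PowerSeries.mk (logLogQuotSeq ℂ) * series μ 13) 1) :
    Runs y logLogQuotStep ρ μ (3100 * ((k + 1) * 2 ^ k)) p fun ρ' μ' =>
      Ready ω k ρ' μ' ∧ (∀ x, x ≠ 2 → x ≠ 3 → ρ' x = ρ x) ∧
      (∀ k', k' < 2 ∨ 5 < k' → k' ≠ 17 → k' ≠ 12 → k' ≠ 9 → k' ≠ 13 → k' ≠ 14 → μ' k' = μ k') ∧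
      SeriesCong (2 ^ k) (PowerSeries.mk (logLogQuotSeq ℂ) * series μ' 13) 1 ∧
      SeriesCong (2 ^ k - 1) (series μ' 14)
        (PowerSeries.mk (logDerivSeq (logLogQuotSeq ℂ))) := by
  have hM : 0 < 2 ^ k := by positivity
  have hC' := seriesCong_series.1 hC
  refine Runs.mono (Runs.seq (runs_fill_len h (b := 12) (by norm_num) hp (v := logLogQuotSeq ℂ)
    (fun i hi => ?_) (fun i hi c _ => ?_)) (T₂ := 3000 * ((k + 1) * 2 ^ k)) fun ρ1 μ1 h1 => ?_)
    (p := p) ?_ le_rfl fun _ _ h => h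
  · simp [NExp.maxAddr, IExp.eval]; omega
  · simp [NExp.eval, IExp.eval, logLogQuotSeq, hC' i hi]
  · obtain ⟨R1, r1, m1, v1⟩ := h1
    refine (runs_logDerivStep R1 (v := fun i => ((i : ℂ) + 1) * μ1 12 (i + 1)) (m := 2 ^ k - 1)
      (by norm_num) (by norm_num) (by norm_num) (by norm_num) (by norm_num) (by norm_num)
      (by norm_num) (by norm_num) hp v1 hn ?_ (Nat.sub_le _ _) (by simp [NExp.cost, IExp.cost])
      (by norm_num) (fun ρ' μ' hρ hμ => ?_) ?_).mono le_rfl le_rfl fun ρ2 μ2 h2 => ?_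
    · rw [series_congr (m1 13 (by norm_num))]
      exact hinv
    · simp [NExp.maxAddr, NExp.eval, IExp.eval, hμ]
      omega
    · rw [SeriesCong.iff_coeff]
      intro i hi
      rw [PowerSeries.coeff_derivative, PowerSeries.coeff_mk,
        seriesCong_series.1 v1 (i + 1) (by omega), mul_comm]
    · obtain ⟨R2, r2, m2, i2, v2⟩ := h2
      refine ⟨R2, fun x hx hx' => (r2 x hx hx').trans (r1 x hx hx'),
        fun k' hk a b c d e => (m2 k' hk a c d e).trans (m1 k' b), i2,
        v2.trans (SeriesCong.mul_inv_cancel ?_ (i2.of_le (Nat.sub_le _ _)))⟩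
      rw [mk_logDerivSeq_mul (logLogQuotSeq_zero)]
  · simp only [NExp.cost, IExp.cost]
    nlinarith

/-- The correction in Newton's iteration for the differential equation: an antiderivative. -/
def odeCorrection (γ δ : ℝ) : NExp :=
  .div (.mul (.ofInt (.sub (.const 1) (.sub (.const 1) (.reg 2))))
      (.sub (.add (.add (.const (1 / 2)) (.mul (.const γ) (.cell 11 (.sub (.reg 2) (.const 1)))))
        (.mul (.const δ) (.cell 14 (.sub (.reg 2) (.const 1)))))
        (.cell 19 (.sub (.reg 2) (.const 1)))))
    (.ofInt (.add (.reg 2) (.sub (.const 1) (.reg 2))))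

/-- Coefficients of `singularFn γ δ`, and of its inverse. -/
def singularStep (γ δ : ℝ) : Cmd :=
  .seq (logDerivStep 15 16 19 (.mul (.ofInt (.add (.reg 2) (.const 1)))
      (.cell 15 (.add (.reg 2) (.const 1)))))
    (.seq (fill 9 (.reg 1) (odeCorrection γ δ)) (.seq (mulSeries 15 9)
      (.seq (fill 15 (.reg 1) (.add (.cell 15 (.reg 2)) (.cell 5 (.reg 2)))) (invStep 15 16))))

/-- The first inversion concerns the current approximation E in array 15, not f, because
`SeriesCong.newton_ode` needs E'/E to double precision. -/
lemma runs_singularStep {n : ℕ} {γ δ : ℝ} (h : Ready ω k ρ μ) (hp : 4 * 2 ^ k ≤ p)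
    (hn : 2 ^ k = 2 * n)
    (hC : SeriesCong (2 ^ k) (series μ 11) (PowerSeries.mk (logDerivSeq (logQuotSeq ℂ))))
    (hD : SeriesCong (2 ^ k - 1) (series μ 14) (PowerSeries.mk (logDerivSeq (logLogQuotSeq ℂ))))
    (hF : SeriesCong n (series μ 15) (PowerSeries.mk (singularSeq (γ : ℂ) (δ : ℂ))))
    (hinv : SeriesCong n (PowerSeries.mk (singularSeq (γ : ℂ) (δ : ℂ)) * series μ 16) 1) :
    Runs y (singularStep γ δ) ρ μ (6100 * ((k + 1) * 2 ^ k)) p fun ρ' μ' =>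
      Ready ω k ρ' μ' ∧ (∀ x, x ≠ 2 → x ≠ 3 → ρ' x = ρ x) ∧
      (∀ k', k' < 2 ∨ 5 < k' → k' ≠ 17 → k' ≠ 9 → k' ≠ 15 → k' ≠ 16 → k' ≠ 19 → μ' k' = μ k') ∧
      SeriesCong (2 ^ k) (series μ' 15) (PowerSeries.mk (singularSeq (γ : ℂ) (δ : ℂ))) ∧
      SeriesCong (2 ^ k) (PowerSeries.mk (singularSeq (γ : ℂ) (δ : ℂ)) * series μ' 16) 1 := by
  have hM : 0 < 2 ^ k := by positivity
  set F := PowerSeries.mk (singularSeq (γ : ℂ) (δ : ℂ)) with hFdef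
  refine Runs.mono (Runs.seq (T₁ := 3000 * ((k + 1) * 2 ^ k)) (T₂ := (40 + 10) * (2 * 2 ^ k)
    + (900 * ((k + 1) * 2 ^ k) + ((5 + 10) * (2 * 2 ^ k) + 2000 * ((k + 1) * 2 ^ k))))
    (runs_logDerivStep h (v := fun i => ((i : ℂ) + 1) * μ 15 (i + 1)) (m := 2 ^ k - 1) (n := n)
      (by norm_num) (by norm_num) (by norm_num) (by norm_num) (by norm_num) (by norm_num)
      (by norm_num) (by norm_num) hp (SeriesCong.refl _) hn ?_ (Nat.sub_le _ _)
      (by simp [NExp.cost, IExp.cost]) (by norm_num) (fun ρ' μ' hρ hμ => ?_) ?_)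
      fun ρ1 μ1 h1 => ?_) (p := p) (by nlinarith) le_rfl fun _ _ h => h
  · exact (hF.mul (SeriesCong.refl _)).trans hinv
  · simp [NExp.maxAddr, NExp.eval, IExp.eval, hμ]
    omega
  · rw [SeriesCong.iff_coeff]
    intro i hi
    rw [PowerSeries.coeff_derivative, PowerSeries.coeff_mk, series, PowerSeries.coeff_mk, mul_comm]
  obtain ⟨R1, r1, m1, i1, v1⟩ := h1
  -- In natural numbers 1 - (1 - i) is 0 for i = 0 and 1 otherwise, and i + (1 - i) is max i 1. So V
  -- is the antiderivative with constant term 0, without a division by 0.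
  set V : ℕ → ℂ := fun i => ((1 - (1 - i) : ℕ) : ℂ) * (1 / 2 + γ * μ1 11 (i - 1)
    + δ * μ1 14 (i - 1) - μ1 19 (i - 1)) / ((i + (1 - i) : ℕ) : ℂ) with hVdef
  refine Runs.seq ((runs_fill_len R1 (b := 9) (by norm_num) hp (v := V)
    (fun i hi => ?_) (fun i hi c _ => ?_)).mono
    (Nat.mul_le_mul_right _ (by simp [odeCorrection, NExp.cost, IExp.cost])) le_rfl
    fun _ _ h => h) fun ρ2 μ2 h2 => ?_
  · simp [odeCorrection, NExp.maxAddr, IExp.eval]; omega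
  · simp [odeCorrection, NExp.eval, IExp.eval, hVdef]
  obtain ⟨R2, r2, m2, v2⟩ := h2
  refine Runs.seq (runs_mulSeries_cong R2 (by norm_num) (by norm_num) hp) fun ρ3 μ3 h3 => ?_
  obtain ⟨R3, r3, m3, v3⟩ := h3
  have hμ15 : μ3 15 = μ 15 := (m3 15 (by norm_num)).trans ((m2 15 (by norm_num)).trans
    (m1 15 (by norm_num) (by norm_num) (by norm_num) (by norm_num) (by norm_num)))
  refine Runs.seq ((runs_fill_len R3 (b := 15) (by norm_num) hp (v := fun i => μ3 15 i + μ3 5 i)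
    (fun i hi => ?_) (fun i hi c hc => ?_)).mono (by simp [NExp.cost, IExp.cost]) le_rfl
    fun _ _ h => h) fun ρ4 μ4 h4 => ?_
  · simp [NExp.maxAddr, IExp.eval]; omega
  · simp [NExp.eval, IExp.eval, hc]
  obtain ⟨R4, r4, m4, v4⟩ := h4
  have e2 : series μ2 15 = series μ 15 := series_congr ((m2 15 (by norm_num)).trans
    (m1 15 (by norm_num) (by norm_num) (by norm_num) (by norm_num) (by norm_num)))
  have hn0 : 0 < n := by omega
  have e4 : series μ4 16 = series μ1 16 := series_congr ((m4 16 (by norm_num)).trans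
    ((m3 16 (by norm_num)).trans (m2 16 (by norm_num))))
  have c4 : SeriesCong (2 ^ k) (series μ4 15) F := by
    have h1 : SeriesCong (2 ^ k) (series μ4 15)
        (series μ 15 + series μ 15 * PowerSeries.mk V) := by
      refine v4.trans ?_
      have e : PowerSeries.mk (fun i => μ3 15 i + μ3 5 i) = series μ 15 + series μ3 5 := by
        ext i; simp [series, hμ15]
      rw [e]
      refine (SeriesCong.refl _).add (v3.trans ?_)
      rw [e2]
      exact (SeriesCong.refl _).mul v2
    refine h1.trans ?_
    rw [hn] at i1 ⊢
    refine SeriesCong.newton_ode (derivative_mk_odeSeq _) hn0 hF i1 ?_ fun i hi => ?_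
    · simp [hVdef]
    · have hi' : i < 2 ^ k - 1 := by omega
      have hi0 : ((i : ℂ) + 1) ≠ 0 := by exact_mod_cast i.succ_ne_zero
      have a1 := seriesCong_series.1 v1 i hi'
      have a2 : μ1 11 i = _ := (congrFun (m1 11 (by norm_num) (by norm_num) (by norm_num)
        (by norm_num) (by norm_num)) i).trans (seriesCong_series.1 hC i (by omega))
      have a3 : μ1 14 i = _ := (congrFun (m1 14 (by norm_num) (by norm_num) (by norm_num)
        (by norm_num) (by norm_num)) i).trans (seriesCong_series.1 hD i hi')
      rw [PowerSeries.coeff_mk] at a2 a3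
      rw [map_sub, ← a1, PowerSeries.coeff_mk, PowerSeries.coeff_mk, hVdef]
      simp only [Nat.add_sub_cancel, a2, a3, singularLogDerivSeq]
      rw [show 1 - (1 - (i + 1)) = 1 by omega, show i + 1 + (1 - (i + 1)) = i + 1 by omega]
      push_cast
      field_simp
  -- Array 16 now inverts E, hence f only modulo X^n; one more Newton step against the improved f
  -- doubles this.
  refine (runs_invStep R4 (by norm_num) (by norm_num) (by norm_num) hp c4 hn (n := n)
    ?_).mono le_rfl le_rfl fun ρ5 μ5 h5 => ?_
  · rw [e4]
    exact (hF.symm.mul (SeriesCong.refl _)).trans (i1.of_le (by omega))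
  obtain ⟨R5, r5, m5, v5⟩ := h5
  refine ⟨R5, fun x hx hx' => ?_, fun k' hk h17 h9 h15 h16 h19 => ?_, ?_, v5⟩
  · rw [r5 x hx hx', r4 x hx hx', r3 x hx hx', r2 x hx hx', r1 x hx hx']
  · rw [m5 k' hk h17 h16, m4 k' h15, m3 k' hk, m2 k' h9, m1 k' hk h17 h9 h16 h19]
  · rw [series_congr (m5 15 (by norm_num) (by norm_num) (by norm_num))]
    exact c4

end RAM

namespace RAM

variable {y : ℕ → ℝ} {k p t : ℕ} {ρ : ℕ → ℕ} {μ : ℕ → ℕ → ℂ} {γ δ : ℝ}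

/-! ## The streaming program -/

/-- What is known when the coefficients have been computed up to `2 ^ k`. -/
structure Prepared (γ δ : ℝ) (k : ℕ) (ρ : ℕ → ℕ) (μ : ℕ → ℕ → ℂ) : Prop where
  len : ρ 1 = 2 ^ k
  root : μ 6 0 ^ 2 ^ k = -1
  table : ∀ u < 2 ^ (k + 1), μ 1 u = μ 6 0 ^ u
  logQuot : SeriesCong (2 ^ k) (PowerSeries.mk (logQuotSeq ℂ) * series μ 10) 1
  logLogQuot : SeriesCong (2 ^ k) (PowerSeries.mk (logLogQuotSeq ℂ) * series μ 13) 1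
  singular : SeriesCong (2 ^ k) (series μ 15) (PowerSeries.mk (singularSeq (γ : ℂ) (δ : ℂ)))
  inverse : SeriesCong (2 ^ k) (PowerSeries.mk (singularSeq (γ : ℂ) (δ : ℂ)) * series μ 16) 1

/-- The array `18` holds the first `2 ^ k` entries of the output. -/
def Output (γ δ : ℝ) (y : ℕ → ℝ) (k : ℕ) (μ : ℕ → ℕ → ℂ) : Prop :=
  ∀ i < 2 ^ k, μ 18 i = PowerSeries.coeff i
    (PowerSeries.mk (singularSeq (γ : ℂ) (δ : ℂ)) * PowerSeries.mk fun j => (y j : ℂ))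

/-- Double the length, and the table of the roots of unity. -/
def resize : Cmd :=
  .seq (.setReg 1 (.mul (.const 2) (.reg 1))) (.seq (.setReg 4 (.mul (.const 2) (.reg 1)))
    (.seq (.setCell 6 (.const 0) (.sqrt (.cell 6 (.const 0))))
    (.seq (fill 7 (.reg 4) (.mul (.cell 1 (.div (.reg 2) (.const 2))) (.add (.const 1)
      (.mul (.ofInt (.mod (.reg 2) (.const 2))) (.sub (.cell 6 (.const 0)) (.const 1))))))
    (fill 1 (.reg 4) (.cell 7 (.reg 2))))))

lemma sqrt_pow_two (a : ℂ) : Complex.sqrt a ^ 2 = a := by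
  rw [Complex.sqrt]
  exact_mod_cast Complex.cpow_nat_inv_pow a two_ne_zero

/-- Either square root of the old root would do, as only the equation ω^(2^(k+1)) = -1 is used. -/
lemma runs_resize (h1 : ρ 1 = 2 ^ k) (hω : μ 6 0 ^ 2 ^ k = -1)
    (hW : ∀ u < 2 ^ (k + 1), μ 1 u = μ 6 0 ^ u) (hp : 4 * 2 ^ (k + 1) ≤ p) :
    Runs y resize ρ μ (200 * 2 ^ (k + 1)) p fun ρ' μ' =>
      Ready (μ' 6 0) (k + 1) ρ' μ' ∧ ρ' 0 = ρ 0 ∧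
      ∀ k', k' ≠ 1 → k' ≠ 6 → k' ≠ 7 → μ' k' = μ k' := by
  have hN : 2 ^ (k + 1) = 2 * 2 ^ k := pow_succ' _ _
  have hN' : 2 ^ (k + 1 + 1) = 2 * 2 ^ (k + 1) := pow_succ' _ _
  have hM : 0 < 2 ^ k := by positivity
  set w := Complex.sqrt (μ 6 0) with hw
  have hw2 : w ^ 2 = μ 6 0 := sqrt_pow_two _
  refine Runs.mono (T₁ := 4 + (4 + ((1 + 3 + 1) + ((1 + 16 + 9) * (2 ^ (k + 1 + 1) + 1)
    + (1 + 2 + 9) * (2 ^ (k + 1 + 1) + 1))))) (Runs.seq (Q₁ := fun ρ' μ' =>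
      ρ' 1 = 2 ^ (k + 1) ∧ ρ' 0 = ρ 0 ∧ μ' = μ)
    (runs_setReg ?_ ⟨?_, ?_, rfl⟩) ?_) (by omega) le_rfl fun _ _ h => h
  · simp [IExp.eval, h1]; omega
  · simp [IExp.eval, h1, hN]
  · simp
  rintro ρ1 μ1 ⟨r1, r10, rfl⟩
  refine Runs.seq (Q₁ := fun ρ' μ' =>
      ρ' 1 = 2 ^ (k + 1) ∧ ρ' 4 = 2 ^ (k + 1 + 1) ∧ ρ' 0 = ρ 0 ∧ μ' = μ1)
    (runs_setReg ?_ ⟨?_, ?_, ?_, rfl⟩) ?_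
  · simp [IExp.eval, r1]; omega
  · simpa using r1
  · simp [IExp.eval, r1, hN']
  · simpa using r10
  rintro ρ2 μ2 ⟨r21, r24, r20, rfl⟩
  refine Runs.seq (Q₁ := fun ρ' μ' =>
      ρ' = ρ2 ∧ μ' 6 0 = w ∧ ∀ k', k' ≠ 6 → μ' k' = μ2 k')
    (runs_setCell ?_ ?_ ⟨rfl, ?_, ?_⟩) ?_
  · simp [IExp.eval]
  · simp [NExp.maxAddr, IExp.eval]
  · simp [IExp.eval, NExp.eval, hw]
  · intro k' hk'
    simp [hk']
  rintro ρ3 μ3 ⟨rfl, m36, m3⟩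
  refine Runs.seq (runs_fill (p := p) (N := 2 ^ (k + 1 + 1)) (v := fun u => w ^ u)
    (fun i => (eval_update_of_reg (by norm_num)).trans r24) (by omega)
    (fun i hi => ?_) (fun i hi b _ => ?_)) fun ρ4 μ4 h4 => ?_
  · simp [NExp.maxAddr, IExp.eval]; omega
  · have hW' := hW (i / 2) (by omega)
    simp only [NExp.eval, IExp.eval, Function.update_self, m36, m3 1 (by norm_num), hW',
      Function.update_of_ne (show (1 : ℕ) ≠ 7 by norm_num),
      Function.update_of_ne (show (6 : ℕ) ≠ 7 by norm_num)]
    -- Even powers of the new root are old table entries; an odd power has one more factor w,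
    -- written as 1 + (i mod 2)(w - 1).
    conv_rhs => rw [← Nat.div_add_mod i 2, pow_add, pow_mul, hw2]
    congr 1
    rcases Nat.mod_two_eq_zero_or_one i with h | h <;> simp [h]
  obtain ⟨r4, m4, v4, -⟩ := h4
  refine (runs_fill (p := p) (N := 2 ^ (k + 1 + 1)) (v := fun u => w ^ u)
    (fun i => (eval_update_of_reg (by norm_num)).trans ((r4 4 (by norm_num)).trans r24)) (by omega)
    (fun i hi => ?_) (fun i hi b _ => ?_)).mono le_rfl le_rfl fun ρ5 μ5 h5 => ?_
  · simp [NExp.maxAddr, IExp.eval]; omega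
  · simp [NExp.eval, IExp.eval, v4 i hi]
  obtain ⟨r5, m5, v5, -⟩ := h5
  have h6 : μ5 6 0 = w := by rw [m5 6 (by norm_num), m4 6 (by norm_num), m36]
  refine ⟨⟨?_, ?_, ?_, ?_⟩, ?_, fun k' h1 h6 h7 => ?_⟩
  · rw [r5 1 (by norm_num), r4 1 (by norm_num), r21]
  · rw [r5 4 (by norm_num), r4 4 (by norm_num), r24]
  · rw [h6, hN, pow_mul, hw2, hω]
  · intro u hu
    rw [h6, v5 u hu]
  · rw [r5 0 (by norm_num), r4 0 (by norm_num), r20]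
  · rw [m5 k' h1, m4 k' h7, m3 k' h6]

/-- Multiply the coefficients with the queried sequence. -/
def outputStep : Cmd :=
  .seq (fill 9 (.reg 1) (.query (.reg 2))) (.seq (mulSeries 15 9)
    (fill 18 (.reg 1) (.cell 5 (.reg 2))))

/-- The whole product is recomputed, including entries that were already emitted, and y is queried
on the whole new range at once; doubling makes this affordable. -/
lemma runs_outputStep {ω : ℂ} (h : Ready ω k ρ μ) (hp : 4 * 2 ^ k ≤ p)
    (hF : SeriesCong (2 ^ k) (series μ 15) (PowerSeries.mk (singularSeq (γ : ℂ) (δ : ℂ)))) :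
    Runs y outputStep ρ μ (1000 * ((k + 1) * 2 ^ k)) p fun ρ' μ' =>
      Ready ω k ρ' μ' ∧ ρ' 0 = ρ 0 ∧
      (∀ k', 5 < k' → k' ≠ 9 → k' ≠ 18 → μ' k' = μ k') ∧ Output γ δ y k μ' := by
  have hM : 0 < 2 ^ k := by positivity
  refine Runs.mono (T₁ := (2 + 10) * (2 * 2 ^ k) + (900 * ((k + 1) * 2 ^ k)
    + (2 + 10) * (2 * 2 ^ k))) (Runs.seq (runs_fill_len h (b := 9) (by norm_num) hp
    (v := fun j => (y j : ℂ)) (fun i hi => ?_) (fun i hi c _ => ?_)) fun ρ1 μ1 h1 => ?_)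
    (p := p) (by nlinarith) le_rfl fun _ _ h => h
  · simp [NExp.maxAddr, IExp.eval]; omega
  · simp [NExp.eval, IExp.eval]
  obtain ⟨R1, r1, m1, v1⟩ := h1
  refine Runs.seq (runs_mulSeries_cong R1 (by norm_num) (by norm_num) hp) fun ρ2 μ2 h2 => ?_
  obtain ⟨R2, r2, m2, v2⟩ := h2
  refine (runs_fill_len R2 (b := 18) (by norm_num) hp (v := fun i => μ2 5 i)
    (fun i hi => ?_) (fun i hi c _ => ?_)).mono (by simp [NExp.cost, IExp.cost]) le_rfl
    fun ρ3 μ3 h3 => ?_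
  · simp [NExp.maxAddr, IExp.eval]; omega
  · simp [NExp.eval, IExp.eval]
  obtain ⟨R3, r3, m3, v3⟩ := h3
  refine ⟨R3, ?_, fun k' hk h9 h18 => ?_, seriesCong_series.1 (v3.trans (v2.trans ?_))⟩
  · rw [r3 0 (by norm_num) (by norm_num), r2 0 (by norm_num) (by norm_num),
      r1 0 (by norm_num) (by norm_num)]
  · rw [m3 k' h18, m2 k' (by omega), m1 k' h9]
  · rw [series_congr (m1 15 (by norm_num))]
    exact hF.mul v1

/-- Double the number of coefficients that are known. -/
def double (γ δ : ℝ) : Cmd :=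
  .seq resize (.seq logQuotStep (.seq logLogQuotStep (.seq (singularStep γ δ) outputStep)))

lemma runs_double (h : Prepared γ δ k ρ μ) (hp : 4 * 2 ^ (k + 1) ≤ p) :
    Runs y (double γ δ) ρ μ (14000 * ((k + 2) * 2 ^ (k + 1))) p fun ρ' μ' =>
      Prepared γ δ (k + 1) ρ' μ' ∧ ρ' 0 = ρ 0 ∧ Output γ δ y (k + 1) μ' := by
  have hn : 2 ^ (k + 1) = 2 * 2 ^ k := pow_succ' _ _
  have hM : 0 < 2 ^ (k + 1) := by positivity
  refine Runs.mono ((runs_resize h.len h.root h.table hp).seq fun ρ1 μ1 h1 => ?_)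
    (T₁ := 200 * 2 ^ (k + 1) + (3100 * ((k + 1 + 1) * 2 ^ (k + 1)) + (3100 *
      ((k + 1 + 1) * 2 ^ (k + 1)) + (6100 * ((k + 1 + 1) * 2 ^ (k + 1)) +
      1000 * ((k + 1 + 1) * 2 ^ (k + 1)))))) (by nlinarith) le_rfl fun _ _ h => h
  obtain ⟨R1, r1, m1⟩ := h1
  have e10 : series μ1 10 = series μ 10 :=
    series_congr (m1 10 (by norm_num) (by norm_num) (by norm_num))
  refine (runs_logQuotStep R1 hp hn (by rw [e10]; exact h.logQuot)).seq fun ρ2 μ2 h2 => ?_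
  obtain ⟨R2, r2, m2, i2, v2⟩ := h2
  have hm2 : ∀ k', 11 < k' → k' ≠ 17 → μ2 k' = μ k' := fun k' hk h17 =>
    (m2 k' (by omega) h17 (by omega) (by omega) (by omega) (by omega)).trans
      (m1 k' (by omega) (by omega) (by omega))
  refine (runs_logLogQuotStep R2 hp hn v2
    (by rw [series_congr (hm2 13 (by norm_num) (by norm_num))]; exact h.logLogQuot)).seq
    fun ρ3 μ3 h3 => ?_
  obtain ⟨R3, r3, m3, i3, v3⟩ := h3
  have hm3 : ∀ k', 14 < k' → k' ≠ 17 → μ3 k' = μ k' := fun k' hk h17 =>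
    (m3 k' (by omega) h17 (by omega) (by omega) (by omega) (by omega)).trans
      (hm2 k' (by omega) h17)
  have e3 : ∀ k', k' = 6 ∨ k' = 10 ∨ k' = 11 → μ3 k' = μ2 k' := fun k' hk' =>
    m3 k' (by omega) (by omega) (by omega) (by omega) (by omega) (by omega)
  refine (runs_singularStep R3 hp hn (by rw [series_congr (e3 11 (by norm_num))]; exact v2) v3
    (by rw [series_congr (hm3 15 (by norm_num) (by norm_num))]; exact h.singular)
    (by rw [series_congr (hm3 16 (by norm_num) (by norm_num))]; exact h.inverse)).seq
    fun ρ4 μ4 h4 => ?_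
  obtain ⟨R4, r4, m4, v4, i4⟩ := h4
  have e4 : ∀ k', k' = 6 ∨ k' = 10 ∨ k' = 13 → μ4 k' = μ3 k' := fun k' hk' =>
    m4 k' (by omega) (by omega) (by omega) (by omega) (by omega) (by omega)
  refine (runs_outputStep R4 hp v4).mono le_rfl le_rfl fun ρ5 μ5 h5 => ?_
  obtain ⟨R5, r5, m5, o5⟩ := h5
  have e6 : μ5 6 = μ1 6 := by
    rw [m5 6 (by norm_num) (by norm_num) (by norm_num), e4 6 (by norm_num), e3 6 (by norm_num),
      m2 6 (by norm_num) (by norm_num) (by norm_num) (by norm_num) (by norm_num) (by norm_num)]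
  refine ⟨⟨R5.len, ?_, fun u hu => ?_, ?_, ?_, ?_, ?_⟩, ?_, o5⟩
  · rw [e6]; exact R1.root
  · rw [e6]; exact R5.table u hu
  · rw [series_congr (m5 10 (by norm_num) (by norm_num) (by norm_num)),
      series_congr (e4 10 (by norm_num)), series_congr (e3 10 (by norm_num))]
    exact i2
  · rw [series_congr (m5 13 (by norm_num) (by norm_num) (by norm_num)),
      series_congr (e4 13 (by norm_num))]
    exact i3
  · rw [series_congr (m5 15 (by norm_num) (by norm_num) (by norm_num))]
    exact v4
  · rw [series_congr (m5 16 (by norm_num) (by norm_num) (by norm_num))]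
    exact i4
  · rw [r5, r4 0 (by norm_num) (by norm_num), r3 0 (by norm_num) (by norm_num),
      r2 0 (by norm_num) (by norm_num), r1]

/-- The first coefficients. -/
def start : Cmd :=
  .seq (.setReg 1 (.const 1)) (.seq (.setCell 6 (.const 0) (.const (-1)))
    (.seq (.setCell 1 (.const 0) (.const 1)) (.seq (.setCell 1 (.const 1) (.const (-1)))
    (.seq (.setCell 10 (.const 0) (.const 1)) (.seq (.setCell 13 (.const 0) (.const 1))
    (.seq (.setCell 15 (.const 0) (.const 1)) (.setCell 16 (.const 0) (.const 1))))))))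

/-- At precision 1 all the series and their inverses are 1, and the root of unity is -1. -/
lemma runs_start (hp : 1 ≤ p) (hμ : ∀ k i, μ k i = 0) :
    Runs y start ρ μ 23 p fun ρ' μ' => Prepared γ δ 0 ρ' μ' ∧ ρ' 0 = ρ 0 := by
  refine Runs.seq (T₁ := 2) (T₂ := 21) (Q₁ := fun ρ' μ' => ρ' = Function.update ρ 1 1 ∧ μ' = μ)
    (runs_setReg (e := .const 1) hp ⟨rfl, rfl⟩) ?_
  rintro _ _ ⟨rfl, rfl⟩
  refine Runs.seq (T₁ := 3) (T₂ := 18) (runs_setCell (i := .const 0) (e := .const (-1))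
    (Nat.zero_le _) (Nat.zero_le _) ⟨rfl, rfl⟩) (Q₁ := fun ρ' μ' => ρ' = _ ∧ μ' = _) ?_
  rintro _ _ ⟨rfl, rfl⟩
  refine Runs.seq (T₁ := 3) (T₂ := 15) (runs_setCell (i := .const 0) (e := .const 1)
    (Nat.zero_le _) (Nat.zero_le _) ⟨rfl, rfl⟩) (Q₁ := fun ρ' μ' => ρ' = _ ∧ μ' = _) ?_
  rintro _ _ ⟨rfl, rfl⟩
  refine Runs.seq (T₁ := 3) (T₂ := 12) (runs_setCell (i := .const 1) (e := .const (-1))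
    hp (Nat.zero_le _) ⟨rfl, rfl⟩) (Q₁ := fun ρ' μ' => ρ' = _ ∧ μ' = _) ?_
  rintro _ _ ⟨rfl, rfl⟩
  refine Runs.seq (T₁ := 3) (T₂ := 9) (runs_setCell (i := .const 0) (e := .const 1)
    (Nat.zero_le _) (Nat.zero_le _) ⟨rfl, rfl⟩) (Q₁ := fun ρ' μ' => ρ' = _ ∧ μ' = _) ?_
  rintro _ _ ⟨rfl, rfl⟩
  refine Runs.seq (T₁ := 3) (T₂ := 6) (runs_setCell (i := .const 0) (e := .const 1)
    (Nat.zero_le _) (Nat.zero_le _) ⟨rfl, rfl⟩) (Q₁ := fun ρ' μ' => ρ' = _ ∧ μ' = _) ?_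
  rintro _ _ ⟨rfl, rfl⟩
  refine Runs.seq (T₁ := 3) (T₂ := 3) (runs_setCell (i := .const 0) (e := .const 1)
    (Nat.zero_le _) (Nat.zero_le _) ⟨rfl, rfl⟩) (Q₁ := fun ρ' μ' => ρ' = _ ∧ μ' = _) ?_
  rintro _ _ ⟨rfl, rfl⟩
  refine runs_setCell (i := .const 0) (e := .const 1) (Nat.zero_le _) (Nat.zero_le _)
    ⟨⟨?_, ?_, ?_, ?_, ?_, ?_, ?_⟩, ?_⟩
  · simp
  · simp [NExp.eval, IExp.eval]
  · intro u hu
    have hu' : u = 0 ∨ u = 1 := by omega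
    rcases hu' with rfl | rfl <;> simp [NExp.eval, IExp.eval]
  all_goals simp [SeriesCong.iff_coeff, series, NExp.eval, IExp.eval, logQuotSeq_zero,
      logLogQuotSeq_zero, singularSeq, odeSeq_zero]

/-- The streaming program: register `0` counts the time steps, and whenever the coefficients do
not suffice for the next step, their number is doubled. -/
def stream (γ δ : ℝ) : Cmd :=
  .seq (.ite (.reg 1) (.const 1) start .skip)
    (.seq (.ite (.reg 1) (.add (.reg 0) (.const 2)) (double γ δ) .skip)
    (.seq (.setCell 0 (.const 0) (.cell 18 (.reg 0)))
      (.setReg 0 (.add (.reg 0) (.const 1)))))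

/-- The result of the first `t` steps. -/
structure Streamed (γ δ : ℝ) (y : ℕ → ℝ) (t k : ℕ) (ρ : ℕ → ℕ) (μ : ℕ → ℕ → ℂ) : Prop where
  count : ρ 0 = t
  prepared : Prepared γ δ k ρ μ
  output : Output γ δ y k μ

/-- The result of step `t`. -/
def StepDone (γ δ : ℝ) (y : ℕ → ℝ) (t k : ℕ) (ρ : ℕ → ℕ) (μ : ℕ → ℕ → ℂ) : Prop :=
  Streamed γ δ y (t + 1) k ρ μ ∧ μ 0 0 = PowerSeries.coeff t
    (PowerSeries.mk (singularSeq (γ : ℂ) (δ : ℂ)) * PowerSeries.mk fun j => (y j : ℂ))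

lemma Prepared.congr {ρ' : ℕ → ℕ} {μ' : ℕ → ℕ → ℂ} (h : Prepared γ δ k ρ μ) (hρ : ρ' 1 = ρ 1)
    (hμ : ∀ k', k' ≠ 0 → μ' k' = μ k') : Prepared γ δ k ρ' μ' := by
  refine ⟨hρ.trans h.len, ?_, ?_, ?_, ?_, ?_, ?_⟩
  · rw [hμ 6 (by norm_num)]; exact h.root
  · rw [hμ 6 (by norm_num), hμ 1 (by norm_num)]; exact h.table
  · rw [series_congr (hμ 10 (by norm_num))]; exact h.logQuot
  · rw [series_congr (hμ 13 (by norm_num))]; exact h.logLogQuot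
  · rw [series_congr (hμ 15 (by norm_num))]; exact h.singular
  · rw [series_congr (hμ 16 (by norm_num))]; exact h.inverse

lemma runs_emit (h : Streamed γ δ y t k ρ μ) (ht : t + 2 ≤ 2 ^ k) (hp : 4 * 2 ^ k ≤ p) :
    Runs y (.seq (.setCell 0 (.const 0) (.cell 18 (.reg 0))) (.setReg 0 (.add (.reg 0) (.const 1))))
      ρ μ 8 p (StepDone γ δ y t k) := by
  refine Runs.seq (T₁ := 4) (T₂ := 4) (runs_setCell (i := .const 0) (e := .cell 18 (.reg 0))
    (Nat.zero_le _) ?_ ⟨rfl, rfl⟩) (Q₁ := fun ρ' μ' => ρ' = _ ∧ μ' = _) ?_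
  · simp [NExp.maxAddr, IExp.eval, h.count]; omega
  rintro _ _ ⟨rfl, rfl⟩
  refine runs_setReg (e := .add (.reg 0) (.const 1)) ?_ ⟨⟨?_, h.prepared.congr ?_ ?_, ?_⟩, ?_⟩
  · simp [IExp.eval, h.count]; omega
  · simp [IExp.eval, h.count]
  · simp
  · intro k' hk'
    simp [hk']
  · intro i hi
    simpa using h.output i hi
  · simp [IExp.eval, NExp.eval, h.count, h.output t (by omega)]

lemma runs_grow (hc : ρ 0 = t) (h : Prepared γ δ k ρ μ) (ht : 2 ^ k < t + 2)
    (ht' : t + 2 ≤ 2 ^ (k + 1)) (hp : 4 * 2 ^ (k + 1) ≤ p) :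
    Runs y (.seq (.ite (.reg 1) (.add (.reg 0) (.const 2)) (double γ δ) .skip)
      (.seq (.setCell 0 (.const 0) (.cell 18 (.reg 0))) (.setReg 0 (.add (.reg 0) (.const 1)))))
      ρ μ (14000 * ((k + 2) * 2 ^ (k + 1)) + 20) p (StepDone γ δ y t (k + 1)) := by
  refine Runs.mono (T₁ := (5 + 14000 * ((k + 2) * 2 ^ (k + 1))) + 8) (Runs.seq
    (runs_ite (a := .reg 1) (b := .add (.reg 0) (.const 2)) (fun _ => runs_double h hp)
      fun h' => absurd ?_ h') fun ρ1 μ1 h1 => ?_) (by omega) le_rfl fun _ _ h => h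
  · simp only [IExp.eval, h.len, hc]
    exact ht
  · exact runs_emit ⟨h1.2.1.trans hc, h1.1, h1.2.2⟩ ht' hp

/-- `start` computes no output. The threshold t + 2, instead of t + 1, forces a doubling in the very
first step, which does. -/
lemma runs_stream_first (hρ : ∀ x, ρ x = 0) (hμ : ∀ k i, μ k i = 0) :
    Runs y (stream γ δ) ρ μ (14000 * (2 * 2) + 50) 8 (StepDone γ δ y 0 1) := by
  refine Runs.mono (T₁ := (3 + 23) + (14000 * ((0 + 2) * 2 ^ (0 + 1)) + 20)) (Runs.seq
    (runs_ite (a := .reg 1) (b := .const 1)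
      (fun _ => runs_start (γ := γ) (δ := δ) (by norm_num) hμ) fun h' => absurd ?_ h')
    fun ρ1 μ1 h1 => ?_) (by norm_num) le_rfl fun _ _ h => h
  · simp [IExp.eval, hρ]
  · exact runs_grow (h1.2.trans (hρ 0)) h1.1 (by norm_num) (by norm_num) (by norm_num)

lemma runs_stream_grow (h : Streamed γ δ y t k ρ μ) (ht : 2 ^ k < t + 2)
    (ht' : t + 2 ≤ 2 ^ (k + 1)) :
    Runs y (stream γ δ) ρ μ (14000 * ((k + 2) * 2 ^ (k + 1)) + 50) (4 * 2 ^ (k + 1))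
      (StepDone γ δ y t (k + 1)) := by
  refine Runs.mono (T₁ := (3 + 1) + (14000 * ((k + 2) * 2 ^ (k + 1)) + 20)) (Runs.seq
    (runs_ite (a := .reg 1) (b := .const 1) (fun h' => absurd h' ?_)
      fun _ => runs_skip (Q := fun ρ' μ' => ρ' = ρ ∧ μ' = μ) ⟨rfl, rfl⟩)
    fun ρ1 μ1 h1 => ?_) (by omega) le_rfl fun _ _ h => h
  · simp [IExp.eval, h.prepared.len]
  · obtain ⟨rfl, rfl⟩ := h1
    exact runs_grow h.count h.prepared ht ht' le_rfl

lemma runs_stream_keep (h : Streamed γ δ y t k ρ μ) (ht : t + 2 ≤ 2 ^ k) :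
    Runs y (stream γ δ) ρ μ 50 (4 * 2 ^ k) (StepDone γ δ y t k) := by
  refine Runs.mono (T₁ := (3 + 1) + ((5 + 1) + 8)) (Runs.seq
    (runs_ite (a := .reg 1) (b := .const 1) (fun h' => absurd h' ?_)
      fun _ => runs_skip (Q := fun ρ' μ' => ρ' = ρ ∧ μ' = μ) ⟨rfl, rfl⟩)
    fun ρ1 μ1 h1 => ?_) (by norm_num) le_rfl fun _ _ h => h
  · simp [IExp.eval, h.prepared.len]
  obtain ⟨rfl, rfl⟩ := h1
  refine Runs.seq (runs_ite (a := .reg 1) (b := .add (.reg 0) (.const 2)) (fun h' => absurd h' ?_)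
      fun _ => runs_skip (Q := fun ρ' μ' => ρ' = ρ1 ∧ μ' = μ1) ⟨rfl, rfl⟩) fun ρ2 μ2 h2 => ?_
  · simp only [IExp.eval, h.prepared.len, h.count]
    omega
  · obtain ⟨rfl, rfl⟩ := h2
    exact runs_emit h ht le_rfl

/-- The invariant of the stream after `t` steps. -/
def StreamInv (γ δ : ℝ) (y : ℕ → ℝ) (t : ℕ) (s : State) : Prop :=
  (t = 0 ∧ s = State.init) ∨ ∃ k, Streamed γ δ y t k s.reg s.mem ∧ t + 1 ≤ 2 ^ k ∧
    2 ^ k ≤ 2 * t ∧ s.time ≤ 50 * t + 28000 * ((k + 1) * 2 ^ k) ∧ s.peak ≤ 4 * 2 ^ k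

lemma StreamInv.step {s : State} (h : StreamInv γ δ y t s) :
    ∃ s', Exec y (stream γ δ) s s' ∧ s'.mem 0 0 = PowerSeries.coeff t
      (PowerSeries.mk (singularSeq (γ : ℂ) (δ : ℂ)) * PowerSeries.mk fun j => (y j : ℂ)) ∧
      StreamInv γ δ y (t + 1) s' := by
  rcases h with ⟨rfl, rfl⟩ | ⟨k, h, h1, h2, h3, h4⟩
  · obtain ⟨s', e, hT, hP, hs, ho⟩ := runs_stream_first (y := y) (γ := γ) (δ := δ)
      (ρ := State.init.reg) (μ := State.init.mem) (fun _ => rfl) (fun _ _ => rfl)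
      State.init rfl rfl
    refine ⟨s', e, ho, Or.inr ⟨1, hs, by norm_num, by norm_num, hT.trans ?_, hP.trans ?_⟩⟩
    · simp [State.init]
    · simp [State.init]
  · have hk : 2 ^ (k + 1) = 2 * 2 ^ k := pow_succ' _ _
    rcases lt_or_ge (2 ^ k) (t + 2) with hlt | hge
    · obtain ⟨s', e, hT, hP, hs, ho⟩ := runs_stream_grow h hlt (by omega) s rfl rfl
      refine ⟨s', e, ho, Or.inr ⟨k + 1, hs, by omega, by omega, hT.trans ?_, hP.trans ?_⟩⟩
      -- The allowance 28000 (k+1) 2^k grows by 28000 (k+3) 2^k, while the doubling costs 28000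
      -- (k+2) 2^k besides the constant 50.
      · have e1 : (k + 1 + 1) * 2 ^ (k + 1) = (k + 2) * 2 ^ (k + 1) := rfl
        have e2 : (k + 2) * 2 ^ (k + 1) = 2 * ((k + 1) * 2 ^ k) + 2 * 2 ^ k := by ring
        rw [e1, e2] at *
        omega
      · omega
    · obtain ⟨s', e, hT, hP, hs, ho⟩ := runs_stream_keep h hge s rfl rfl
      exact ⟨s', e, ho, Or.inr ⟨k, hs, by omega, by omega, hT.trans (by omega), by omega⟩⟩

lemma StreamInv.bounds {s : State} (h : StreamInv γ δ y (t + 1) s) :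
    (s.time : ℝ) ≤ 1000000 * (t + 1) * Real.log (t + 2) ∧
      (s.peak : ℝ) ≤ 1000000 * (t + 1) := by
  rcases h with ⟨h, -⟩ | ⟨k, -, -, h2, h3, h4⟩
  · omega
  have h2' : (2 : ℝ) ^ k ≤ 2 * (t + 1) := by exact_mod_cast h2
  have h3' : (s.time : ℝ) ≤ 50 * (t + 1) + 28000 * ((k + 1) * 2 ^ k) := by exact_mod_cast h3
  have h4' : (s.peak : ℝ) ≤ 4 * 2 ^ k := by exact_mod_cast h4
  have ht : (0 : ℝ) ≤ t := t.cast_nonneg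
  refine ⟨?_, by linarith⟩
  have hl2 := Real.log_two_gt_d9
  have hl : Real.log 2 ≤ Real.log (t + 2) := Real.log_le_log (by norm_num) (by linarith)
  have hk : k * Real.log 2 ≤ Real.log 2 + Real.log (t + 2) := by
    rw [← Real.log_pow, ← Real.log_mul (by norm_num) (by positivity)]
    exact Real.log_le_log (by positivity) (by linarith)
  have hk1 : (k : ℝ) + 1 ≤ 5 * Real.log (t + 2) := by
    nlinarith [(k.cast_nonneg : (0 : ℝ) ≤ k)]
  have h5 : ((k : ℝ) + 1) * 2 ^ k ≤ 5 * Real.log (t + 2) * (2 * (t + 1)) :=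
    mul_le_mul hk1 h2' (by positivity) (by linarith)
  nlinarith [mul_nonneg ht (show 0 ≤ Real.log (t + 2) - 1 / 2 by linarith)]

end RAM

/-- The lower-triangular Toeplitz matrix of the coefficients of `singularFn γ δ` can be streamed
in amortized logarithmic time. -/
theorem isStreamable_ltt_singularSeq (γ δ : ℝ) : IsStreamable (ltt (singularSeq γ δ)) := by
  refine ⟨RAM.stream γ δ, 1000000, fun y => ?_⟩
  choose! next hE hO hI using fun (t : ℕ) (s : RAM.State) (h : RAM.StreamInv γ δ y t s) => h.step
  set s : ℕ → RAM.State := fun t => Nat.rec RAM.State.init next t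
  have hs : ∀ t, RAM.StreamInv γ δ y t (s t) := by
    intro t
    induction t with
    | zero => exact Or.inl ⟨rfl, rfl⟩
    | succ t ih => exact hI t _ ih
  refine ⟨s, rfl, fun t => ⟨hE t _ (hs t), ?_, (hs (t + 1)).bounds⟩⟩
  rw [show (s (t + 1)).mem 0 0 = _ from hO t _ (hs t), mul_comm, coeff_mul_eq_sum_range, ltMulVec]
  push_cast
  refine Finset.sum_congr rfl fun j hj => ?_
  rw [Finset.mem_range] at hj
  rw [PowerSeries.coeff_mk, PowerSeries.coeff_mk, ltt_apply, if_pos (by omega), mul_comm]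
  congr 1
  exact (map_singularSeq Complex.ofRealHom γ δ (t - j)).symm

/-! ### Assembly of the theorem -/

/-- The factors given by the singular functions. -/
theorem isGoodFactorization_singularSeq {α δ : ℝ} (hα : 0 < α) (hδ : 0 ≤ δ) :
    IsGoodFactorization α (ltt (singularSeq (1 / 2 + α) (-δ)))
      (ltt (singularSeq (-(1 / 2 + α)) δ)) √(∑' n, singularSeq (-(1 / 2 + α)) δ n ^ 2) ∧
    (IsRatComputable α → IsRatComputable δ →
      IsComputableReal √(∑' n, singularSeq (-(1 / 2 + α)) δ n ^ 2)) := by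
  -- Here 2γ = -1 - 2α, so β = -1 - α leaves room α for the log-log factor and is still α below the
  -- threshold -1 of summability.
  obtain ⟨K, hK, hr⟩ := exists_block_sum_singularSeq_sq_le (γ := -(1 / 2 + α)) (δ := δ)
    (β := -1 - α) (Or.inl (by linarith))
  -- The log-log exponent is nonpositive here, so β = 2γ is admissible without loss.
  obtain ⟨K', hK', hl⟩ := exists_block_sum_singularSeq_sq_le (γ := 1 / 2 + α) (δ := -δ)
    (β := 1 + 2 * α) (Or.inr ⟨by linarith, by linarith⟩)
  obtain ⟨hs, D, -, htail⟩ := summable_of_block_le (fun _ => sq_nonneg _) hK hα hr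
  refine ⟨⟨leading_ltt_mul_leading_ltt ?_, tendsto_colNorm_leading_ltt hs,
    rowNorm_isBigO hK' hα hl, isStreamable_ltt_singularSeq _ _⟩, fun h1 h2 =>
    isComputableReal_sqrt_tsum_sq h1.neg_half_add h2 hs (half_pos hα) htail⟩
  simpa only [neg_neg] using mk_singularSeq_mul_neg (1 / 2 + α) (-δ)

lemma IsGoodFactorization.of_le {α α' C : ℝ} {L R : Matrix ℕ ℕ ℝ}
    (h : IsGoodFactorization α' L R C) (hα : α' ≤ α) : IsGoodFactorization α L R C := by
  obtain ⟨h1, h2, h3, h4⟩ := h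
  refine ⟨h1, h2, h3.trans (IsBigO.of_bound 1 ?_), h4⟩
  have hlog := Real.tendsto_log_atTop.comp tendsto_natCast_atTop_atTop
  filter_upwards [hlog.eventually_ge_atTop 1] with n hn
  have hn : 1 ≤ Real.log n := hn
  rw [one_mul, Real.norm_of_nonneg (by positivity), Real.norm_of_nonneg (by positivity)]
  exact Real.rpow_le_rpow_of_exponent_le hn (by linarith)

end

theorem theorem1 (α : ℝ) (hα : 0 < α) :
    (∃ (L R : Matrix ℕ ℕ ℝ) (C : ℝ),
      IsLTToeplitz L ∧ IsLTToeplitz R ∧ IsGoodFactorization α L R C ∧ IsComputableReal C) ∧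
    (∀ δ : ℝ, 0 ≤ δ → ∃ (l r : ℕ → ℝ) (C : ℝ),
      IsTaylorOnDisc (singularFn (1 / 2 + α) (-δ)) l ∧
      IsTaylorOnDisc (singularFn (-(1 / 2 + α)) δ) r ∧
      IsGoodFactorization α (ltt l) (ltt r) C ∧
      (IsComputableReal α → IsComputableReal δ → IsComputableReal C)) := by
  refine ⟨?_, fun δ hδ => ⟨_, _, _, isTaylorOnDisc_singularFn _ _, isTaylorOnDisc_singularFn _ _,
    (isGoodFactorization_singularSeq hα hδ).1, fun h1 h2 =>
      (isGoodFactorization_singularSeq hα hδ).2 h1.isRatComputable h2.isRatComputable⟩⟩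
  -- A computable limit is claimed even if α is not computable, so a rational exponent below α is
  -- used.
  obtain ⟨k, hk⟩ := exists_nat_one_div_lt hα
  have hk0 : (0 : ℝ) < 1 / ((k : ℝ) + 1) := by positivity
  have hval : RatCode.val (1, 0, k) = 1 / ((k : ℝ) + 1) := by simp [RatCode.val]
  have hgood := isGoodFactorization_singularSeq hk0 le_rfl
  refine ⟨_, _, _, ⟨_, rfl⟩, ⟨_, rfl⟩, hgood.1.of_le hk.le, hgood.2 ?_ ?_⟩
  · rw [← hval]
    exact isRatComputable_val _
  · have h0 := isRatComputable_val (RatCode.ofNat 0)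
    rwa [RatCode.val_ofNat, Nat.cast_zero] at h0
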